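/- Let $\mathcal G$ be a Lie groupoid over an $n$-dimensional (Hausdorff, second countable) smooth manifold $M$, with source $s$, target $t$, units $1_x$, and with $s$-fibres of constant dimension $r$. Let $A=\ker(ds)|_{M}$ be its Lie algebroid. For $F=\Lambda^{\mathrm{top}}(\cdot)^*$ or $F=|\Lambda^{\mathrm{top}}(\cdot)^*|$ (densities) consider the line bundle $F^{\mathrm{tr}}_A=F(A^*)\otimes F(TM)$, that is, the transverse volume bundle $\mathcal V^{\mathrm{tr}}_A$ or the transverse density bundle $\mathcal D^{\mathrm{tr}}_A$, with its canonical action of $\mathcal G$: for $g:x\to y$, the isomorphism $g_*:F^{\mathrm{tr}}_{A,x}\to F^{\mathrm{tr}}_{A,y}$ is induced by the two isomorphisms $$F(A_y)\otimes F(T_xM)\cong F(T_g\mathcal G)\cong F(A_x)\otimes F(T_yM)$$ given by the exact sequences $0\to A_y\to T_g\mathcal G\xrightarrow{ds}T_xM\to0$ (with the differential of $h\mapsto hg$ at $1_y$) and $0\to A_x\to T_g\mathcal G\xrightarrow{dt}T_yM\to 0$ (with minus the differential of $h\mapsto gh^{-1}$ at $1_x$). $\mathcal G$ is *transversely orientable*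 if $\mathcal V^{\mathrm{tr}}_A$ has an orientation preserved by the action of $\mathcal G$; a *transverse volume form* is a nowhere vanishing $\mathcal G$-invariant smooth section of $\mathcal V^{\mathrm{tr}}_A$. The *modular class* $\mathrm{mod}(\mathcal G)\in H^1_{\mathrm{diff}}(\mathcal G)$ (smooth functions $c$ on $\mathcal G$ with $c(gh)=c(g)+c(h)$, modulo those of the form $f\circ s-f\circ t$ with $f\in C^\infty(M)$) is the class of $c_\sigma(g)=\ln\big(\sigma(y)/g_*\sigma(x)\big)$, $g:x\to y$, for any smooth strictly positive section $\sigma$ of $\mathcal D^{\mathrm{tr}}_A$. For an open cover $\mathcal U$ of $M$ let $\mathcal G_{\mathcal U}$ be the pull-back of $\mathcal G$ to the disjoint union of the members of $\mathcal U$, and let $\check H^1_{\mathrm{diff}}(\mathcal G,\mathbb Z_2)=\varinjlim_{\mathcal U}H^1_{\mathrm{diff}}(\mathcal G_{\mathcal U},\mathbb Z_2)$, with $\mathbb Z_2=\{\pm1\}$ and the colimit taken over refinements of covers. The *transverse first Stiefel–Whitney class* $w_1^{\mathrm{tr}}(\mathcal G)\in\check H^1_{\mathrm{diff}}(\mathcal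 G,\mathbb Z_2)$ is the class of the cocycle $\operatorname{sign}\tilde c$ on $\mathcal G_{\mathcal U}$, where $\mathcal U$ is an open cover over whose members $U$ there are nowhere vanishing smooth sections $\sigma_U$ of $\mathcal V^{\mathrm{tr}}_A$, and $g_*\sigma_U(x)=\tilde c(g)\,\sigma_V(y)$ for an arrow $g:(U,x)\to(V,y)$ of $\mathcal G_{\mathcal U}$. Then these two classes exist and do not depend on the choices made, and: 1. $\mathcal G$ is transversely orientable if and only if $w_1^{\mathrm{tr}}(\mathcal G)=1$. 2. $\mathcal G$ admits a transverse volume form if and only if $\mathrm{mod}(\mathcal G)=0$ and $w_1^{\mathrm{tr}}(\mathcal G)=1$. -/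

import Mathlib

open scoped Manifold ContDiff Topology
open TopologicalSpace

noncomputable section

/-! ### Groupoids over a set of objects -/

/-- A groupoid with set of objects `M` and set of arrows `G`. An arrow `g` goes from `src g` to
`tgt g`, and `mul g h` is the composition `g ∘ h`, meaningful (and constrained) only if
`src g = tgt h`. -/
structure GroupoidOver (M G : Type*) where
  src : G → M
  tgt : G → M
  unit : M → G
  inv : G → G
  mul : G → G → G
  src_unit : ∀ x, src (unit x) = x
  tgt_unit : ∀ x, tgt (unit x) = x
  src_inv : ∀ g, src (inv g) = tgt g
  tgt_inv : ∀ g, tgt (inv g) = src g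
  src_mul : ∀ g h, src g = tgt h → src (mul g h) = src h
  tgt_mul : ∀ g h, src g = tgt h → tgt (mul g h) = tgt g
  mul_assoc : ∀ g h k, src g = tgt h → src h = tgt k → mul (mul g h) k = mul g (mul h k)
  mul_unit : ∀ g, mul g (unit (src g)) = g
  unit_mul : ∀ g, mul (unit (tgt g)) g = g
  inv_mul : ∀ g, mul (inv g) g = unit (src g)
  mul_inv : ∀ g, mul g (inv g) = unit (tgt g)

namespace GroupoidOver

variable {M G N N' N'' : Type*}

/-- The arrows `(y, g, x)`, `g : f x → f y`, of the pull-back of a groupoid along `f : N → M`. -/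
abbrev PullbackArrow (𝒢 : GroupoidOver M G) (f : N → M) : Type _ :=
  {p : N × G × N // 𝒢.tgt p.2.1 = f p.1 ∧ 𝒢.src p.2.1 = f p.2.2}

open Classical in
/-- The pull-back of a groupoid along a map `f : N → M`. -/
def pullback (𝒢 : GroupoidOver M G) (f : N → M) : GroupoidOver N (𝒢.PullbackArrow f) where
  src p := p.1.2.2
  tgt p := p.1.1
  unit y := ⟨(y, 𝒢.unit (f y), y), 𝒢.tgt_unit _, 𝒢.src_unit _⟩
  inv p := ⟨(p.1.2.2, 𝒢.inv p.1.2.1, p.1.1), by simp [𝒢.tgt_inv, p.2.2],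
    by simp [𝒢.src_inv, p.2.1]⟩
  mul p q :=
    if h : p.1.2.2 = q.1.1 then
      ⟨(p.1.1, 𝒢.mul p.1.2.1 q.1.2.1, q.1.2.2),
        by
          have hc : 𝒢.src p.1.2.1 = 𝒢.tgt q.1.2.1 := by rw [p.2.2, q.2.1, h]
          exact ⟨(𝒢.tgt_mul _ _ hc).trans p.2.1, (𝒢.src_mul _ _ hc).trans q.2.2⟩⟩
    else p
  src_unit _ := rfl
  tgt_unit _ := rfl
  src_inv _ := rfl
  tgt_inv _ := rfl
  src_mul p q h := by rw [dif_pos h]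
  tgt_mul p q h := by rw [dif_pos h]
  mul_assoc p q k h h' := by
    have h1 : 𝒢.src p.1.2.1 = 𝒢.tgt q.1.2.1 := by rw [p.2.2, q.2.1, h]
    have h2 : 𝒢.src q.1.2.1 = 𝒢.tgt k.1.2.1 := by rw [q.2.2, k.2.1, h']
    simp only [dif_pos h, dif_pos h', 𝒢.mul_assoc _ _ _ h1 h2]
  mul_unit p := by
    rw [dif_pos rfl]
    apply Subtype.ext
    have := 𝒢.mul_unit p.1.2.1
    rw [p.2.2] at this
    simp [this]
  unit_mul p := by
    rw [dif_pos rfl]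
    apply Subtype.ext
    have := 𝒢.unit_mul p.1.2.1
    rw [p.2.1] at this
    simp [this]
  inv_mul p := by
    rw [dif_pos rfl]
    apply Subtype.ext
    simp [𝒢.inv_mul, p.2.2]
  mul_inv p := by
    rw [dif_pos rfl]
    apply Subtype.ext
    simp [𝒢.mul_inv, p.2.1]

/-- The map induced on the arrows of pull-back groupoids by a map of the objects over `M`. -/
def pullbackArrowMap (𝒢 : GroupoidOver M G) {f : N → M} {f' : N' → M} (φ : N' → N)
    (h : ∀ y, f (φ y) = f' y) (p : 𝒢.PullbackArrow f') : 𝒢.PullbackArrow f :=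
  ⟨(φ p.1.1, p.1.2.1, φ p.1.2.2), by simp [h, p.2.1], by simp [h, p.2.2]⟩

theorem pullback_mul_val (𝒢 : GroupoidOver M G) (f : N → M) (p q : 𝒢.PullbackArrow f)
    (h : p.1.2.2 = q.1.1) :
    ((𝒢.pullback f).mul p q).1 = (p.1.1, 𝒢.mul p.1.2.1 q.1.2.1, q.1.2.2) := by
  simp [pullback, dif_pos h]

/-! ### Degree one differentiable cohomology with coefficients in a discrete abelian group

A smooth map into a discrete (that is, zero-dimensional Lie) group is a locally constant map. -/

section Discrete

variable (A : Type*) [CommGroup A]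

/-- The group of differentiable `1`-cocycles with values in the discrete abelian group `A`. -/
def discreteCocycles [TopologicalSpace G] (𝒢 : GroupoidOver M G) : Subgroup (G → A) where
  carrier := {c | IsLocallyConstant c ∧
    ∀ g h, 𝒢.src g = 𝒢.tgt h → c (𝒢.mul g h) = c g * c h}
  one_mem' := ⟨IsLocallyConstant.const 1, fun _ _ _ => by simp⟩
  mul_mem' := fun {c d} hc hd => ⟨hc.1.mul hd.1, fun g h e => by
    simp only [Pi.mul_apply, hc.2 g h e, hd.2 g h e]; exact mul_mul_mul_comm _ _ _ _⟩
  inv_mem' := fun {c} hc => ⟨hc.1.inv, fun g h e => by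
    simp only [Pi.inv_apply, hc.2 g h e, _root_.mul_inv]⟩

/-- The subgroup of coboundaries `g ↦ f (src g) / f (tgt g)`, with `f` locally constant. -/
def discreteCoboundaries [TopologicalSpace M] [TopologicalSpace G] (𝒢 : GroupoidOver M G) :
    Subgroup (𝒢.discreteCocycles A) where
  carrier := {c | ∃ f : M → A, IsLocallyConstant f ∧ ∀ g, c.1 g = f (𝒢.src g) / f (𝒢.tgt g)}
  one_mem' := ⟨1, IsLocallyConstant.const 1, fun _ => by simp⟩
  mul_mem' := by
    rintro c d ⟨f, hf, hcf⟩ ⟨k, hk, hdk⟩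
    exact ⟨f * k, hf.mul hk, fun g => by
      simp [hcf, hdk, mul_div_mul_comm]⟩
  inv_mem' := by
    rintro c ⟨f, hf, hcf⟩
    exact ⟨f⁻¹, hf.inv, fun g => by simp [hcf, div_eq_mul_inv, mul_comm]⟩

/-- The differentiable cohomology group `H¹(𝒢, A)`, for a discrete abelian group `A`. -/
abbrev discreteH1 [TopologicalSpace M] [TopologicalSpace G] (𝒢 : GroupoidOver M G) : Type _ :=
  𝒢.discreteCocycles A ⧸ 𝒢.discreteCoboundaries A

variable {A}
variable [TopologicalSpace G] [TopologicalSpace N] [TopologicalSpace N'] [TopologicalSpace N'']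

theorem continuous_pullbackArrowMap (𝒢 : GroupoidOver M G) {f : N → M} {f' : N' → M}
    (φ : N' → N) (hφ : Continuous φ) (h : ∀ y, f (φ y) = f' y) :
    Continuous (𝒢.pullbackArrowMap φ h) := by
  have hv : Continuous (fun p : 𝒢.PullbackArrow f' => p.1) := continuous_subtype_val
  exact Continuous.subtype_mk (by fun_prop) _

/-- Pull-back of cocycles. -/
def cocycleMap (𝒢 : GroupoidOver M G) {f : N → M} {f' : N' → M} (φ : N' → N)
    (hφ : Continuous φ) (h : ∀ y, f (φ y) = f' y) :
    (𝒢.pullback f).discreteCocycles A →* (𝒢.pullback f').discreteCocycles A where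
  toFun c := ⟨fun p => c.1 (𝒢.pullbackArrowMap φ h p),
    c.2.1.comp_continuous (𝒢.continuous_pullbackArrowMap φ hφ h), fun p q e => by
      have e' : (𝒢.pullback f).src (𝒢.pullbackArrowMap φ h p) =
        (𝒢.pullback f).tgt (𝒢.pullbackArrowMap φ h q) := congrArg φ e
      rw [← c.2.2 _ _ e']
      refine congrArg c.1 ?_
      apply Subtype.ext
      rw [𝒢.pullback_mul_val f _ _ e']
      simp [pullbackArrowMap, 𝒢.pullback_mul_val f' p q e]⟩
  map_one' := rfl
  map_mul' _ _ := rfl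

/-- The map induced in cohomology by a continuous map of the objects over `M`. -/
def discreteH1Map (𝒢 : GroupoidOver M G) {f : N → M} {f' : N' → M} (φ : N' → N)
    (hφ : Continuous φ) (h : ∀ y, f (φ y) = f' y) :
    (𝒢.pullback f).discreteH1 A →* (𝒢.pullback f').discreteH1 A :=
  QuotientGroup.map _ _ (𝒢.cocycleMap φ hφ h) (by
    rintro c ⟨k, hk, hck⟩
    exact ⟨k ∘ φ, hk.comp_continuous hφ, fun p => hck _⟩)

/-- The map induced in cohomology does not depend on the map of objects over `M`. -/
theorem discreteH1Map_congr [TopologicalSpace M] (𝒢 : GroupoidOver M G) (hu : Continuous 𝒢.unit)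
    {f : N → M} {f' : N' → M} (hf' : Continuous f') (φ ψ : N' → N)
    (hφ : Continuous φ) (h : ∀ y, f (φ y) = f' y) (hψ : Continuous ψ) (h' : ∀ y, f (ψ y) = f' y)
    (z : (𝒢.pullback f).discreteH1 A) :
    𝒢.discreteH1Map φ hφ h z = 𝒢.discreteH1Map ψ hψ h' z := by
  induction z using QuotientGroup.induction_on with
  | H c =>
    refine QuotientGroup.eq.2 ?_
    -- the connecting units `f' y`, seen as arrows from `φ y` to `ψ y`
    let e : N' → 𝒢.PullbackArrow f := fun y =>
      ⟨(ψ y, 𝒢.unit (f' y), φ y), by simp [𝒢.tgt_unit, h'], by simp [𝒢.src_unit, h]⟩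
    have he : Continuous e := Continuous.subtype_mk (by fun_prop) _
    refine ⟨fun y => (c.1 (e y))⁻¹, (c.2.1.comp_continuous he).inv, fun p => ?_⟩
    have key : c.1 (𝒢.pullbackArrowMap ψ h' p) * c.1 (e p.1.2.2) =
        c.1 (e p.1.1) * c.1 (𝒢.pullbackArrowMap φ h p) := by
      have e1 : (𝒢.pullback f).src (𝒢.pullbackArrowMap ψ h' p) =
        (𝒢.pullback f).tgt (e p.1.2.2) := rfl
      have e2 : (𝒢.pullback f).src (e p.1.1) =
        (𝒢.pullback f).tgt (𝒢.pullbackArrowMap φ h p) := rfl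
      rw [← c.2.2 _ _ e1, ← c.2.2 _ _ e2]
      refine congrArg c.1 ?_
      apply Subtype.ext
      rw [𝒢.pullback_mul_val f _ _ e1, 𝒢.pullback_mul_val f _ _ e2]
      have m1 := 𝒢.mul_unit p.1.2.1
      have m2 := 𝒢.unit_mul p.1.2.1
      rw [p.2.2] at m1
      rw [p.2.1] at m2
      simp [e, pullbackArrowMap, m1, m2]
    change (c.1 (𝒢.pullbackArrowMap φ h p))⁻¹ * c.1 (𝒢.pullbackArrowMap ψ h' p) =
      (c.1 (e p.1.2.2))⁻¹ / (c.1 (e p.1.1))⁻¹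
    rw [eq_mul_inv_of_mul_eq key, div_inv_eq_mul, mul_comm (c.1 (e p.1.1)),
      _root_.mul_assoc, inv_mul_cancel_left, mul_comm]

theorem discreteH1Map_id (𝒢 : GroupoidOver M G) {f : N → M}
    (z : (𝒢.pullback f).discreteH1 A) :
    𝒢.discreteH1Map id continuous_id (fun _ => rfl) z = z := by
  induction z using QuotientGroup.induction_on with
  | H c => rfl

theorem discreteH1Map_comp (𝒢 : GroupoidOver M G) {f : N → M} {f' : N' → M} {f'' : N'' → M}
    (φ : N' → N) (hφ : Continuous φ) (h : ∀ y, f (φ y) = f' y)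
    (ψ : N'' → N') (hψ : Continuous ψ) (h' : ∀ y, f' (ψ y) = f'' y)
    (z : (𝒢.pullback f).discreteH1 A) :
    𝒢.discreteH1Map ψ hψ h' (𝒢.discreteH1Map φ hφ h z) =
      𝒢.discreteH1Map (φ ∘ ψ) (hφ.comp hψ) (fun y => (h _).trans (h' y)) z := by
  induction z using QuotientGroup.induction_on with
  | H c => rfl

end Discrete

end GroupoidOver

/-! ### Open covers and refinement -/

/-- A cover of `M` by open subsets. -/
structure OpenCover (M : Type*) [TopologicalSpace M] where
  sets : Set (Opens M)
  covers : ∀ x, ∃ U ∈ sets, x ∈ U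

namespace OpenCover

variable {M : Type*} [TopologicalSpace M]

/-- `𝒰 ≤ 𝒱` if `𝒱` is finer than `𝒰`. -/
instance : Preorder (OpenCover M) where
  le 𝒰 𝒱 := ∀ V ∈ 𝒱.sets, ∃ U ∈ 𝒰.sets, V ≤ U
  le_refl _ V hV := ⟨V, hV, le_rfl⟩
  le_trans _ _ _ h h' W hW := by
    obtain ⟨V, hV, hWV⟩ := h' W hW
    obtain ⟨U, hU, hVU⟩ := h V hV
    exact ⟨U, hU, hWV.trans hVU⟩

instance : Nonempty (OpenCover M) := ⟨⟨{⊤}, fun _ => ⟨⊤, rfl, trivial⟩⟩⟩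

instance : IsDirectedOrder (OpenCover M) where
  directed 𝒰 𝒱 := by
    refine ⟨⟨{W | ∃ U ∈ 𝒰.sets, ∃ V ∈ 𝒱.sets, W = U ⊓ V}, fun x => ?_⟩, ?_, ?_⟩
    · obtain ⟨U, hU, hx⟩ := 𝒰.covers x
      obtain ⟨V, hV, hx'⟩ := 𝒱.covers x
      exact ⟨U ⊓ V, ⟨U, hU, V, hV, rfl⟩, hx, hx'⟩
    · rintro W ⟨U, hU, V, hV, rfl⟩
      exact ⟨U, hU, inf_le_left⟩
    · rintro W ⟨U, hU, V, hV, rfl⟩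
      exact ⟨V, hV, inf_le_right⟩

/-- The disjoint union of the members of a cover. -/
abbrev Total (𝒰 : OpenCover M) : Type _ := Σ U : 𝒰.sets, (U.1 : Opens M)

/-- The canonical map from the disjoint union of the members of a cover to the space. -/
def proj (𝒰 : OpenCover M) (p : 𝒰.Total) : M := p.2.1

theorem continuous_proj (𝒰 : OpenCover M) : Continuous 𝒰.proj :=
  continuous_sigma fun _ => continuous_subtype_val

/-- A map of disjoint unions induced by (a choice of) a refinement function. -/
def refineMap {𝒰 𝒱 : OpenCover M} (h : 𝒰 ≤ 𝒱) (p : 𝒱.Total) : 𝒰.Total :=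
  ⟨⟨(h p.1.1 p.1.2).choose, (h p.1.1 p.1.2).choose_spec.1⟩,
    ⟨p.2.1, (h p.1.1 p.1.2).choose_spec.2 p.2.2⟩⟩

theorem continuous_refineMap {𝒰 𝒱 : OpenCover M} (h : 𝒰 ≤ 𝒱) : Continuous (refineMap h) :=
  continuous_sigma fun V =>
    (continuous_sigmaMk (ι := 𝒰.sets) (σ := fun U => (U.1 : Opens M))
      (i := ⟨(h V.1 V.2).choose, (h V.1 V.2).choose_spec.1⟩)).comp
    (Continuous.subtype_mk (f := fun x : V.1 => x.1) continuous_subtype_val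
      fun x => (h V.1 V.2).choose_spec.2 x.2)

theorem proj_refineMap {𝒰 𝒱 : OpenCover M} (h : 𝒰 ≤ 𝒱) (p : 𝒱.Total) :
    𝒰.proj (refineMap h p) = 𝒱.proj p := rfl

end OpenCover

/-! ### Lie groupoids -/

/-- A Lie groupoid with objects the `n`-dimensional manifold `M` and with arrows the
`(r + n)`-dimensional manifold `G`, so that its Lie algebroid has rank `r`. -/
structure LieGroupoid (n r : ℕ) (M G : Type*)
    [TopologicalSpace M] [ChartedSpace (EuclideanSpace ℝ (Fin n)) M]
    [TopologicalSpace G] [ChartedSpace (EuclideanSpace ℝ (Fin (r + n))) G]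
    extends GroupoidOver M G where
  contMDiff_src : ContMDiff (𝓡 (r + n)) (𝓡 n) ∞ src
  contMDiff_tgt : ContMDiff (𝓡 (r + n)) (𝓡 n) ∞ tgt
  contMDiff_unit : ContMDiff (𝓡 n) (𝓡 (r + n)) ∞ unit
  contMDiff_inv : ContMDiff (𝓡 (r + n)) (𝓡 (r + n)) ∞ inv
  contMDiffOn_mul : ContMDiffOn ((𝓡 (r + n)).prod (𝓡 (r + n))) (𝓡 (r + n)) ∞
    (fun p : G × G => mul p.1 p.2) {p | src p.1 = tgt p.2}
  surjective_mfderiv_src : ∀ g, Function.Surjective (mfderiv (𝓡 (r + n)) (𝓡 n) src g)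
  surjective_mfderiv_tgt : ∀ g, Function.Surjective (mfderiv (𝓡 (r + n)) (𝓡 n) tgt g)

namespace LieGroupoid

variable {n r : ℕ} {M G : Type*}
  [TopologicalSpace M] [ChartedSpace (EuclideanSpace ℝ (Fin n)) M]
  [TopologicalSpace G] [ChartedSpace (EuclideanSpace ℝ (Fin (r + n))) G]
  (𝒢 : LieGroupoid n r M G)

/-! ### Differentiable cohomology -/

/-- The space of differentiable `1`-cocycles: the smooth functions `c` on `G` such that
`c (g h) = c g + c h` whenever `g` and `h` are composable. -/
def realCocycles : Submodule ℝ (G → ℝ) where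
  carrier := {c | ContMDiff (𝓡 (r + n)) 𝓘(ℝ, ℝ) ∞ c ∧
    ∀ g h, 𝒢.src g = 𝒢.tgt h → c (𝒢.mul g h) = c g + c h}
  zero_mem' := ⟨contMDiff_const, fun _ _ _ => by simp⟩
  add_mem' := fun {c d} hc hd => ⟨hc.1.add hd.1, fun g h e => by
    simp only [Pi.add_apply, hc.2 g h e, hd.2 g h e]; ring⟩
  smul_mem' := fun a c hc => ⟨contMDiff_const.mul hc.1, fun g h e => by
    simp only [Pi.smul_apply, hc.2 g h e, smul_add]⟩

/-- The space of coboundaries `δ f : g ↦ f (src g) - f (tgt g)`, with `f` smooth on `M`. -/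
def realCoboundaries : Submodule ℝ 𝒢.realCocycles where
  carrier := {c | ∃ f : M → ℝ, ContMDiff (𝓡 n) 𝓘(ℝ, ℝ) ∞ f ∧
    ∀ g, c.1 g = f (𝒢.src g) - f (𝒢.tgt g)}
  zero_mem' := ⟨0, contMDiff_const, fun _ => by simp⟩
  add_mem' := by
    rintro c d ⟨f, hf, hcf⟩ ⟨k, hk, hdk⟩
    exact ⟨f + k, hf.add hk, fun g => by simp [hcf, hdk]; ring⟩
  smul_mem' := by
    rintro a c ⟨f, hf, hcf⟩
    exact ⟨a • f, contMDiff_const.mul hf, fun g => by simp [hcf]; ring⟩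

/-- The first differentiable cohomology `H¹_diff(𝒢)`. -/
abbrev H1diff : Type _ := 𝒢.realCocycles ⧸ 𝒢.realCoboundaries

section Cech

variable (A : Type*) [CommGroup A]

/-- The restriction map `H¹(𝒢_𝒰, A) → H¹(𝒢_𝒱, A)`, for `𝒱` a refinement of `𝒰`. -/
def cechMap (𝒰 𝒱 : OpenCover M) (h : 𝒰 ≤ 𝒱) :
    (𝒢.pullback 𝒰.proj).discreteH1 A →* (𝒢.pullback 𝒱.proj).discreteH1 A :=
  𝒢.discreteH1Map (OpenCover.refineMap h) (OpenCover.continuous_refineMap h)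
    (OpenCover.proj_refineMap h)

instance : DirectedSystem (fun 𝒰 : OpenCover M => (𝒢.pullback 𝒰.proj).discreteH1 A)
    (fun 𝒰 𝒱 h => 𝒢.cechMap A 𝒰 𝒱 h) where
  map_self 𝒰 z := by
    rw [cechMap, 𝒢.discreteH1Map_congr 𝒢.contMDiff_unit.continuous 𝒰.continuous_proj _ id _ _
      continuous_id (fun _ => rfl), 𝒢.discreteH1Map_id]
  map_map 𝒲 𝒱 𝒰 h h' z := by
    rw [cechMap, cechMap, cechMap, 𝒢.discreteH1Map_comp]
    exact 𝒢.discreteH1Map_congr 𝒢.contMDiff_unit.continuous 𝒲.continuous_proj _ _ _ _ _ _ z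

/-- The Čech-type differentiable cohomology `Ȟ¹_diff(𝒢, A)` with coefficients in a discrete abelian
group `A`: the colimit over the open covers `𝒰` of `M` of the groups `H¹_diff(𝒢_𝒰, A)`, where
`𝒢_𝒰` is the pull-back of `𝒢` to the disjoint union of the members of `𝒰`. -/
abbrev CechH1 : Type _ :=
  DirectLimit (fun 𝒰 : OpenCover M => (𝒢.pullback 𝒰.proj).discreteH1 A)
    (fun 𝒰 𝒱 h => 𝒢.cechMap A 𝒰 𝒱 h)

end Cech

/-! ### The Lie algebroid as a vector bundle, and translations -/

/-- The fibre `A_x` of the Lie algebroid: the kernel of `d src` at the unit at `x`. -/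
abbrev algebroidFibre (x : M) : Submodule ℝ (TangentSpace (𝓡 (r + n)) (𝒢.unit x)) :=
  LinearMap.ker (mfderiv (𝓡 (r + n)) (𝓡 n) 𝒢.src (𝒢.unit x)).toLinearMap

/-- The right translation `A_y → T_g G`, for `g : x → y`: the differential at `1_y` of `h ↦ h g`,
which is defined on the fibre of `src` over `y`. (The vectors of `A_y` are tangent to that fibre,
so their images do not depend on the derivative used for the other directions.) -/
def rightTranslation (g : G) :
    𝒢.algebroidFibre (𝒢.tgt g) →ₗ[ℝ] TangentSpace (𝓡 (r + n)) g :=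
  (mfderivWithin (𝓡 (r + n)) (𝓡 (r + n)) (fun h => 𝒢.mul h g)
    (𝒢.src ⁻¹' {𝒢.tgt g}) (𝒢.unit (𝒢.tgt g))).toLinearMap.domRestrict
    (𝒢.algebroidFibre (𝒢.tgt g))

/-- The left translation `A_x → T_g G`, for `g : x → y`: minus the differential at `1_x` of
`h ↦ g h⁻¹`, which is defined on the fibre of `src` over `x`. It takes values in the kernel of
`d tgt`. (For a Lie group it is the differential of `h ↦ g h` at the identity.) -/
def leftTranslation (g : G) :
    𝒢.algebroidFibre (𝒢.src g) →ₗ[ℝ] TangentSpace (𝓡 (r + n)) g :=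
  -(mfderivWithin (𝓡 (r + n)) (𝓡 (r + n)) (fun h => 𝒢.mul g (𝒢.inv h))
    (𝒢.src ⁻¹' {𝒢.src g}) (𝒢.unit (𝒢.src g))).toLinearMap.domRestrict
    (𝒢.algebroidFibre (𝒢.src g))

theorem finrank_algebroidFibre (x : M) : Module.finrank ℝ (𝒢.algebroidFibre x) = r := by
  have : FiniteDimensional ℝ (TangentSpace (𝓡 (r + n)) (𝒢.unit x)) :=
    inferInstanceAs (FiniteDimensional ℝ (EuclideanSpace ℝ (Fin (r + n))))
  have h := LinearMap.finrank_range_add_finrank_ker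
    (mfderiv (𝓡 (r + n)) (𝓡 n) 𝒢.src (𝒢.unit x)).toLinearMap
  have h1 : Module.finrank ℝ (TangentSpace (𝓡 n) (𝒢.src (𝒢.unit x))) = n :=
    finrank_euclideanSpace_fin
  have h2 : Module.finrank ℝ (TangentSpace (𝓡 (r + n)) (𝒢.unit x)) = r + n :=
    finrank_euclideanSpace_fin
  rw [LinearMap.range_eq_top.2 (𝒢.surjective_mfderiv_src (𝒢.unit x)), finrank_top, h1, h2] at h
  exact Nat.add_left_cancel (h.trans (Nat.add_comm r n))

/-! ### The transverse volume and density bundles -/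

/-- The fibre at `x` of `F(A*) ⊗ F(TM)`, where `F(V)` is the line of the functions `ξ` on the set of
frames of `V` with `ξ(e · P) = χ(det P) ξ(e)`, for a character `χ` of `ℝˣ` extended by `χ 0 = 0`.
An element `α ⊗ β` of `F(A_x*) ⊗ F(T_x M)` is seen as the function `(a, X) ↦ α(a^∨) β(X)` of a frame
`a` of `A_x`, with dual frame `a^∨`, and a frame `X` of `T_x M`. Here `a'.det a` is the determinant
of the matrix that takes `a'` to `a`, so that it is inverse to `a.det a'`. -/
def transverseFibre (χ : ℝ →*₀ ℝ) (x : M) :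
    Submodule ℝ (Module.Basis (Fin r) ℝ (𝒢.algebroidFibre x) →
      Module.Basis (Fin n) ℝ (TangentSpace (𝓡 n) x) → ℝ) where
  carrier := {ξ | ∀ (a a' : Module.Basis (Fin r) ℝ (𝒢.algebroidFibre x))
    (X X' : Module.Basis (Fin n) ℝ (TangentSpace (𝓡 n) x)), ξ a' X' = χ (a'.det a) * χ (X.det X') * ξ a X}
  zero_mem' := fun _ _ _ _ => by simp
  add_mem' := fun {ξ η} hξ hη a a' X X' => by
    simp only [Pi.add_apply, hξ a a' X X', hη a a' X X']; ring
  smul_mem' := fun c ξ hξ a a' X X' => by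
    simp only [Pi.smul_apply, smul_eq_mul, hξ a a' X X']; ring

/-- The basis of `T_g G` given by the model space. -/
def tangentBasis (g : G) : Module.Basis (Fin r ⊕ Fin n) ℝ (TangentSpace (𝓡 (r + n)) g) :=
  (EuclideanSpace.basisFun (Fin (r + n)) ℝ).toBasis.reindex finSumFinEquiv.symm

/-- The determinant of a family of `r + n` vectors of `U`, as a form in the first `r` vectors. -/
theorem det_sumElim_left {U V : Type*} [AddCommGroup U] [Module ℝ U] [AddCommGroup V] [Module ℝ V]
    (B : Module.Basis (Fin r ⊕ Fin n) ℝ U) (L : V →ₗ[ℝ] U) (w : Fin n → U)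
    (a a' : Module.Basis (Fin r) ℝ V) :
    B.det (Sum.elim (L ∘ a') w) = a.det a' * B.det (Sum.elim (L ∘ a) w) := by
  let D : V [⋀^Fin r]→ₗ[ℝ] ℝ :=
    { toFun := fun v => B.det (Sum.elim (L ∘ v) w)
      map_update_add' := fun v i p q => by
        classical
        simp [Function.comp_update, -Sum.update_elim_inl]
      map_update_smul' := fun v i c p => by
        classical
        simp [Function.comp_update, -Sum.update_elim_inl]
      map_eq_zero_of_eq' := fun v i j h hij =>
        B.det.map_eq_zero_of_eq _ (i := Sum.inl i) (j := Sum.inl j) (by simp [h])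
          (by simpa using hij) }
  have := congrArg (fun E => E a') (D.eq_smul_basis_det a)
  simpa [D, mul_comm] using this

/-- The determinant of a family of `r + n` vectors of `U`, as a form in the last `n` vectors. -/
theorem det_sumElim_right {U V : Type*} [AddCommGroup U] [Module ℝ U] [AddCommGroup V] [Module ℝ V]
    (B : Module.Basis (Fin r ⊕ Fin n) ℝ U) (L : V →ₗ[ℝ] U) (w : Fin r → U)
    (a a' : Module.Basis (Fin n) ℝ V) :
    B.det (Sum.elim w (L ∘ a')) = a.det a' * B.det (Sum.elim w (L ∘ a)) := by
  let D : V [⋀^Fin n]→ₗ[ℝ] ℝ :=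
    { toFun := fun v => B.det (Sum.elim w (L ∘ v))
      map_update_add' := fun v i p q => by
        classical
        simp [Function.comp_update, -Sum.update_elim_inr]
      map_update_smul' := fun v i c p => by
        classical
        simp [Function.comp_update, -Sum.update_elim_inr]
      map_eq_zero_of_eq' := fun v i j h hij =>
        B.det.map_eq_zero_of_eq _ (i := Sum.inr i) (j := Sum.inr j) (by simp [h])
          (by simpa using hij) }
  have := congrArg (fun E => E a') (D.eq_smul_basis_det a)
  simpa [D, mul_comm] using this

/-- A linear section of `d src : T_g G → T_x M`, for `g : x → y`. -/
def srcLift (g : G) : TangentSpace (𝓡 n) (𝒢.src g) →ₗ[ℝ] TangentSpace (𝓡 (r + n)) g :=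
  ((mfderiv (𝓡 (r + n)) (𝓡 n) 𝒢.src g).toLinearMap.exists_rightInverse_of_surjective
    (LinearMap.range_eq_top.2 (𝒢.surjective_mfderiv_src g))).choose

/-- A linear section of `d tgt : T_g G → T_y M`, for `g : x → y`. -/
def tgtLift (g : G) : TangentSpace (𝓡 n) (𝒢.tgt g) →ₗ[ℝ] TangentSpace (𝓡 (r + n)) g :=
  ((mfderiv (𝓡 (r + n)) (𝓡 n) 𝒢.tgt g).toLinearMap.exists_rightInverse_of_surjective
    (LinearMap.range_eq_top.2 (𝒢.surjective_mfderiv_tgt g))).choose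

/-- For `g : x → y`, frames `b` of `A_x`, `X` of `T_x M`, `a` of `A_y` and `Y` of `T_y M`, the
determinant of the matrix that takes the frame of `T_g G` induced by `a` and `X` through the exact
sequence `0 → A_y → T_g G → T_x M → 0` of the right translation and `d src` to the frame induced by
`b` and `Y` through the exact sequence `0 → A_x → T_g G → T_y M → 0` of the left translation and
`d tgt`. (It does not depend on the chosen lifts.) -/
def frameRatio (g : G)
    (b : Module.Basis (Fin r) ℝ (𝒢.algebroidFibre (𝒢.src g)))
    (X : Module.Basis (Fin n) ℝ (TangentSpace (𝓡 n) (𝒢.src g)))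
    (a : Module.Basis (Fin r) ℝ (𝒢.algebroidFibre (𝒢.tgt g)))
    (Y : Module.Basis (Fin n) ℝ (TangentSpace (𝓡 n) (𝒢.tgt g))) : ℝ :=
  (tangentBasis (r := r) (n := n) g).det
      (Sum.elim (𝒢.leftTranslation g ∘ b) (𝒢.tgtLift g ∘ Y)) /
    (tangentBasis (r := r) (n := n) g).det
      (Sum.elim (𝒢.rightTranslation g ∘ a) (𝒢.srcLift g ∘ X))

/-- Some frame of `A_x`. -/
def someFrame (x : M) : Module.Basis (Fin r) ℝ (𝒢.algebroidFibre x) :=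
  have : FiniteDimensional ℝ (TangentSpace (𝓡 (r + n)) (𝒢.unit x)) :=
    inferInstanceAs (FiniteDimensional ℝ (EuclideanSpace ℝ (Fin (r + n))))
  Module.finBasisOfFinrankEq ℝ (𝒢.algebroidFibre x) (𝒢.finrank_algebroidFibre x)

/-- Some frame of `T_x M`. -/
def someTangentFrame (x : M) : Module.Basis (Fin n) ℝ (TangentSpace (𝓡 n) x) :=
  (EuclideanSpace.basisFun (Fin n) ℝ).toBasis

/-- The action `g_*` of `g : x → y` on the transverse bundle: `(g_* ξ)(a, Y) = χ(det P) ξ(b, X)`, where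
`P` takes the frame of `T_g G` induced by `(a, X)` to the one induced by `(b, Y)`. (The result does
not depend on `b` and `X`.) -/
def transverseAction (χ : ℝ →*₀ ℝ) (g : G) :
    𝒢.transverseFibre χ (𝒢.src g) →ₗ[ℝ] 𝒢.transverseFibre χ (𝒢.tgt g) where
  toFun ξ := ⟨fun a Y =>
      χ (𝒢.frameRatio g (𝒢.someFrame (𝒢.src g)) (someTangentFrame (𝒢.src g)) a Y) *
        ξ.1 (𝒢.someFrame (𝒢.src g)) (someTangentFrame (𝒢.src g)), fun a a' Y Y' => by
    have hinv : (a.det a')⁻¹ = a'.det a := by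
      have h1 : a'.det a * a.det a' = 1 := by rw [Module.Basis.det_mul_det, Module.Basis.det_self]
      exact (eq_inv_of_mul_eq_one_left h1).symm
    unfold frameRatio
    beta_reduce
    rw [det_sumElim_right _ (𝒢.tgtLift g) _ Y Y', det_sumElim_left _ (𝒢.rightTranslation g) _ a a',
      ← hinv, ← map_mul, ← mul_assoc, ← map_mul]
    congr 2
    rw [mul_div_mul_comm, div_eq_mul_inv (Y.det Y')]
    ring⟩
  map_add' ξ η := by
    apply Subtype.ext
    funext a Y
    simp [mul_add]
  map_smul' c ξ := by
    apply Subtype.ext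
    funext a Y
    simp [mul_left_comm]

/-- Smoothness on the open set `U` of a section of the transverse bundle: its values on smooth
local frames of `A` and of `TM` are smooth. -/
def IsSmoothOn [IsManifold (𝓡 n) ∞ M] [IsManifold (𝓡 (r + n)) ∞ G] (χ : ℝ →*₀ ℝ)
    (σ : ∀ x : M, 𝒢.transverseFibre χ x) (U : Opens M) : Prop :=
  ∀ W : Opens M, W ≤ U →
    ∀ (a : ∀ x : M, Module.Basis (Fin r) ℝ (𝒢.algebroidFibre x))
      (X : ∀ x : M, Module.Basis (Fin n) ℝ (TangentSpace (𝓡 n) x)),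
      (∀ i, ContMDiffOn (𝓡 n) (𝓡 (r + n)).tangent ∞
        (fun x => (⟨𝒢.unit x, (a x i).1⟩ : TangentBundle (𝓡 (r + n)) G)) W) →
      (∀ j, ContMDiffOn (𝓡 n) (𝓡 n).tangent ∞
        (fun x => (⟨x, X x j⟩ : TangentBundle (𝓡 n) M)) W) →
      ContMDiffOn (𝓡 n) 𝓘(ℝ, ℝ) ∞ (fun x => (σ x).1 (a x) (X x)) W

variable [IsManifold (𝓡 n) ∞ M] [IsManifold (𝓡 (r + n)) ∞ G]

/-- The character whose transverse bundle is the transverse volume bundle `V_A^tr`. -/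
abbrev volumeCharacter : ℝ →*₀ ℝ := MonoidWithZeroHom.id ℝ

/-- The character whose transverse bundle is the transverse density bundle `D_A^tr`. -/
abbrev densityCharacter : ℝ →*₀ ℝ := absHom

/-- `𝒢` admits a transverse volume form: a nowhere vanishing smooth section of the transverse
volume bundle which is `𝒢`-invariant. -/
def AdmitsTransverseVolumeForm : Prop :=
  ∃ σ : ∀ x : M, 𝒢.transverseFibre volumeCharacter x,
    𝒢.IsSmoothOn volumeCharacter σ ⊤ ∧ (∀ x, σ x ≠ 0) ∧
    ∀ g, 𝒢.transverseAction volumeCharacter g (σ (𝒢.src g)) = σ (𝒢.tgt g)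

/-- `𝒢` is transversely orientable: the transverse volume bundle has an orientation (a continuous
choice of a ray in each fibre, that is, one given locally by smooth nowhere vanishing sections) that
is preserved by the action of `𝒢`. -/
def TransverselyOrientable : Prop :=
  ∃ o : ∀ x : M, Module.Ray ℝ (𝒢.transverseFibre volumeCharacter x),
    (∀ x : M, ∃ U : Opens M, x ∈ U ∧ ∃ σ : ∀ y : M, 𝒢.transverseFibre volumeCharacter y,
      𝒢.IsSmoothOn volumeCharacter σ U ∧
      ∀ y ∈ U, ∃ h : σ y ≠ 0, rayOfNeZero ℝ (σ y) h = o y) ∧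
    ∀ (g : G) (v : 𝒢.transverseFibre volumeCharacter (𝒢.src g)) (hv : v ≠ 0),
      rayOfNeZero ℝ v hv = o (𝒢.src g) →
      ∃ h : 𝒢.transverseAction volumeCharacter g v ≠ 0,
        rayOfNeZero ℝ (𝒢.transverseAction volumeCharacter g v) h = o (𝒢.tgt g)

/-! ### The modular class and the transverse first Stiefel–Whitney class -/

/-- `κ` is the class of the cocycle `c_σ(g) = log (σ(y) / g_* σ(x))`, `g : x → y`, for some smooth
strictly positive section `σ` of the transverse density bundle. -/
def IsModularClass (κ : 𝒢.H1diff) : Prop :=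
  ∃ σ : ∀ x : M, 𝒢.transverseFibre densityCharacter x,
    𝒢.IsSmoothOn densityCharacter σ ⊤ ∧ (∀ x a X, 0 < (σ x).1 a X) ∧
    ∃ c : 𝒢.realCocycles,
      (∀ g, σ (𝒢.tgt g) =
        Real.exp (c.1 g) • 𝒢.transverseAction densityCharacter g (σ (𝒢.src g))) ∧
      κ = Submodule.Quotient.mk c

/-- The modular class of `𝒢`. -/
def modularClass : 𝒢.H1diff := Classical.epsilon 𝒢.IsModularClass

/-- `w` is the class obtained from some open cover `𝒰` of `M` and some smooth nowhere vanishing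
sections `σ_U` of the transverse volume bundle over the members `U` of `𝒰`, as the class in the
colimit of the cocycle `g ↦ sign c̃(g)` on `𝒢_𝒰`, where `g_* σ_U(x) = c̃(g) σ_V(y)` for an arrow
`g : (U, x) → (V, y)` of `𝒢_𝒰`. -/
def IsTransverseStiefelWhitneyClass (w : 𝒢.CechH1 ℤˣ) : Prop :=
  ∃ (𝒰 : OpenCover M) (σ : 𝒰.sets → ∀ x : M, 𝒢.transverseFibre volumeCharacter x),
    (∀ U : 𝒰.sets, 𝒢.IsSmoothOn volumeCharacter (σ U) U.1 ∧ ∀ x ∈ U.1, σ U x ≠ 0) ∧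
    ∃ c : (𝒢.pullback 𝒰.proj).discreteCocycles ℤˣ,
      (∀ p : 𝒢.PullbackArrow 𝒰.proj, ∃ l : ℝ, 0 < l ∧
        𝒢.transverseAction volumeCharacter p.1.2.1 (σ p.1.2.2.1 (𝒢.src p.1.2.1)) =
          (l * ((c.1 p : ℤ) : ℝ)) • σ p.1.1.1 (𝒢.tgt p.1.2.1)) ∧
      w = Quotient.mk _ ⟨𝒰, QuotientGroup.mk c⟩

/-- The transverse first Stiefel–Whitney class of `𝒢`. -/
def transverseStiefelWhitneyClass : 𝒢.CechH1 ℤˣ :=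
  Classical.epsilon 𝒢.IsTransverseStiefelWhitneyClass

end LieGroupoid

end

noncomputable section

/-! ### Determinants of adapted frames -/

section LinearAlgebra

variable {κ ι : Type*} [Fintype κ] [Fintype ι]
variable {U V W : Type*} [AddCommGroup U] [Module ℝ U] [AddCommGroup V] [Module ℝ V]
  [AddCommGroup W] [Module ℝ W]

/-! In a fixed frame of each fibre, an element of the transverse bundle is a number (`value`) and
`g_*` is multiplication by `χ (ratio g)`. The heart of the matter is that `ratio` is multiplicative,
i.e. that `g_*` is an action (`frameRatio_mul`). The rest is smoothness and bookkeeping of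
logarithms and signs.

Multiplicativity. Let `W` be the tangent space of the composable pairs at `(g, h)`, of dimension `2r
+ n`. It surjects onto `T_g G`, `T_h G` (projections) and `T_{gh} G` (differential of the
multiplication), with kernels of dimension `r` framed by translations of `A` at `src h`, `tgt g` and
`src g`. A determinant on a quotient is, up to a constant, a determinant on `W`, so the six
determinants in the three frame ratios are determinants on `W` of the same blocks in different
orders. Three block exchanges give `(-1)^(3r)`, and the minus sign in the left translation supplies
the missing `(-1)^r` (`det_mul_det_mul_det_eq`).

Derivatives along sets. Multiplication is smooth only on the set of composable pairs, where a
derivative within the set need not be unique. Its values on velocities of curves in the set are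
nevertheless determined (`HasVelocity.mfderivWithin`), the implicit function theorem supplies enough
curves (`exists_hasVelocity_fibreProduct`), and `contMDiffAt_of_hasVelocity` gives smooth dependence
on parameters.

Classes. A smooth positive density exists by a partition of unity. Its cocycle is minus the
logarithm of the coefficient of the action, and another density changes it by the coboundary of a
logarithm. The signs of the coefficients in local volume sections form a locally constant cocycle,
and two families of sections give cohomologous cocycles over a common refinement.

The equivalences. In the chosen frames an invariant orientation is a function `ε` with values `±1`
and `ε(y) = sign (ratio g) ε(x)`, smooth in the sense of `IsOrientationSign`. If the sign cocycle is
the coboundary of `f` over a finer cover, the product of `f` with the signs of the sections is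
invariant and descends to such an `ε`; the converse uses sections of sign `ε`. An invariant volume
form `σ` yields the orientation of `σ` and the invariant density `|σ|`. Conversely, if the modular
cocycle of `δ` is `f ∘ src - f ∘ tgt`, then `e^f δ` is invariant, and `ε e^f δ` is an invariant
volume form. -/

theorem linearIndependent_sumElim_of_comp (p : W →ₗ[ℝ] V) {k : κ → W} {w : ι → W}
    (hk : LinearIndependent ℝ k) (hpk : ∀ i, p (k i) = 0) (hw : LinearIndependent ℝ (p ∘ w)) :
    LinearIndependent ℝ (Sum.elim k w) := by
  rw [Fintype.linearIndependent_iff] at *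
  intro c hc
  rw [Fintype.sum_sum_type] at hc
  simp only [Sum.elim_inl, Sum.elim_inr] at hc
  have h1 := congrArg p hc
  simp only [map_add, map_sum, map_smul, hpk, smul_zero, Finset.sum_const_zero, zero_add,
    map_zero] at h1
  have h2 := hw (fun i => c (Sum.inr i)) h1
  simp only [h2, zero_smul, Finset.sum_const_zero, add_zero] at hc
  have h3 := hk (fun i => c (Sum.inl i)) hc
  rintro (i | i)
  exacts [h3 i, h2 i]

variable [DecidableEq κ] [DecidableEq ι]

/-- If `k` is a frame of the kernel of the surjective map `p : W → V`, the determinant of `(k, w)`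
is a nonzero multiple of that of `p ∘ w`. -/
theorem exists_det_sumElim_eq_mul_det (B : Module.Basis (κ ⊕ ι) ℝ W) (C : Module.Basis ι ℝ V)
    (p : W →ₗ[ℝ] V) (hp : Function.Surjective p) {k : κ → W} (hk : LinearIndependent ℝ k)
    (hpk : ∀ i, p (k i) = 0) :
    ∃ c : ℝ, c ≠ 0 ∧ ∀ w : ι → W, B.det (Sum.elim k w) = c * C.det (p ∘ w) := by
  choose s hs using hp
  have hw0 : p ∘ (s ∘ C) = C := by funext i; exact hs _
  have hli : LinearIndependent ℝ (Sum.elim k (s ∘ C)) :=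
    linearIndependent_sumElim_of_comp p hk hpk (by rw [hw0]; exact C.linearIndependent)
  by_cases hne : Nonempty (κ ⊕ ι)
  · have hcard : Fintype.card (κ ⊕ ι) = Module.finrank ℝ W :=
      (Module.finrank_eq_card_basis B).symm
    -- The constant is the determinant of the adapted basis formed by `k` and a lift of `C`.
    let B' := basisOfLinearIndependentOfCardEqFinrank hli hcard
    have hB' : ⇑B' = Sum.elim k (s ∘ C) := coe_basisOfLinearIndependentOfCardEqFinrank hli hcard
    refine ⟨B.det B', (B.isUnit_det B').ne_zero, fun w => ?_⟩
    have h1 : B.det (Sum.elim k w) = B.det B' * B'.det (Sum.elim k w) := by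
      have := congrArg (fun f => f (Sum.elim k w)) (B.det.eq_smul_basis_det B')
      simpa using this
    rw [h1]
    congr 1
    have hrepr : ∀ (v : W) (j : ι), B'.repr v (Sum.inr j) = C.repr (p v) j := by
      intro v j
      conv_rhs => rw [← B'.sum_repr v]
      simp [Fintype.sum_sum_type, hB', hpk, hs, Finsupp.single_apply]
    -- In the adapted basis the matrix is block triangular: the columns of `k` are unit vectors, and
    -- the last coordinates of `w` are the coordinates of `p ∘ w`.
    have hm : B'.toMatrix (Sum.elim k w) = Matrix.fromBlocks 1
        (Matrix.of fun i j => B'.repr (w j) (Sum.inl i)) 0 (C.toMatrix (p ∘ w)) := by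
      have hkr : ∀ i, B'.repr (k i) = Finsupp.single (Sum.inl i) 1 := fun i => by
        have : k i = B' (Sum.inl i) := by rw [hB']; rfl
        rw [this, Module.Basis.repr_self]
      ext (i | i) (j | j)
      · simp [Module.Basis.toMatrix_apply, hkr, Finsupp.single_apply, Matrix.one_apply, eq_comm]
      · simp [Module.Basis.toMatrix_apply]
      · simp [Module.Basis.toMatrix_apply, hkr]
      · simp [Module.Basis.toMatrix_apply, hrepr]
    rw [Module.Basis.det_apply, hm, Matrix.det_fromBlocks_zero₂₁, Matrix.det_one, one_mul,
      Module.Basis.det_apply]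
  · have h1 : IsEmpty (κ ⊕ ι) := not_nonempty_iff.1 hne
    have h2 : IsEmpty ι := (isEmpty_sum.1 h1).2
    exact ⟨1, one_ne_zero, fun w => by simp⟩

/-- The permutation of `κ ⊕ (κ ⊕ ι)` that exchanges the two copies of `κ`. -/
def sumSwapPerm (κ ι : Type*) : Equiv.Perm (κ ⊕ (κ ⊕ ι)) :=
  (Equiv.sumAssoc κ κ ι).permCongr (Equiv.sumCongr (Equiv.sumComm κ κ) (Equiv.refl ι))

/-- Under `κ ⊕ κ ≃ κ × Bool` the exchange is a transposition in each of the `card κ` fibres. -/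
theorem sign_sumComm (κ : Type*) [Fintype κ] [DecidableEq κ] :
    Equiv.Perm.sign (Equiv.sumComm κ κ : Equiv.Perm (κ ⊕ κ)) = (-1) ^ Fintype.card κ := by
  let e : κ ⊕ κ ≃ κ × Bool :=
    ((Equiv.boolProdEquivSum κ).symm).trans (Equiv.prodComm Bool κ)
  have h := Equiv.Perm.sign_prodCongrRight (fun _ : κ => Equiv.swap true false)
  rw [Equiv.Perm.sign_swap (by decide), Finset.prod_const, Finset.card_univ] at h
  rw [← h]
  refine Equiv.Perm.sign_eq_sign_of_equiv _ _ e ?_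
  rintro (i | i) <;> simp [e, Equiv.prodCongrRight]

theorem det_sumElim_swap (B : Module.Basis (κ ⊕ (κ ⊕ ι)) ℝ W) (a b : κ → W) (w : ι → W) :
    B.det (Sum.elim a (Sum.elim b w)) =
      (-1) ^ Fintype.card κ * B.det (Sum.elim b (Sum.elim a w)) := by
  have h := B.det.map_perm (Sum.elim b (Sum.elim a w)) (sumSwapPerm κ ι)
  have h1 : (Sum.elim b (Sum.elim a w)) ∘ sumSwapPerm κ ι = Sum.elim a (Sum.elim b w) := by
    funext x
    rcases x with (i | i | i) <;> simp [sumSwapPerm, Equiv.permCongr_apply]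
  have h2 : Equiv.Perm.sign (sumSwapPerm κ ι) = (-1) ^ Fintype.card κ := by
    rw [sumSwapPerm, Equiv.Perm.sign_permCongr]
    exact (Equiv.Perm.sign_sumCongr _ _).trans (by simp [sign_sumComm])
  rw [h1, h2] at h
  rw [h]
  -- The sign of the permutation is a power of `-1` in `ℤˣ`, the stated one a power in `ℝ`; the two
  -- mixed cases are contradictory.
  rcases neg_one_pow_eq_or ℤˣ (Fintype.card κ) with h3 | h3
  · rcases neg_one_pow_eq_or ℝ (Fintype.card κ) with h4 | h4
    · simp [h3, h4]
    · exfalso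
      have := congrArg (fun u : ℤˣ => ((u : ℤ) : ℝ)) h3
      norm_num [h4] at this
  · rcases neg_one_pow_eq_or ℝ (Fintype.card κ) with h4 | h4
    · exfalso
      have := congrArg (fun u : ℤˣ => ((u : ℤ) : ℝ)) h3
      norm_num [h4] at this
    · simp [h3, h4]

theorem det_sumElim_neg (B : Module.Basis (κ ⊕ ι) ℝ W) (a : κ → W) (w : ι → W) :
    B.det (Sum.elim (fun i => -a i) w) = (-1) ^ Fintype.card κ * B.det (Sum.elim a w) := by
  have h := B.det.toMultilinearMap.map_smul_univ (Sum.elim (fun _ => -1) (fun _ => 1))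
    (Sum.elim a w)
  have h1 : (fun i => (Sum.elim (fun _ => -1) (fun _ => 1) i : ℝ) • (Sum.elim a w) i) =
      Sum.elim (fun i => -a i) w := by
    funext x
    rcases x with (i | i) <;> simp
  rw [h1] at h
  simpa [Fintype.prod_sum_type] using h

/-- A change of basis multiplies both determinants by the same factor. Frame ratios, defined with
the chart at `g`, can thus be computed in a basis that varies smoothly with `g`. -/
theorem Module.Basis.det_div_det_eq (B B' : Module.Basis ι ℝ W) (v w : ι → W) :
    B.det v / B.det w = B'.det v / B'.det w := by
  have h : ∀ v, B.det v = B.det B' * B'.det v := fun v => by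
    have := congrArg (fun f => f v) (B.det.eq_smul_basis_det B')
    simpa using this
  rw [h v, h w, mul_div_mul_left _ _ (B.isUnit_det B').ne_zero]

variable {W' : Type*} [AddCommGroup W'] [Module ℝ W']

/-- The relation between the determinants of the frames induced by three short exact sequences with
a common middle term. -/
theorem det_mul_det_mul_det_eq (B : Module.Basis (κ ⊕ (κ ⊕ ι)) ℝ W')
    (Bg : Module.Basis (κ ⊕ ι) ℝ U) (Bh : Module.Basis (κ ⊕ ι) ℝ V) (Bm : Module.Basis (κ ⊕ ι) ℝ W)
    (pg : W' →ₗ[ℝ] U) (ph : W' →ₗ[ℝ] V) (m : W' →ₗ[ℝ] W)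
    (hpg : Function.Surjective pg) (hph : Function.Surjective ph) (hm : Function.Surjective m)
    {u k l : κ → W'} (x y z : ι → W')
    (hu : LinearIndependent ℝ u) (hk : LinearIndependent ℝ k) (hl : LinearIndependent ℝ l)
    (hpu : ∀ i, ph (u i) = 0) (hmk : ∀ i, m (k i) = 0) (hpl : ∀ i, pg (l i) = 0) :
    Bm.det (Sum.elim (m ∘ l) (m ∘ z)) * Bg.det (Sum.elim (pg ∘ u) (pg ∘ y)) *
        Bh.det (Sum.elim (ph ∘ k) (ph ∘ x)) =
      Bm.det (Sum.elim (m ∘ u) (m ∘ x)) * Bg.det (Sum.elim (fun i => -pg (k i)) (pg ∘ z)) *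
        Bh.det (Sum.elim (ph ∘ l) (ph ∘ y)) := by
  obtain ⟨ch, hch, Hh⟩ := exists_det_sumElim_eq_mul_det B Bh ph hph hu hpu
  obtain ⟨cg, hcg, Hg⟩ := exists_det_sumElim_eq_mul_det B Bg pg hpg hl hpl
  obtain ⟨cm, hcm, Hm⟩ := exists_det_sumElim_eq_mul_det B Bm m hm hk hmk
  have e1 := Hh (Sum.elim k x)
  have e2 := Hh (Sum.elim l y)
  have e3 := Hg (Sum.elim u y)
  have e4 := Hg (Sum.elim k z)
  have e5 := Hm (Sum.elim u x)
  have e6 := Hm (Sum.elim l z)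
  rw [Sum.comp_elim] at e1 e2 e3 e4 e5 e6
  have s1 := det_sumElim_swap B k u x
  have s2 := det_sumElim_swap B k l z
  have s3 := det_sumElim_swap B u l y
  have n1 := det_sumElim_neg Bg (pg ∘ k) (pg ∘ z)
  simp only [Function.comp_apply] at n1
  rw [n1]
  have hc : cm * cg * ch ≠ 0 := mul_ne_zero (mul_ne_zero hcm hcg) hch
  refine mul_left_cancel₀ hc ?_
  -- Absorbing `cm`, `cg`, `ch` turns each factor into a determinant on `W'`. The two sides then
  -- differ by three block exchanges and one negation, a total sign of `(-1)^(4 card κ) = 1`.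
  calc _ = (cm * Bm.det (Sum.elim (m ∘ l) (m ∘ z))) * (cg * Bg.det (Sum.elim (pg ∘ u) (pg ∘ y))) *
        (ch * Bh.det (Sum.elim (ph ∘ k) (ph ∘ x))) := by ring
    _ = (cm * Bm.det (Sum.elim (m ∘ u) (m ∘ x))) *
        ((-1) ^ Fintype.card κ * (cg * Bg.det (Sum.elim (pg ∘ k) (pg ∘ z)))) *
        (ch * Bh.det (Sum.elim (ph ∘ l) (ph ∘ y))) := by
      rw [← e1, ← e2, ← e3, ← e4, ← e5, ← e6, s1, s2, s3]
      rcases neg_one_pow_eq_or ℝ (Fintype.card κ) with h | h <;> rw [h] <;> ring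
    _ = _ := by ring

end LinearAlgebra

/-! ### Velocities of curves -/

section Velocity

variable {E : Type*} [NormedAddCommGroup E] [NormedSpace ℝ E] {H : Type*} [TopologicalSpace H]
  {I : ModelWithCorners ℝ E H} {N : Type*} [TopologicalSpace N] [ChartedSpace H N]
  {E' : Type*} [NormedAddCommGroup E'] [NormedSpace ℝ E'] {H' : Type*} [TopologicalSpace H']
  {I' : ModelWithCorners ℝ E' H'} {N' : Type*} [TopologicalSpace N'] [ChartedSpace H' N']

variable (I) in
/-- The curve `c` passes through `p` at the time `0`, with velocity `v`. -/
def HasVelocity (c : ℝ → N) (p : N) (v : TangentSpace I p) : Prop :=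
  c 0 = p ∧ ContinuousAt c 0 ∧ HasDerivAt (F := E) (fun t => extChartAt I p (c t)) v 0

namespace HasVelocity

theorem unique {c : ℝ → N} {p : N} {v w : TangentSpace I p} (hv : HasVelocity I c p v)
    (hw : HasVelocity I c p w) : v = w :=
  HasDerivAt.unique (F := E) hv.2.2 hw.2.2

theorem tendsto {c : ℝ → N} {p : N} {v : TangentSpace I p} (hv : HasVelocity I c p v) :
    Filter.Tendsto c (𝓝 0) (𝓝 p) := by
  have := hv.2.1.tendsto
  rwa [hv.1] at this

theorem congr {c c' : ℝ → N} {p : N} {v : TangentSpace I p} (hv : HasVelocity I c p v)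
    (h : c =ᶠ[𝓝 0] c') : HasVelocity I c' p v :=
  ⟨h.eq_of_nhds ▸ hv.1, hv.2.1.congr h, HasDerivAt.congr_of_eventuallyEq (F := E) hv.2.2
    (h.mono fun t ht => by simp only [ht])⟩

theorem const (p : N) : HasVelocity I (fun _ : ℝ => p) p 0 :=
  ⟨rfl, continuousAt_const, hasDerivAt_const (F := E) _ _⟩

theorem prodMk {c : ℝ → N} {c' : ℝ → N'} {p : N} {p' : N'} {v : TangentSpace I p}
    {v' : TangentSpace I' p'} (hv : HasVelocity I c p v) (hv' : HasVelocity I' c' p' v') :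
    HasVelocity (I.prod I') (fun t => (c t, c' t)) (p, p') (v, v') := by
  refine ⟨Prod.ext hv.1 hv'.1, hv.2.1.prodMk hv'.2.1, ?_⟩
  have := HasDerivAt.prodMk (F := E) (G := E') hv.2.2 hv'.2.2
  rw [extChartAt_prod]
  exact this

/-- The chain rule. The set `s` is arbitrary. -/
theorem mfderivWithin {c : ℝ → N} {p : N} {v : TangentSpace I p} (hv : HasVelocity I c p v)
    {f : N → N'} {s : Set N} (hf : MDifferentiableWithinAt I I' f s p) (hs : ∀ᶠ t in 𝓝 0, c t ∈ s) :
    HasVelocity I' (fun t => f (c t)) (f p) (mfderivWithin I I' f s p v) := by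
  have hF := hf.hasMFDerivWithinAt
  have hsrc : ∀ᶠ t in 𝓝 0, c t ∈ (extChartAt I p).source :=
    hv.tendsto (extChartAt_source_mem_nhds p)
  refine ⟨congrArg f hv.1, ?_, ?_⟩
  · have h1 : Filter.Tendsto c (𝓝 0) (𝓝[s] p) := tendsto_nhdsWithin_iff.2 ⟨hv.tendsto, hs⟩
    have := hF.1.tendsto.comp h1
    rw [ContinuousAt, hv.1]
    exact this
  · have h2 : HasDerivWithinAt (F := E) (fun t => extChartAt I p (c t)) v
      {t | c t ∈ s ∧ c t ∈ (extChartAt I p).source} 0 := HasDerivAt.hasDerivWithinAt (F := E) hv.2.2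
    have h3 := HasFDerivWithinAt.comp_hasDerivWithinAt_of_eq (F := E) (E := E') (x := (0 : ℝ))
      (f := fun t => extChartAt I p (c t)) hF.2 h2 (fun t ht => by
        simp only [Set.mem_inter_iff, Set.mem_preimage]
        rw [(extChartAt I p).left_inv ht.2]
        exact ⟨ht.1, extChartAt_target_subset_range p ((extChartAt I p).map_source ht.2)⟩)
        (by simp only [hv.1])
    -- The times at which the curve lies in `s` and in the chart domain form a neighbourhood of `0`,
    -- so a derivative within this set is a true one. No uniqueness of derivatives within `s` is
    -- needed.
    have h4 := h3.hasDerivAt (hs.and hsrc)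
    refine HasDerivAt.congr_of_eventuallyEq (F := E') h4 ?_
    filter_upwards [hsrc] with t ht
    simp only [writtenInExtChartAt, Function.comp_apply, (extChartAt I p).left_inv ht]

theorem mfderiv {c : ℝ → N} {p : N} {v : TangentSpace I p} (hv : HasVelocity I c p v)
    {f : N → N'} (hf : MDifferentiableAt I I' f p) :
    HasVelocity I' (fun t => f (c t)) (f p) (mfderiv I I' f p v) := by
  rw [← mfderivWithin_univ]
  exact hv.mfderivWithin hf.mdifferentiableWithinAt (Filter.Eventually.of_forall fun _ => trivial)

/-- The derivative of a curve in another chart. -/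
theorem hasDerivAt_extChartAt [IsManifold I 1 N] {c : ℝ → N} {p : N} {v : TangentSpace I p}
    (hv : HasVelocity I c p v) {p₀ : N} (hp : p ∈ (chartAt H p₀).source) :
    HasDerivAt (F := E) (fun t => extChartAt I p₀ (c t))
      (trivializationAt E (TangentSpace I) p₀ ⟨p, v⟩).2 0 := by
  have h1 := hasFDerivWithinAt_tangentCoordChange (I := I) (x := p) (y := p₀) (z := p)
    ⟨mem_extChartAt_source p, by rwa [extChartAt_source]⟩
  have hsrc : ∀ᶠ t in 𝓝 0, c t ∈ (extChartAt I p).source :=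
    hv.tendsto (extChartAt_source_mem_nhds p)
  have h3 := HasFDerivWithinAt.comp_hasDerivWithinAt_of_eq (F := E) (E := E) (x := (0 : ℝ))
    (f := fun t => extChartAt I p (c t)) h1
    (HasDerivAt.hasDerivWithinAt (F := E) (s := {t | c t ∈ (extChartAt I p).source}) hv.2.2)
    (fun t ht => extChartAt_target_subset_range p ((extChartAt I p).map_source ht))
    (by simp only [hv.1])
  refine HasDerivAt.congr_of_eventuallyEq (F := E) (h3.hasDerivAt hsrc) ?_
  filter_upwards [hsrc] with t ht
  simp only [Function.comp_apply, (extChartAt I p).left_inv ht]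

end HasVelocity

variable {E'' : Type*} [NormedAddCommGroup E''] [NormedSpace ℝ E''] [FiniteDimensional ℝ E'']
  {H'' : Type*} [TopologicalSpace H'']
  {I'' : ModelWithCorners ℝ E'' H''} {N'' : Type*} [TopologicalSpace N''] [ChartedSpace H'' N'']

/-- The implicit function theorem requires strict differentiability, which a `C¹` map has at
interior points. -/
theorem hasStrictFDerivAt_writtenInExtChartAt [I.Boundaryless]
    {f : N → N'} {p : N} (hf : ContMDiffAt I I' 1 f p) :
    HasStrictFDerivAt (E := E) (F := E') (writtenInExtChartAt I I' p f)
      (mfderiv I I' f p) (extChartAt I p p) := by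
  have h1 := (contMDiffAt_iff.1 hf).2
  rw [I.range_eq_univ, contDiffWithinAt_univ] at h1
  have h2 := h1.hasStrictFDerivAt one_ne_zero
  have h3 : (mfderiv I I' f p : E →L[ℝ] E') = fderiv ℝ (writtenInExtChartAt I I' p f)
      (extChartAt I p p) := by
    rw [(hf.mdifferentiableAt one_ne_zero).mfderiv, I.range_eq_univ]
    exact congrFun (fderivWithin_univ (𝕜 := ℝ) (E := E) (F := E')) _
  rw [h3]
  exact h2

variable [CompleteSpace E] [CompleteSpace E']

/-- Vectors tangent to the fibre product of a submersion and of a smooth map are velocities of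
curves in the fibre product. -/
theorem exists_hasVelocity_fibreProduct [I.Boundaryless] [I'.Boundaryless]
    {f : N → N''} {f' : N' → N''} {p : N} {p' : N'} (hf : ContMDiffAt I I'' 1 f p)
    (hf' : ContMDiffAt I' I'' 1 f' p') (hp : f p = f' p')
    (hsurj : Function.Surjective (mfderiv I I'' f p)) (v : TangentSpace I p)
    (v' : TangentSpace I' p')
    (hv : (mfderiv I I'' f p v : E'') = (mfderiv I' I'' f' p' v' : E'')) :
    ∃ (c : ℝ → N) (c' : ℝ → N'), HasVelocity I c p v ∧ HasVelocity I' c' p' v' ∧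
      ∀ᶠ t in 𝓝 0, f (c t) = f' (c' t) := by
  have h1 := hasStrictFDerivAt_writtenInExtChartAt hf
  have h2 := hasStrictFDerivAt_writtenInExtChartAt hf'
  let a : E × E' := (extChartAt I p p, extChartAt I' p' p')
  -- In charts the fibre product is the zero set of `F`. The derivative of `F` is surjective because
  -- that of `f` already is.
  let F : E × E' → E'' := fun x =>
    writtenInExtChartAt I I'' p f x.1 - writtenInExtChartAt I' I'' p' f' x.2
  let D : E →L[ℝ] E'' := mfderiv I I'' f p
  let D' : E' →L[ℝ] E'' := mfderiv I' I'' f' p'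
  let F' : E × E' →L[ℝ] E'' := D.comp (ContinuousLinearMap.fst ℝ E E') -
    D'.comp (ContinuousLinearMap.snd ℝ E E')
  have hF : HasStrictFDerivAt F F' a :=
    (HasStrictFDerivAt.comp a (g := writtenInExtChartAt I I'' p f) h1 hasStrictFDerivAt_fst).sub
      (HasStrictFDerivAt.comp a (g := writtenInExtChartAt I' I'' p' f') h2 hasStrictFDerivAt_snd)
  have hF' : F'.range = ⊤ := by
    refine LinearMap.range_eq_top.2 fun y => ?_
    obtain ⟨x, hx⟩ := hsurj y
    refine ⟨(x, 0), ?_⟩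
    change D x - D' 0 = y
    rw [map_zero, sub_zero]
    exact hx
  have hker : ((v, v') : E × E') ∈ F'.ker := by
    change D v - D' v' = 0
    exact sub_eq_zero.2 hv
  let κ : F'.ker := ⟨(v, v'), hker⟩
  -- The implicit function parametrizes the level set of `F` by the kernel of `F'`, with the
  -- inclusion as derivative at `0`; the line `t • κ` therefore gives a curve in the level set with
  -- velocity `(v, v')`.
  let γ : ℝ → E × E' := fun t => hF.implicitFunction F F' hF' (F a) (t • κ)
  have hγ0 : γ 0 = a := by
    simp only [γ, zero_smul, HasStrictFDerivAt.implicitFunction_apply_image]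
  have hγ : HasDerivAt γ (v, v') 0 := by
    have h3 := (hF.to_implicitFunction hF').hasFDerivAt
    have h4 : HasDerivAt (fun t : ℝ => t • κ) κ 0 := by
      simpa using (hasDerivAt_id (0 : ℝ)).smul_const κ
    have h5 := HasFDerivAt.comp_hasDerivAt_of_eq (x := (0 : ℝ)) (f := fun t : ℝ => t • κ) h3 h4
      (by simp)
    exact h5
  have hγF : ∀ᶠ t in 𝓝 (0 : ℝ), F (γ t) = F a := by
    have h6 : Filter.Tendsto (fun t : ℝ => (F a, t • κ)) (𝓝 0) (𝓝 (F a, 0)) := by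
      have : Continuous (fun t : ℝ => (F a, t • κ)) := by fun_prop
      simpa using this.tendsto 0
    exact h6.eventually (hF.map_implicitFunction_eq hF')
  have hγc : Filter.Tendsto γ (𝓝 0) (𝓝 a) := by
    have := hγ.continuousAt.tendsto
    rwa [hγ0] at this
  have hγ1 : Filter.Tendsto (fun t => (γ t).1) (𝓝 0) (𝓝 (extChartAt I p p)) :=
    (continuous_fst.tendsto a).comp hγc
  have hγ2 : Filter.Tendsto (fun t => (γ t).2) (𝓝 0) (𝓝 (extChartAt I' p' p')) :=
    (continuous_snd.tendsto a).comp hγc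
  have hFa : F a = 0 := by
    simp [F, a, writtenInExtChartAt, hp]
  have hc0 : Filter.Tendsto (fun t => (extChartAt I p).symm (γ t).1) (𝓝 0) (𝓝 p) := by
    have := (continuousAt_extChartAt_symm (I := I) p).tendsto.comp hγ1
    rwa [extChartAt_to_inv] at this
  have hc0' : Filter.Tendsto (fun t => (extChartAt I' p').symm (γ t).2) (𝓝 0) (𝓝 p') := by
    have := (continuousAt_extChartAt_symm (I := I') p').tendsto.comp hγ2
    rwa [extChartAt_to_inv] at this
  have hd1 : HasDerivAt (F := E) (fun t => (γ t).1) v 0 := hγ.fst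
  have hd2 : HasDerivAt (F := E') (fun t => (γ t).2) v' 0 := hγ.snd
  refine ⟨fun t => (extChartAt I p).symm (γ t).1, fun t => (extChartAt I' p').symm (γ t).2,
    ⟨by simp [hγ0, a], ?_, ?_⟩, ⟨by simp [hγ0, a], ?_, ?_⟩, ?_⟩
  · simpa [ContinuousAt, hγ0, a] using hc0
  · refine HasDerivAt.congr_of_eventuallyEq (F := E) hd1 ?_
    filter_upwards [hγ1 (extChartAt_target_mem_nhds (I := I) p)] with t ht
    exact (extChartAt I p).right_inv ht
  · simpa [ContinuousAt, hγ0, a] using hc0'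
  · refine HasDerivAt.congr_of_eventuallyEq (F := E') hd2 ?_
    filter_upwards [hγ2 (extChartAt_target_mem_nhds (I := I') p')] with t ht
    exact (extChartAt I' p').right_inv ht
  · have hs1 := hf.continuousAt.tendsto.comp hc0 (extChartAt_source_mem_nhds (I := I'') (f p))
    have hs2 := hf'.continuousAt.tendsto.comp hc0' (extChartAt_source_mem_nhds (I := I'') (f' p'))
    filter_upwards [hγF, hs1, hs2] with t ht h1 h2
    rw [hFa] at ht
    have ht' := sub_eq_zero.1 ht
    simp only [writtenInExtChartAt, Function.comp_apply] at ht'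
    rw [← hp] at ht' h2
    exact (extChartAt I'' (f p)).injOn h1 h2 ht'

/-- Vectors tangent to a fibre of a submersion are velocities of curves in this fibre. -/
theorem exists_hasVelocity_fibre [I.Boundaryless]
    {f : N → N''} {p : N} (hf : ContMDiffAt I I'' 1 f p)
    (hsurj : Function.Surjective (mfderiv I I'' f p)) (v : TangentSpace I p)
    (hv : mfderiv I I'' f p v = 0) :
    ∃ c : ℝ → N, HasVelocity I c p v ∧ ∀ᶠ t in 𝓝 0, f (c t) = f p := by
  -- The fibre is the fibre product with a constant map, taken with the zero vector in the second
  -- factor.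
  obtain ⟨c, _, hc, _, h⟩ := exists_hasVelocity_fibreProduct (I' := I) (p' := p)
    (f' := fun _ : N => f p) hf contMDiffAt_const rfl hsurj v 0
    (by rw [map_zero]; exact hv)
  exact ⟨c, hc, h⟩

end Velocity

/-! ### Smooth dependence of derivatives within a set -/

section SmoothVelocity

variable {E : Type*} [NormedAddCommGroup E] [NormedSpace ℝ E] {H : Type*} [TopologicalSpace H]
  {I : ModelWithCorners ℝ E H} {P : Type*} [TopologicalSpace P] [ChartedSpace H P]
  {E' : Type*} [NormedAddCommGroup E'] [NormedSpace ℝ E'] {H' : Type*} [TopologicalSpace H']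
  {I' : ModelWithCorners ℝ E' H'} {Q : Type*} [TopologicalSpace Q] [ChartedSpace H' Q]
  {F : Type*} [NormedAddCommGroup F] [NormedSpace ℝ F] {K : Type*} [TopologicalSpace K]
  {J : ModelWithCorners ℝ F K} {N : Type*} [TopologicalSpace N] [ChartedSpace K N]
  [IsManifold I ∞ P] [IsManifold I' ∞ Q]

/-- If `f` is smooth on an arbitrary set `s`, the images by the derivative of `f` of a smooth family
of vectors, which are velocities of curves in `s`, form a smooth family. -/
theorem contMDiffAt_of_hasVelocity {f : P → Q} {s : Set P} (hf : ContMDiffOn I I' ∞ f s)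
    {φ : N → P} {x₀ : N} (hφs : ∀ x, φ x ∈ s) {v : ∀ x, TangentSpace I (φ x)}
    (hv : ContMDiffAt J I.tangent ∞ (fun x => (⟨φ x, v x⟩ : TangentBundle I P)) x₀)
    {ψ : N → Q} (hψ : ∀ x, f (φ x) = ψ x) {w : ∀ x, TangentSpace I' (ψ x)}
    (hw : ∀ᶠ x in 𝓝 x₀, ∃ c : ℝ → P, HasVelocity I c (φ x) (v x) ∧ (∀ᶠ t in 𝓝 0, c t ∈ s) ∧
      HasVelocity I' (fun t => f (c t)) (ψ x) (w x)) :
    ContMDiffAt J I'.tangent ∞ (fun x => (⟨ψ x, w x⟩ : TangentBundle I' Q)) x₀ := by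
  obtain ⟨hφ, hv2⟩ := Bundle.contMDiffAt_totalSpace.1 hv
  have hψ' : ψ = f ∘ φ := funext fun x => (hψ x).symm
  have hψs : ContMDiffAt J I' ∞ ψ x₀ := by
    rw [hψ', ← contMDiffWithinAt_univ]
    exact (hf (φ x₀) (hφs x₀)).comp x₀ (contMDiffWithinAt_univ.2 hφ) (fun x _ => hφs x)
  refine Bundle.contMDiffAt_totalSpace.2 ⟨hψs, ?_⟩
  dsimp only at hv2 hφ ⊢
  refine contMDiffAt_infty.2 fun m => ?_
  have h1 := (contMDiffWithinAt_iff.1 ((hf (φ x₀) (hφs x₀)).of_le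
    (m := (m : ℕ∞ω) + 1) (by exact_mod_cast le_top))).2
  -- `f'` is one possible derivative within `u`, of class `C^m`. It need not be canonical, but its
  -- values on velocities of curves in `s` are.
  obtain ⟨u, hu, -, f', hf', hf'm⟩ :=
    (contDiffWithinAt_succ_iff_hasFDerivWithinAt (by simp)).1 h1
  obtain ⟨o, ho, hao, hou⟩ := mem_nhdsWithin.1 hu
  have hφ1 : ContMDiffAt J 𝓘(ℝ, E) ∞ (fun x => extChartAt I (φ x₀) (φ x)) x₀ :=
    (contMDiffAt_extChartAt (I := I)).comp x₀ hφ
  have hsrc : ∀ᶠ x in 𝓝 x₀, φ x ∈ (extChartAt I (φ x₀)).source :=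
    hφ.continuousAt (extChartAt_source_mem_nhds (φ x₀))
  have hsrc' : ∀ᶠ x in 𝓝 x₀, ψ x ∈ (extChartAt I' (ψ x₀)).source :=
    hψs.continuousAt (extChartAt_source_mem_nhds (ψ x₀))
  have hin : ∀ᶠ x in 𝓝 x₀, extChartAt I (φ x₀) (φ x) ∈ o :=
    hφ1.continuousAt (ho.mem_nhds hao)
  have hmem : ∀ y, y ∈ s → y ∈ (extChartAt I (φ x₀)).source → extChartAt I (φ x₀) y ∈ o →
      extChartAt I (φ x₀) y ∈ u := fun y hys hy hyo => hou ⟨hyo, Set.mem_insert_of_mem _ ⟨by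
        simp only [Set.mem_preimage, (extChartAt I (φ x₀)).left_inv hy, hys],
        extChartAt_target_subset_range _ ((extChartAt I (φ x₀)).map_source hy)⟩⟩
  have hf2 : ContMDiffAt J 𝓘(ℝ, E →L[ℝ] E') m (fun x => f' (extChartAt I (φ x₀) (φ x))) x₀ := by
    have h2 : ContMDiffWithinAt J 𝓘(ℝ, E →L[ℝ] E') m
        (f' ∘ fun x => extChartAt I (φ x₀) (φ x)) {x | extChartAt I (φ x₀) (φ x) ∈ u} x₀ :=
      (ContDiffWithinAt.contMDiffWithinAt hf'm).comp x₀
        ((hφ1.of_le (by exact_mod_cast le_top)).contMDiffWithinAt) (fun x hx => hx)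
    refine h2.contMDiffAt ?_
    filter_upwards [hsrc, hin] with x hx1 hx2
    exact hmem _ (hφs x) hx1 hx2
  have hv3 := hv2.of_le (n := ∞) (m := (m : ℕ∞ω)) (by exact_mod_cast le_top)
  -- Near `x₀`, in charts, `w x` is `f'` applied to `v x`: both are the derivative of `f` along the
  -- curve `c`.
  refine (hf2.clm_apply hv3).congr_of_eventuallyEq ?_
  filter_upwards [hsrc, hin, hw, hsrc'] with x hx1 hx2 ⟨c, hc, hcs, hcw⟩ hx3
  have d1 := hc.hasDerivAt_extChartAt (p₀ := φ x₀) (by rwa [extChartAt_source] at hx1)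
  have d2 := hcw.hasDerivAt_extChartAt (p₀ := ψ x₀) (by rwa [extChartAt_source] at hx3)
  have hcsrc : ∀ᶠ t in 𝓝 0, c t ∈ (extChartAt I (φ x₀)).source :=
    hc.tendsto ((isOpen_extChartAt_source (I := I) (φ x₀)).mem_nhds hx1)
  have hcin : ∀ᶠ t in 𝓝 0, extChartAt I (φ x₀) (c t) ∈ o := by
    have h3 := d1.continuousAt
    refine h3 (ho.mem_nhds ?_)
    simpa only [hc.1] using hx2
  have d3 := HasFDerivWithinAt.comp_hasDerivWithinAt_of_eq (F := E) (E := E') (x := (0 : ℝ))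
    (f := fun t => extChartAt I (φ x₀) (c t)) (hf' _ (hmem _ (hφs x) hx1 hx2))
    (HasDerivAt.hasDerivWithinAt (F := E) (s := {t | extChartAt I (φ x₀) (c t) ∈ u}) d1)
    (fun t ht => ht) (by simp only [hc.1])
  have d4 := d3.hasDerivAt (by
    filter_upwards [hcsrc, hcin, hcs] with t h1 h2 h3 using hmem _ h3 h1 h2)
  refine HasDerivAt.unique (F := E') d2 (HasDerivAt.congr_of_eventuallyEq (F := E') d4 ?_)
  filter_upwards [hcsrc] with t ht
  simp only [Function.comp_apply, (extChartAt I (φ x₀)).left_inv ht, hψ]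

end SmoothVelocity

/-- The vector is typed in the model space `E`, so replacing the base point by an equal one leaves
it unchanged. -/
theorem HasVelocity.of_eq {E : Type*} [NormedAddCommGroup E] [NormedSpace ℝ E] {H : Type*}
    [TopologicalSpace H] {I : ModelWithCorners ℝ E H} {N : Type*} [TopologicalSpace N]
    [ChartedSpace H N] {c : ℝ → N} {p q : N} {v : E} (hv : HasVelocity I c p v) (h : p = q) :
    HasVelocity I c q v := by
  subst h
  exact hv

theorem GroupoidOver.inv_inv {M G : Type*} (𝒢 : GroupoidOver M G) (g : G) :
    𝒢.inv (𝒢.inv g) = g := by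
  have h1 := 𝒢.mul_unit (𝒢.inv (𝒢.inv g))
  rw [𝒢.src_inv, 𝒢.tgt_inv, ← 𝒢.inv_mul, ← 𝒢.mul_assoc _ _ _ (𝒢.src_inv _) (𝒢.src_inv _),
    𝒢.inv_mul, 𝒢.src_inv, 𝒢.unit_mul] at h1
  exact h1.symm

namespace LieGroupoid

variable {n r : ℕ} {M G : Type*}
  [TopologicalSpace M] [ChartedSpace (EuclideanSpace ℝ (Fin n)) M]
  [TopologicalSpace G] [ChartedSpace (EuclideanSpace ℝ (Fin (r + n))) G]
  (𝒢 : LieGroupoid n r M G)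

/-! ### Translations and the derivative of the multiplication -/

/-- The derivative of the multiplication at a pair of composable arrows. It is meaningful on the
vectors tangent to the set of pairs of composable arrows. -/
def mulDeriv (g h : G) : (TangentSpace (𝓡 (r + n)) g × TangentSpace (𝓡 (r + n)) h) →ₗ[ℝ]
    TangentSpace (𝓡 (r + n)) (𝒢.mul g h) :=
  (mfderivWithin ((𝓡 (r + n)).prod (𝓡 (r + n))) (𝓡 (r + n)) (fun p : G × G => 𝒢.mul p.1 p.2)
    {p | 𝒢.src p.1 = 𝒢.tgt p.2} (g, h)).toLinearMap

variable {𝒢}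

theorem hasVelocity_mul {g h : G} (hgh : 𝒢.src g = 𝒢.tgt h) {c c' : ℝ → G}
    {ξ : TangentSpace (𝓡 (r + n)) g} {η : TangentSpace (𝓡 (r + n)) h}
    (hc : HasVelocity (𝓡 (r + n)) c g ξ) (hc' : HasVelocity (𝓡 (r + n)) c' h η)
    (hcc' : ∀ᶠ t in 𝓝 0, 𝒢.src (c t) = 𝒢.tgt (c' t)) :
    HasVelocity (𝓡 (r + n)) (fun t => 𝒢.mul (c t) (c' t)) (𝒢.mul g h) (𝒢.mulDeriv g h (ξ, η)) :=
  (hc.prodMk hc').mfderivWithin (f := fun p : G × G => 𝒢.mul p.1 p.2)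
    (s := {p | 𝒢.src p.1 = 𝒢.tgt p.2})
    ((𝒢.contMDiffOn_mul (g, h) hgh).mdifferentiableWithinAt (by simp)) hcc'

/-- Translations are differentials of maps defined only on a fibre of `src`, so computations with
them start from such a curve. -/
theorem exists_hasVelocity_algebroidFibre (x : M) (a : 𝒢.algebroidFibre x) :
    ∃ c : ℝ → G, HasVelocity (𝓡 (r + n)) c (𝒢.unit x) a.1 ∧ ∀ᶠ t in 𝓝 0, 𝒢.src (c t) = x := by
  obtain ⟨c, hc, h⟩ := exists_hasVelocity_fibre (p := 𝒢.unit x)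
    ((𝒢.contMDiff_src (𝒢.unit x)).of_le (m := 1) (by simp)) (𝒢.surjective_mfderiv_src _) a.1 a.2
  rw [𝒢.src_unit] at h
  exact ⟨c, hc, h⟩

/-- Taking a whole section `a` and a point `y` with `tgt g = y` makes this applicable when `g` is a
product, whose target is only propositionally the expected point. -/
theorem hasVelocity_rightTranslation {g : G} {y : M} (hy : 𝒢.tgt g = y)
    (a : ∀ x, 𝒢.algebroidFibre x) {c : ℝ → G} (hc : HasVelocity (𝓡 (r + n)) c (𝒢.unit y) (a y).1)
    (hcy : ∀ᶠ t in 𝓝 0, 𝒢.src (c t) = y) :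
    HasVelocity (𝓡 (r + n)) (fun t => 𝒢.mul (c t) g) g
      (𝒢.rightTranslation g (a (𝒢.tgt g))) := by
  subst hy
  have hd : MDifferentiableWithinAt (𝓡 (r + n)) (𝓡 (r + n)) (fun h => 𝒢.mul h g)
      (𝒢.src ⁻¹' {𝒢.tgt g}) (𝒢.unit (𝒢.tgt g)) := by
    have h1 := (𝒢.contMDiffOn_mul (𝒢.unit (𝒢.tgt g), g)
      (𝒢.src_unit _)).mdifferentiableWithinAt (by simp)
    exact MDifferentiableWithinAt.comp (f := fun h => (h, g)) (s := 𝒢.src ⁻¹' {𝒢.tgt g}) _ h1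
      (mdifferentiableAt_id.prodMk mdifferentiableAt_const).mdifferentiableWithinAt
      (fun h hh => hh)
  exact (hc.mfderivWithin hd hcy).of_eq (𝒢.unit_mul g)

theorem inv_unit (x : M) : 𝒢.inv (𝒢.unit x) = 𝒢.unit x := by
  have h1 := 𝒢.mul_unit (𝒢.inv (𝒢.unit x))
  rw [𝒢.src_inv, 𝒢.tgt_unit] at h1
  have h2 := 𝒢.inv_mul (𝒢.unit x)
  rw [𝒢.src_unit] at h2
  exact h1.symm.trans h2

theorem hasVelocity_leftTranslation {g : G} {x : M} (hx : 𝒢.src g = x)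
    (b : ∀ x, 𝒢.algebroidFibre x) {c : ℝ → G} (hc : HasVelocity (𝓡 (r + n)) c (𝒢.unit x) (b x).1)
    (hcx : ∀ᶠ t in 𝓝 0, 𝒢.src (c t) = x) :
    HasVelocity (𝓡 (r + n)) (fun t => 𝒢.mul g (𝒢.inv (c t))) g
      (-𝒢.leftTranslation g (b (𝒢.src g))) := by
  subst hx
  have hd : MDifferentiableWithinAt (𝓡 (r + n)) (𝓡 (r + n)) (fun h => 𝒢.mul g (𝒢.inv h))
      (𝒢.src ⁻¹' {𝒢.src g}) (𝒢.unit (𝒢.src g)) := by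
    have h1 := (𝒢.contMDiffOn_mul (g, 𝒢.inv (𝒢.unit (𝒢.src g)))
      (by simp [𝒢.tgt_inv, 𝒢.src_unit])).mdifferentiableWithinAt (by simp)
    exact MDifferentiableWithinAt.comp (f := fun h => (g, 𝒢.inv h)) (s := 𝒢.src ⁻¹' {𝒢.src g}) _ h1
      (mdifferentiableAt_const.prodMk
        (𝒢.contMDiff_inv.mdifferentiableAt (by simp))).mdifferentiableWithinAt
      (fun h hh => by
        simp only [Set.mem_preimage, Set.mem_singleton_iff] at hh
        simp [𝒢.tgt_inv, hh])
  have h2 := (hc.mfderivWithin hd hcx).of_eq (q := g) (by simp only [inv_unit, 𝒢.mul_unit])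
  have h3 : -𝒢.leftTranslation g (b (𝒢.src g)) =
      (mfderivWithin (𝓡 (r + n)) (𝓡 (r + n)) (fun h => 𝒢.mul g (𝒢.inv h))
        (𝒢.src ⁻¹' {𝒢.src g}) (𝒢.unit (𝒢.src g)) (b (𝒢.src g)).1 : EuclideanSpace ℝ (Fin (r + n))) :=
    neg_neg (G := EuclideanSpace ℝ (Fin (r + n))) _
  rw [h3]
  exact h2

/-- An arbitrary, possibly discontinuous, extension lets results stated for sections apply to a
single vector. -/
theorem exists_section_eq {x : M} (a : 𝒢.algebroidFibre x) :
    ∃ α : ∀ x, 𝒢.algebroidFibre x, α x = a := by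
  classical
  exact ⟨fun y => if h : x = y then h ▸ a else 0, by simp⟩

theorem mfderiv_src_eq_of_eventually_eq {c : ℝ → G} {g : G} {ξ : TangentSpace (𝓡 (r + n)) g}
    (hc : HasVelocity (𝓡 (r + n)) c g ξ) (h : ∀ᶠ t in 𝓝 0, 𝒢.src (c t) = 𝒢.src g) :
    mfderiv (𝓡 (r + n)) (𝓡 n) 𝒢.src g ξ = 0 :=
  ((hc.mfderiv (𝒢.contMDiff_src.mdifferentiableAt (by simp))).congr h).unique
    (HasVelocity.const (I := 𝓡 n) _)

theorem mfderiv_tgt_eq_of_eventually_eq {c : ℝ → G} {g : G} {ξ : TangentSpace (𝓡 (r + n)) g}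
    (hc : HasVelocity (𝓡 (r + n)) c g ξ) (h : ∀ᶠ t in 𝓝 0, 𝒢.tgt (c t) = 𝒢.tgt g) :
    mfderiv (𝓡 (r + n)) (𝓡 n) 𝒢.tgt g ξ = 0 :=
  ((hc.mfderiv (𝒢.contMDiff_tgt.mdifferentiableAt (by simp))).congr h).unique
    (HasVelocity.const (I := 𝓡 n) _)

theorem mfderiv_src_rightTranslation (g : G) (a : 𝒢.algebroidFibre (𝒢.tgt g)) :
    mfderiv (𝓡 (r + n)) (𝓡 n) 𝒢.src g (𝒢.rightTranslation g a) = 0 := by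
  obtain ⟨α, rfl⟩ := exists_section_eq a
  obtain ⟨c, hc, hcs⟩ := exists_hasVelocity_algebroidFibre _ (α (𝒢.tgt g))
  exact mfderiv_src_eq_of_eventually_eq (hasVelocity_rightTranslation rfl α hc hcs)
    (hcs.mono fun t ht => 𝒢.src_mul _ _ ht)

theorem mfderiv_tgt_leftTranslation (g : G) (b : 𝒢.algebroidFibre (𝒢.src g)) :
    mfderiv (𝓡 (r + n)) (𝓡 n) 𝒢.tgt g (𝒢.leftTranslation g b) = 0 := by
  obtain ⟨α, rfl⟩ := exists_section_eq b
  obtain ⟨c, hc, hcs⟩ := exists_hasVelocity_algebroidFibre _ (α (𝒢.src g))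
  have := mfderiv_tgt_eq_of_eventually_eq (hasVelocity_leftTranslation rfl α hc hcs)
    (hcs.mono fun t ht => 𝒢.tgt_mul _ _ (by rw [𝒢.tgt_inv, ht]))
  rwa [map_neg, neg_eq_zero] at this

/-- If `c g` has zero velocity, so has `c = (c g) g⁻¹`. -/
theorem rightTranslation_injective (g : G) : Function.Injective (𝒢.rightTranslation g) := by
  rw [← LinearMap.ker_eq_bot, LinearMap.ker_eq_bot']
  intro a ha
  obtain ⟨α, rfl⟩ := exists_section_eq a
  obtain ⟨c, hc, hcs⟩ := exists_hasVelocity_algebroidFibre _ (α (𝒢.tgt g))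
  have h1 := hasVelocity_rightTranslation rfl α hc hcs
  rw [ha] at h1
  have h2 := hasVelocity_mul (𝒢.tgt_inv g).symm h1 (HasVelocity.const (𝒢.inv g))
    (hcs.mono fun t ht => by rw [𝒢.src_mul _ _ ht, 𝒢.tgt_inv])
  have h3 : 𝒢.mulDeriv g (𝒢.inv g) (0, 0) = 0 := map_zero _
  rw [h3] at h2
  have h4 := HasVelocity.of_eq h2 (𝒢.mul_inv g)
  have h5 := h4.congr (c' := c) (hcs.mono fun t ht => by
    simp only []
    rw [𝒢.mul_assoc _ _ _ ht (𝒢.tgt_inv g).symm, 𝒢.mul_inv, ← ht, 𝒢.mul_unit])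
  exact Subtype.ext (hc.unique h5)

/-- If `g c⁻¹` has zero velocity, so has `c⁻¹ = g⁻¹ (g c⁻¹)`, and then `c` itself by applying the
inversion. -/
theorem leftTranslation_injective (g : G) : Function.Injective (𝒢.leftTranslation g) := by
  rw [← LinearMap.ker_eq_bot, LinearMap.ker_eq_bot']
  intro a ha
  obtain ⟨α, rfl⟩ := exists_section_eq a
  obtain ⟨c, hc, hcs⟩ := exists_hasVelocity_algebroidFibre _ (α (𝒢.src g))
  have h1 := hasVelocity_leftTranslation rfl α hc hcs
  rw [ha, neg_zero] at h1
  have h2 := hasVelocity_mul (𝒢.src_inv g) (HasVelocity.const (𝒢.inv g)) h1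
    (hcs.mono fun t ht => by rw [𝒢.src_inv, 𝒢.tgt_mul _ _ (by rw [𝒢.tgt_inv, ht])])
  have h3 : 𝒢.mulDeriv (𝒢.inv g) g (0, 0) = 0 := map_zero _
  rw [h3] at h2
  have h4 := h2.mfderiv (f := 𝒢.inv) (𝒢.contMDiff_inv.mdifferentiableAt (by simp))
  rw [map_zero] at h4
  have h5 := h4.congr (c' := c) (hcs.mono fun t ht => by
    simp only []
    rw [← 𝒢.mul_assoc _ _ _ (𝒢.src_inv g) (by rw [𝒢.tgt_inv, ht]), 𝒢.inv_mul, ← ht,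
      ← 𝒢.tgt_inv (c t), 𝒢.unit_mul, 𝒢.inv_inv])
  have h6 : 𝒢.inv (𝒢.mul (𝒢.inv g) g) = 𝒢.unit (𝒢.src g) := h5.1.symm.trans hc.1
  exact Subtype.ext (hc.unique (HasVelocity.of_eq h5 h6))

/-- Differentiate the associativity `(c g) h = c (g h)` along a curve `c` in a fibre of `src`. -/
theorem mulDeriv_rightTranslation {g h : G} (hgh : 𝒢.src g = 𝒢.tgt h)
    (a : ∀ x, 𝒢.algebroidFibre x) :
    𝒢.mulDeriv g h (𝒢.rightTranslation g (a (𝒢.tgt g)), 0) =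
      𝒢.rightTranslation (𝒢.mul g h) (a (𝒢.tgt (𝒢.mul g h))) := by
  obtain ⟨c, hc, hcs⟩ := exists_hasVelocity_algebroidFibre _ (a (𝒢.tgt g))
  have h1 := hasVelocity_mul hgh (hasVelocity_rightTranslation rfl a hc hcs) (HasVelocity.const h)
    (hcs.mono fun t ht => by rw [𝒢.src_mul _ _ ht, hgh])
  refine (h1.congr (hcs.mono fun t ht => ?_)).unique
    (hasVelocity_rightTranslation (𝒢.tgt_mul g h hgh) a hc hcs)
  exact 𝒢.mul_assoc _ _ _ ht hgh

/-- Differentiate `g (h c⁻¹) = (g h) c⁻¹`; the minus signs in the two left translations cancel. -/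
theorem mulDeriv_leftTranslation {g h : G} (hgh : 𝒢.src g = 𝒢.tgt h)
    (b : ∀ x, 𝒢.algebroidFibre x) :
    𝒢.mulDeriv g h (0, 𝒢.leftTranslation h (b (𝒢.src h))) =
      𝒢.leftTranslation (𝒢.mul g h) (b (𝒢.src (𝒢.mul g h))) := by
  obtain ⟨c, hc, hcs⟩ := exists_hasVelocity_algebroidFibre _ (b (𝒢.src h))
  have h1 := hasVelocity_mul hgh (HasVelocity.const g) (hasVelocity_leftTranslation rfl b hc hcs)
    (hcs.mono fun t ht => by rw [𝒢.tgt_mul _ _ (by rw [𝒢.tgt_inv, ht]), hgh])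
  have h2 := (h1.congr (hcs.mono fun t ht =>
    (𝒢.mul_assoc g h _ hgh (by rw [𝒢.tgt_inv, ht])).symm)).unique
    (hasVelocity_leftTranslation (𝒢.src_mul g h hgh) b hc hcs)
  have h3 : ((0, -𝒢.leftTranslation h (b (𝒢.src h))) :
      TangentSpace (𝓡 (r + n)) g × TangentSpace (𝓡 (r + n)) h) =
      -(0, 𝒢.leftTranslation h (b (𝒢.src h))) := by simp
  rw [h3, map_neg] at h2
  exact neg_injective h2

/-- The curve `(g c⁻¹) (c h) = g h` is constant. These vectors frame the kernel of the differential
of the multiplication, and their minus sign is the one needed in `det_mul_det_mul_det_eq`. -/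
theorem mulDeriv_neg_leftTranslation_rightTranslation {g h : G} (hgh : 𝒢.src g = 𝒢.tgt h)
    (a : ∀ x, 𝒢.algebroidFibre x) :
    𝒢.mulDeriv g h (-𝒢.leftTranslation g (a (𝒢.src g)),
      𝒢.rightTranslation h (a (𝒢.tgt h))) = 0 := by
  obtain ⟨c, hc, hcs⟩ := exists_hasVelocity_algebroidFibre _ (a (𝒢.tgt h))
  have h1 := hasVelocity_mul hgh (hasVelocity_leftTranslation hgh a hc hcs)
    (hasVelocity_rightTranslation rfl a hc hcs)
    (hcs.mono fun t ht => by
      rw [𝒢.src_mul _ _ (by rw [𝒢.tgt_inv, ht, hgh]), 𝒢.tgt_mul _ _ ht, 𝒢.src_inv])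
  refine (h1.congr (hcs.mono fun t ht => ?_)).unique (HasVelocity.const (𝒢.mul g h))
  simp only []
  rw [𝒢.mul_assoc _ _ _ (by rw [𝒢.tgt_inv, ht, hgh]) (by rw [𝒢.tgt_mul _ _ ht, 𝒢.src_inv]),
    ← 𝒢.mul_assoc _ _ _ (𝒢.src_inv _) ht, 𝒢.inv_mul, ht, 𝒢.unit_mul]

/-- The hypothesis makes `(ξ, η)` the velocity of a curve of composable pairs, along which `src (c
c') = src c'`. -/
theorem mfderiv_src_mulDeriv {g h : G} (hgh : 𝒢.src g = 𝒢.tgt h)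
    (ξ : TangentSpace (𝓡 (r + n)) g) (η : TangentSpace (𝓡 (r + n)) h)
    (hξη : (mfderiv (𝓡 (r + n)) (𝓡 n) 𝒢.src g ξ : EuclideanSpace ℝ (Fin n)) =
      (mfderiv (𝓡 (r + n)) (𝓡 n) 𝒢.tgt h η : EuclideanSpace ℝ (Fin n))) :
    (mfderiv (𝓡 (r + n)) (𝓡 n) 𝒢.src (𝒢.mul g h) (𝒢.mulDeriv g h (ξ, η)) :
      EuclideanSpace ℝ (Fin n)) = mfderiv (𝓡 (r + n)) (𝓡 n) 𝒢.src h η := by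
  obtain ⟨c, c', hc, hc', hcc'⟩ := exists_hasVelocity_fibreProduct
    ((𝒢.contMDiff_src g).of_le (m := 1) (by simp)) ((𝒢.contMDiff_tgt h).of_le (m := 1) (by simp))
    hgh (𝒢.surjective_mfderiv_src g) ξ η hξη
  have h1 := ((hasVelocity_mul hgh hc hc' hcc').mfderiv
    (𝒢.contMDiff_src.mdifferentiableAt (by simp))).of_eq (𝒢.src_mul g h hgh)
  have h2 := hc'.mfderiv (f := 𝒢.src) (𝒢.contMDiff_src.mdifferentiableAt (by simp))
  exact (h1.congr (hcc'.mono fun t ht => 𝒢.src_mul _ _ ht)).unique h2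

theorem mfderiv_tgt_mulDeriv {g h : G} (hgh : 𝒢.src g = 𝒢.tgt h)
    (ξ : TangentSpace (𝓡 (r + n)) g) (η : TangentSpace (𝓡 (r + n)) h)
    (hξη : (mfderiv (𝓡 (r + n)) (𝓡 n) 𝒢.src g ξ : EuclideanSpace ℝ (Fin n)) =
      (mfderiv (𝓡 (r + n)) (𝓡 n) 𝒢.tgt h η : EuclideanSpace ℝ (Fin n))) :
    (mfderiv (𝓡 (r + n)) (𝓡 n) 𝒢.tgt (𝒢.mul g h) (𝒢.mulDeriv g h (ξ, η)) :
      EuclideanSpace ℝ (Fin n)) = mfderiv (𝓡 (r + n)) (𝓡 n) 𝒢.tgt g ξ := by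
  obtain ⟨c, c', hc, hc', hcc'⟩ := exists_hasVelocity_fibreProduct
    ((𝒢.contMDiff_src g).of_le (m := 1) (by simp)) ((𝒢.contMDiff_tgt h).of_le (m := 1) (by simp))
    hgh (𝒢.surjective_mfderiv_src g) ξ η hξη
  have h1 := ((hasVelocity_mul hgh hc hc' hcc').mfderiv
    (𝒢.contMDiff_tgt.mdifferentiableAt (by simp))).of_eq (𝒢.tgt_mul g h hgh)
  have h2 := hc.mfderiv (f := 𝒢.tgt) (𝒢.contMDiff_tgt.mdifferentiableAt (by simp))
  exact (h1.congr (hcc'.mono fun t ht => 𝒢.tgt_mul _ _ ht)).unique h2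

theorem mfderiv_src_srcLift (g : G) (X : TangentSpace (𝓡 n) (𝒢.src g)) :
    mfderiv (𝓡 (r + n)) (𝓡 n) 𝒢.src g (𝒢.srcLift g X) = X :=
  LinearMap.congr_fun ((mfderiv (𝓡 (r + n)) (𝓡 n) 𝒢.src
    g).toLinearMap.exists_rightInverse_of_surjective
      (LinearMap.range_eq_top.2 (𝒢.surjective_mfderiv_src g))).choose_spec X

theorem mfderiv_tgt_tgtLift (g : G) (Y : TangentSpace (𝓡 n) (𝒢.tgt g)) :
    mfderiv (𝓡 (r + n)) (𝓡 n) 𝒢.tgt g (𝒢.tgtLift g Y) = Y :=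
  LinearMap.congr_fun ((mfderiv (𝓡 (r + n)) (𝓡 n) 𝒢.tgt
    g).toLinearMap.exists_rightInverse_of_surjective
      (LinearMap.range_eq_top.2 (𝒢.surjective_mfderiv_tgt g))).choose_spec Y

end LieGroupoid

namespace LieGroupoid

variable {n r : ℕ} {M G : Type*}
  [TopologicalSpace M] [ChartedSpace (EuclideanSpace ℝ (Fin n)) M]
  [TopologicalSpace G] [ChartedSpace (EuclideanSpace ℝ (Fin (r + n))) G]
  {𝒢 : LieGroupoid n r M G}

/-! ### The frame ratio -/

theorem linearIndependent_rightTranslation (g : G)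
    (a : Module.Basis (Fin r) ℝ (𝒢.algebroidFibre (𝒢.tgt g))) :
    LinearIndependent ℝ (𝒢.rightTranslation g ∘ a) :=
  a.linearIndependent.map' _ (LinearMap.ker_eq_bot.2 (rightTranslation_injective g))

theorem linearIndependent_leftTranslation (g : G)
    (b : Module.Basis (Fin r) ℝ (𝒢.algebroidFibre (𝒢.src g))) :
    LinearIndependent ℝ (𝒢.leftTranslation g ∘ b) :=
  b.linearIndependent.map' _ (LinearMap.ker_eq_bot.2 (leftTranslation_injective g))

/-- The right translation of a frame of `A` frames the kernel of `d src`, so the determinant sees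
`w` only through `d src`. This is why the choice of the lifts is immaterial. -/
theorem exists_det_rightTranslation_eq (g : G)
    (B : Module.Basis (Fin r ⊕ Fin n) ℝ (TangentSpace (𝓡 (r + n)) g))
    (a : Module.Basis (Fin r) ℝ (𝒢.algebroidFibre (𝒢.tgt g)))
    (C : Module.Basis (Fin n) ℝ (TangentSpace (𝓡 n) (𝒢.src g))) :
    ∃ c : ℝ, c ≠ 0 ∧ ∀ w : Fin n → TangentSpace (𝓡 (r + n)) g,
      B.det (Sum.elim (𝒢.rightTranslation g ∘ a) w) =
        c * C.det (fun j => mfderiv (𝓡 (r + n)) (𝓡 n) 𝒢.src g (w j)) :=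
  exists_det_sumElim_eq_mul_det B C (mfderiv (𝓡 (r + n)) (𝓡 n) 𝒢.src g).toLinearMap
    (𝒢.surjective_mfderiv_src g) (linearIndependent_rightTranslation g a)
    (fun i => mfderiv_src_rightTranslation g (a i))

theorem exists_det_leftTranslation_eq (g : G)
    (B : Module.Basis (Fin r ⊕ Fin n) ℝ (TangentSpace (𝓡 (r + n)) g))
    (b : Module.Basis (Fin r) ℝ (𝒢.algebroidFibre (𝒢.src g)))
    (C : Module.Basis (Fin n) ℝ (TangentSpace (𝓡 n) (𝒢.tgt g))) :
    ∃ c : ℝ, c ≠ 0 ∧ ∀ w : Fin n → TangentSpace (𝓡 (r + n)) g,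
      B.det (Sum.elim (𝒢.leftTranslation g ∘ b) w) =
        c * C.det (fun j => mfderiv (𝓡 (r + n)) (𝓡 n) 𝒢.tgt g (w j)) :=
  exists_det_sumElim_eq_mul_det B C (mfderiv (𝓡 (r + n)) (𝓡 n) 𝒢.tgt g).toLinearMap
    (𝒢.surjective_mfderiv_tgt g) (linearIndependent_leftTranslation g b)
    (fun i => mfderiv_tgt_leftTranslation g (b i))

theorem det_rightTranslation_eq_of_lift (g : G)
    (B : Module.Basis (Fin r ⊕ Fin n) ℝ (TangentSpace (𝓡 (r + n)) g))
    (a : Module.Basis (Fin r) ℝ (𝒢.algebroidFibre (𝒢.tgt g)))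
    (X : Module.Basis (Fin n) ℝ (TangentSpace (𝓡 n) (𝒢.src g)))
    (w : Fin n → TangentSpace (𝓡 (r + n)) g)
    (hw : ∀ j, mfderiv (𝓡 (r + n)) (𝓡 n) 𝒢.src g (w j) = X j) :
    B.det (Sum.elim (𝒢.rightTranslation g ∘ a) w) =
      B.det (Sum.elim (𝒢.rightTranslation g ∘ a) (𝒢.srcLift g ∘ X)) := by
  obtain ⟨c, -, hc⟩ := exists_det_rightTranslation_eq g B a X
  rw [hc, hc]
  simp only [Function.comp_apply, mfderiv_src_srcLift, hw]

theorem det_leftTranslation_eq_of_lift (g : G)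
    (B : Module.Basis (Fin r ⊕ Fin n) ℝ (TangentSpace (𝓡 (r + n)) g))
    (b : Module.Basis (Fin r) ℝ (𝒢.algebroidFibre (𝒢.src g)))
    (Y : Module.Basis (Fin n) ℝ (TangentSpace (𝓡 n) (𝒢.tgt g)))
    (w : Fin n → TangentSpace (𝓡 (r + n)) g)
    (hw : ∀ j, mfderiv (𝓡 (r + n)) (𝓡 n) 𝒢.tgt g (w j) = Y j) :
    B.det (Sum.elim (𝒢.leftTranslation g ∘ b) w) =
      B.det (Sum.elim (𝒢.leftTranslation g ∘ b) (𝒢.tgtLift g ∘ Y)) := by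
  obtain ⟨c, -, hc⟩ := exists_det_leftTranslation_eq g B b Y
  rw [hc, hc]
  simp only [Function.comp_apply, mfderiv_tgt_tgtLift, hw]

theorem det_rightTranslation_srcLift_ne_zero (g : G)
    (B : Module.Basis (Fin r ⊕ Fin n) ℝ (TangentSpace (𝓡 (r + n)) g))
    (a : Module.Basis (Fin r) ℝ (𝒢.algebroidFibre (𝒢.tgt g)))
    (X : Module.Basis (Fin n) ℝ (TangentSpace (𝓡 n) (𝒢.src g))) :
    B.det (Sum.elim (𝒢.rightTranslation g ∘ a) (𝒢.srcLift g ∘ X)) ≠ 0 := by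
  obtain ⟨c, h0, hc⟩ := exists_det_rightTranslation_eq g B a X
  rw [hc]
  simp only [Function.comp_apply, mfderiv_src_srcLift]
  rw [X.det_self, mul_one]
  exact h0

theorem det_leftTranslation_tgtLift_ne_zero (g : G)
    (B : Module.Basis (Fin r ⊕ Fin n) ℝ (TangentSpace (𝓡 (r + n)) g))
    (b : Module.Basis (Fin r) ℝ (𝒢.algebroidFibre (𝒢.src g)))
    (Y : Module.Basis (Fin n) ℝ (TangentSpace (𝓡 n) (𝒢.tgt g))) :
    B.det (Sum.elim (𝒢.leftTranslation g ∘ b) (𝒢.tgtLift g ∘ Y)) ≠ 0 := by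
  obtain ⟨c, h0, hc⟩ := exists_det_leftTranslation_eq g B b Y
  rw [hc]
  simp only [Function.comp_apply, mfderiv_tgt_tgtLift]
  rw [Y.det_self, mul_one]
  exact h0

theorem frameRatio_ne_zero (g : G)
    (b : Module.Basis (Fin r) ℝ (𝒢.algebroidFibre (𝒢.src g)))
    (X : Module.Basis (Fin n) ℝ (TangentSpace (𝓡 n) (𝒢.src g)))
    (a : Module.Basis (Fin r) ℝ (𝒢.algebroidFibre (𝒢.tgt g)))
    (Y : Module.Basis (Fin n) ℝ (TangentSpace (𝓡 n) (𝒢.tgt g))) :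
    𝒢.frameRatio g b X a Y ≠ 0 :=
  div_ne_zero (det_leftTranslation_tgtLift_ne_zero g _ b Y)
    (det_rightTranslation_srcLift_ne_zero g _ a X)

/-- The factor is the inverse of the one in the transformation rule of `transverseFibre`, which
makes the action independent of the source frames. -/
theorem frameRatio_eq_of_src (g : G)
    (b b' : Module.Basis (Fin r) ℝ (𝒢.algebroidFibre (𝒢.src g)))
    (X X' : Module.Basis (Fin n) ℝ (TangentSpace (𝓡 n) (𝒢.src g)))
    (a : Module.Basis (Fin r) ℝ (𝒢.algebroidFibre (𝒢.tgt g)))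
    (Y : Module.Basis (Fin n) ℝ (TangentSpace (𝓡 n) (𝒢.tgt g))) :
    𝒢.frameRatio g b X a Y = 𝒢.frameRatio g b' X' a Y * (b'.det b * X.det X') := by
  have h1 : X'.det X * X.det X' = 1 := by rw [Module.Basis.det_mul_det, Module.Basis.det_self]
  have h2 : X'.det X = (X.det X')⁻¹ := eq_inv_of_mul_eq_one_left h1
  unfold frameRatio
  rw [det_sumElim_left _ (𝒢.leftTranslation g) _ b' b, det_sumElim_right _ (𝒢.srcLift g) _ X' X, h2,
    mul_div_mul_comm, div_inv_eq_mul]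
  ring

/-- The difference of the images by `d src` and by `d tgt` of the components of a pair of vectors. Its
kernel consists of the vectors tangent to the set of pairs of composable arrows. -/
def composableTangent (𝒢 : LieGroupoid n r M G) (g h : G) :
    (TangentSpace (𝓡 (r + n)) g × TangentSpace (𝓡 (r + n)) h) →ₗ[ℝ] EuclideanSpace ℝ (Fin n) :=
  let D : TangentSpace (𝓡 (r + n)) g →ₗ[ℝ] EuclideanSpace ℝ (Fin n) :=
    (mfderiv (𝓡 (r + n)) (𝓡 n) 𝒢.src g).toLinearMap
  let D' : TangentSpace (𝓡 (r + n)) h →ₗ[ℝ] EuclideanSpace ℝ (Fin n) :=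
    (mfderiv (𝓡 (r + n)) (𝓡 n) 𝒢.tgt h).toLinearMap
  D ∘ₗ LinearMap.fst ℝ _ _ - D' ∘ₗ LinearMap.snd ℝ _ _

theorem mem_ker_composableTangent {g h : G} {ξ : TangentSpace (𝓡 (r + n)) g}
    {η : TangentSpace (𝓡 (r + n)) h} :
    (ξ, η) ∈ LinearMap.ker (𝒢.composableTangent g h) ↔
      (mfderiv (𝓡 (r + n)) (𝓡 n) 𝒢.src g ξ : EuclideanSpace ℝ (Fin n)) =
        (mfderiv (𝓡 (r + n)) (𝓡 n) 𝒢.tgt h η : EuclideanSpace ℝ (Fin n)) :=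
  LinearMap.mem_ker.trans (sub_eq_zero (G := EuclideanSpace ℝ (Fin n)))

/-- The map is onto already because `d src` is, so the kernel has dimension `2 (r + n) - n`. -/
theorem finrank_ker_composableTangent (g h : G) :
    Module.finrank ℝ (LinearMap.ker (𝒢.composableTangent g h)) =
      Fintype.card (Fin r ⊕ (Fin r ⊕ Fin n)) := by
  have hfd : ∀ g : G, FiniteDimensional ℝ (TangentSpace (𝓡 (r + n)) g) := fun _ =>
    inferInstanceAs (FiniteDimensional ℝ (EuclideanSpace ℝ (Fin (r + n))))
  have hfr : ∀ g : G, Module.finrank ℝ (TangentSpace (𝓡 (r + n)) g) = r + n := fun _ =>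
    finrank_euclideanSpace_fin
  have h1 := LinearMap.finrank_range_add_finrank_ker (𝒢.composableTangent g h)
  have h2 : LinearMap.range (𝒢.composableTangent g h) = ⊤ := by
    refine LinearMap.range_eq_top.2 fun y => ?_
    obtain ⟨x, hx⟩ := 𝒢.surjective_mfderiv_src g y
    refine ⟨(x, 0), ?_⟩
    have h0 : (mfderiv (𝓡 (r + n)) (𝓡 n) 𝒢.tgt h 0 : EuclideanSpace ℝ (Fin n)) = 0 := map_zero _
    exact (congrArg (fun v => (mfderiv (𝓡 (r + n)) (𝓡 n) 𝒢.src g x : EuclideanSpace ℝ (Fin n)) - v)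
      h0).trans ((sub_zero (G := EuclideanSpace ℝ (Fin n)) _).trans hx)
  rw [h2, finrank_top, finrank_euclideanSpace_fin, Module.finrank_prod, hfr, hfr] at h1
  simp only [Fintype.card_sum, Fintype.card_fin]
  omega

/-- Frames over propositionally equal points are compared in the model space, which avoids
transports. -/
theorem apply_eq_of_eq {k : ℕ} (X : ∀ x : M, Module.Basis (Fin k) ℝ (TangentSpace (𝓡 n) x))
    {x y : M} (h : x = y) (j : Fin k) :
    (X x j : EuclideanSpace ℝ (Fin n)) = (X y j : EuclideanSpace ℝ (Fin n)) := by
  subst h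
  rfl

/-- The frame ratio is multiplicative. -/
theorem frameRatio_mul {g h : G} (hgh : 𝒢.src g = 𝒢.tgt h)
    (a : ∀ x, Module.Basis (Fin r) ℝ (𝒢.algebroidFibre x))
    (X : ∀ x : M, Module.Basis (Fin n) ℝ (TangentSpace (𝓡 n) x)) :
    𝒢.frameRatio (𝒢.mul g h) (a _) (X _) (a _) (X _) =
      𝒢.frameRatio g (a _) (X _) (a _) (X _) * 𝒢.frameRatio h (a _) (X _) (a _) (X _) := by
  have hfd : ∀ g : G, FiniteDimensional ℝ (TangentSpace (𝓡 (r + n)) g) := fun _ =>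
    inferInstanceAs (FiniteDimensional ℝ (EuclideanSpace ℝ (Fin (r + n))))
  -- `W` plays the role of the tangent space of the composable pairs. `u`, `l` and `k` below frame
  -- the kernels of `ph`, `pg` and `m`.
  let W := LinearMap.ker (𝒢.composableTangent g h)
  let B : Module.Basis (Fin r ⊕ (Fin r ⊕ Fin n)) ℝ W :=
    (Module.finBasisOfFinrankEq ℝ W (finrank_ker_composableTangent g h)).reindex
      (Fintype.equivFin _).symm
  let pg : W →ₗ[ℝ] TangentSpace (𝓡 (r + n)) g := (LinearMap.fst ℝ _ _).domRestrict W
  let ph : W →ₗ[ℝ] TangentSpace (𝓡 (r + n)) h := (LinearMap.snd ℝ _ _).domRestrict W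
  let m : W →ₗ[ℝ] TangentSpace (𝓡 (r + n)) (𝒢.mul g h) := (𝒢.mulDeriv g h).domRestrict W
  have hph : ∀ η, ∃ ξ, ((ξ, η) : TangentSpace (𝓡 (r + n)) g × TangentSpace (𝓡 (r + n)) h) ∈ W :=
    fun η => by
      obtain ⟨ξ, hξ⟩ := 𝒢.surjective_mfderiv_src g (mfderiv (𝓡 (r + n)) (𝓡 n) 𝒢.tgt h η)
      exact ⟨ξ, mem_ker_composableTangent.2 hξ⟩
  have hpg : ∀ ξ, ∃ η, ((ξ, η) : TangentSpace (𝓡 (r + n)) g × TangentSpace (𝓡 (r + n)) h) ∈ W :=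
    fun ξ => by
      obtain ⟨η, hη⟩ := 𝒢.surjective_mfderiv_tgt h (mfderiv (𝓡 (r + n)) (𝓡 n) 𝒢.src g ξ)
      exact ⟨η, mem_ker_composableTangent.2 hη.symm⟩
  have hu : ∀ i, ((𝒢.rightTranslation g (a (𝒢.tgt g) i), 0) :
      TangentSpace (𝓡 (r + n)) g × TangentSpace (𝓡 (r + n)) h) ∈ W := fun i =>
    mem_ker_composableTangent.2 (by rw [mfderiv_src_rightTranslation, map_zero]; rfl)
  have hl : ∀ i, ((0, 𝒢.leftTranslation h (a (𝒢.src h) i)) :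
      TangentSpace (𝓡 (r + n)) g × TangentSpace (𝓡 (r + n)) h) ∈ W := fun i =>
    mem_ker_composableTangent.2 (by rw [mfderiv_tgt_leftTranslation, map_zero]; rfl)
  -- Both components come from one curve `c`: `src (g c⁻¹)` and `tgt (c h)` are both `tgt c`.
  have hk : ∀ i, ((-𝒢.leftTranslation g (a (𝒢.src g) i), 𝒢.rightTranslation h (a (𝒢.tgt h) i)) :
      TangentSpace (𝓡 (r + n)) g × TangentSpace (𝓡 (r + n)) h) ∈ W := fun i => by
    obtain ⟨c, hc, hcs⟩ := exists_hasVelocity_algebroidFibre _ (a (𝒢.tgt h) i)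
    have h1 := (hasVelocity_leftTranslation hgh (fun x => a x i) hc hcs).mfderiv (f := 𝒢.src)
      (𝒢.contMDiff_src.mdifferentiableAt (by simp))
    have h2 := (hasVelocity_rightTranslation rfl (fun x => a x i) hc hcs).mfderiv (f := 𝒢.tgt)
      (𝒢.contMDiff_tgt.mdifferentiableAt (by simp))
    have h3 := HasVelocity.of_eq h2 hgh.symm
    refine mem_ker_composableTangent.2 (HasVelocity.unique (I := 𝓡 n) h1 (h3.congr ?_))
    filter_upwards [hcs] with t ht
    rw [𝒢.tgt_mul _ _ ht, 𝒢.src_mul _ _ (by rw [𝒢.tgt_inv, ht, hgh]), 𝒢.src_inv]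
  -- One family `y` lifts both the frame at `src g` and the frame at `tgt h`, because these points
  -- coincide. `x` and `z` similarly lift the frames at `src h` and `tgt g`.
  have hy : ∀ j, ((𝒢.srcLift g (X (𝒢.src g) j), 𝒢.tgtLift h (X (𝒢.tgt h) j)) :
      TangentSpace (𝓡 (r + n)) g × TangentSpace (𝓡 (r + n)) h) ∈ W := fun j =>
    mem_ker_composableTangent.2 (by
      rw [mfderiv_src_srcLift, mfderiv_tgt_tgtLift]
      exact apply_eq_of_eq X hgh j)
  choose x1 hx using fun j => hph (𝒢.srcLift h (X (𝒢.src h) j))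
  choose z2 hz using fun j => hpg (𝒢.tgtLift g (X (𝒢.tgt g) j))
  let u : Fin r → W := fun i => ⟨_, hu i⟩
  let k : Fin r → W := fun i => ⟨_, hk i⟩
  let l : Fin r → W := fun i => ⟨_, hl i⟩
  let x : Fin n → W := fun j => ⟨_, hx j⟩
  let y : Fin n → W := fun j => ⟨_, hy j⟩
  let z : Fin n → W := fun j => ⟨_, hz j⟩
  have hmu : m ∘ u = 𝒢.rightTranslation (𝒢.mul g h) ∘ a _ := by
    funext i
    exact mulDeriv_rightTranslation hgh fun x => a x i
  have hml : m ∘ l = 𝒢.leftTranslation (𝒢.mul g h) ∘ a _ := by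
    funext i
    exact mulDeriv_leftTranslation hgh fun x => a x i
  have hmx : ∀ j, mfderiv (𝓡 (r + n)) (𝓡 n) 𝒢.src (𝒢.mul g h) (m (x j)) = X _ j := fun j =>
    (mfderiv_src_mulDeriv hgh _ _ (mem_ker_composableTangent.1 (hx j))).trans
      ((mfderiv_src_srcLift h _).trans (apply_eq_of_eq X (𝒢.src_mul g h hgh).symm j))
  have hmz : ∀ j, mfderiv (𝓡 (r + n)) (𝓡 n) 𝒢.tgt (𝒢.mul g h) (m (z j)) = X _ j := fun j =>
    (mfderiv_tgt_mulDeriv hgh _ _ (mem_ker_composableTangent.1 (hz j))).trans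
      ((mfderiv_tgt_tgtLift g _).trans (apply_eq_of_eq X (𝒢.tgt_mul g h hgh).symm j))
  -- The image contains the kernel of `d src` at `g h`, spanned by right translations for reasons of
  -- dimension, and it maps onto the tangent space at the source.
  have hmsurj : Function.Surjective m := by
    have hR : LinearMap.ker (mfderiv (𝓡 (r + n)) (𝓡 n) 𝒢.src (𝒢.mul g h)).toLinearMap ≤
        LinearMap.range m := by
      have h1 : Submodule.span ℝ (Set.range (m ∘ u)) ≤ LinearMap.range m :=
        Submodule.span_le.2 (by rintro _ ⟨i, rfl⟩; exact ⟨_, rfl⟩)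
      refine le_trans (le_of_eq ?_) h1
      symm
      apply Submodule.eq_of_le_of_finrank_eq
      · refine Submodule.span_le.2 ?_
        rintro _ ⟨i, rfl⟩
        rw [hmu]
        exact mfderiv_src_rightTranslation _ _
      · rw [hmu, finrank_span_eq_card (linearIndependent_rightTranslation _ _), Fintype.card_fin]
        have h2 := LinearMap.finrank_range_add_finrank_ker
          (mfderiv (𝓡 (r + n)) (𝓡 n) 𝒢.src (𝒢.mul g h)).toLinearMap
        have h3 : Module.finrank ℝ (TangentSpace (𝓡 n) (𝒢.src (𝒢.mul g h))) = n :=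
          finrank_euclideanSpace_fin
        have h4 : Module.finrank ℝ (TangentSpace (𝓡 (r + n)) (𝒢.mul g h)) = r + n :=
          finrank_euclideanSpace_fin
        rw [LinearMap.range_eq_top.2 (𝒢.surjective_mfderiv_src _), finrank_top, h3, h4] at h2
        omega
    intro v
    obtain ⟨η, hη⟩ := 𝒢.surjective_mfderiv_src h
      (mfderiv (𝓡 (r + n)) (𝓡 n) 𝒢.src (𝒢.mul g h) v : EuclideanSpace ℝ (Fin n))
    obtain ⟨ξ, hξ⟩ := hph η
    have h5 : v - m ⟨_, hξ⟩ ∈ LinearMap.range m := hR (by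
      rw [LinearMap.mem_ker, map_sub, sub_eq_zero]
      exact hη.symm.trans (mfderiv_src_mulDeriv hgh _ _ (mem_ker_composableTangent.1 hξ)).symm)
    obtain ⟨w, hw⟩ := h5
    exact ⟨w + ⟨_, hξ⟩, by rw [map_add, hw, sub_add_cancel]⟩
  have key := det_mul_det_mul_det_eq B (tangentBasis (r := r) (n := n) g)
    (tangentBasis (r := r) (n := n) h) (tangentBasis (r := r) (n := n) (𝒢.mul g h)) pg ph m
    (fun ξ => ⟨⟨_, (hpg ξ).choose_spec⟩, rfl⟩) (fun η => ⟨⟨_, (hph η).choose_spec⟩, rfl⟩) hmsurj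
    (u := u) (k := k) (l := l) x y z
    (LinearIndependent.of_comp pg (linearIndependent_rightTranslation g (a _)))
    (LinearIndependent.of_comp ph (linearIndependent_rightTranslation h (a _)))
    (LinearIndependent.of_comp ph (linearIndependent_leftTranslation h (a _)))
    (fun i => rfl) (fun i => mulDeriv_neg_leftTranslation_rightTranslation hgh fun x => a x i)
    (fun i => rfl)
  rw [hmu, hml, det_rightTranslation_eq_of_lift _ _ _ (X _) (m ∘ x) hmx,
    det_leftTranslation_eq_of_lift _ _ _ (X _) (m ∘ z) hmz] at key
  have e1 : pg ∘ u = 𝒢.rightTranslation g ∘ a _ := rfl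
  have e2 : pg ∘ y = 𝒢.srcLift g ∘ X _ := rfl
  have e3 : ph ∘ k = 𝒢.rightTranslation h ∘ a _ := rfl
  have e4 : ph ∘ x = 𝒢.srcLift h ∘ X _ := rfl
  have e5 : ph ∘ l = 𝒢.leftTranslation h ∘ a _ := rfl
  have e6 : ph ∘ y = 𝒢.tgtLift h ∘ X _ := rfl
  have e7 : (fun i => -pg (k i)) = 𝒢.leftTranslation g ∘ a _ := funext fun i => neg_neg _
  have e8 : pg ∘ z = 𝒢.tgtLift g ∘ X _ := rfl
  rw [e1, e2, e3, e4, e5, e6, e7, e8] at key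
  unfold frameRatio
  rw [div_mul_div_comm, div_eq_div_iff (det_rightTranslation_srcLift_ne_zero _ _ _ _)
    (mul_ne_zero (det_rightTranslation_srcLift_ne_zero _ _ _ _)
      (det_rightTranslation_srcLift_ne_zero _ _ _ _))]
  linear_combination key

end LieGroupoid

namespace LieGroupoid

variable {n r : ℕ} {M G : Type*}
  [TopologicalSpace M] [ChartedSpace (EuclideanSpace ℝ (Fin n)) M]
  [TopologicalSpace G] [ChartedSpace (EuclideanSpace ℝ (Fin (r + n))) G]
  {𝒢 : LieGroupoid n r M G} {χ : ℝ →*₀ ℝ}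

/-! ### The fibres of the transverse bundle -/

theorem transverseFibre_apply {x : M} (ξ : 𝒢.transverseFibre χ x)
    (a a' : Module.Basis (Fin r) ℝ (𝒢.algebroidFibre x))
    (X X' : Module.Basis (Fin n) ℝ (TangentSpace (𝓡 n) x)) :
    ξ.1 a' X' = χ (a'.det a) * χ (X.det X') * ξ.1 a X :=
  ξ.2 a a' X X'

theorem character_ne_zero (χ : ℝ →*₀ ℝ) {t : ℝ} (ht : t ≠ 0) : χ t ≠ 0 :=
  (map_ne_zero χ).2 ht

/-- The fibre is a line: any two pairs of frames are related by determinants, so one value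
determines all the others. -/
theorem transverseFibre_ext {x : M} {ξ η : 𝒢.transverseFibre χ x}
    (a : Module.Basis (Fin r) ℝ (𝒢.algebroidFibre x))
    (X : Module.Basis (Fin n) ℝ (TangentSpace (𝓡 n) x)) (h : ξ.1 a X = η.1 a X) : ξ = η := by
  apply Subtype.ext
  funext a' X'
  rw [transverseFibre_apply ξ a a' X X', transverseFibre_apply η a a' X X', h]

theorem transverseFibre_apply_ne_zero {x : M} {ξ : 𝒢.transverseFibre χ x} (hξ : ξ ≠ 0)
    (a : Module.Basis (Fin r) ℝ (𝒢.algebroidFibre x))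
    (X : Module.Basis (Fin n) ℝ (TangentSpace (𝓡 n) x)) : ξ.1 a X ≠ 0 :=
  fun h => hξ (transverseFibre_ext a X h)

theorem ne_zero_of_apply_ne_zero {x : M} {ξ : 𝒢.transverseFibre χ x}
    {a : Module.Basis (Fin r) ℝ (𝒢.algebroidFibre x)}
    {X : Module.Basis (Fin n) ℝ (TangentSpace (𝓡 n) x)} (h : ξ.1 a X ≠ 0) : ξ ≠ 0 := by
  rintro rfl
  exact h rfl

variable (𝒢 χ) in
/-- The element of the fibre of the transverse bundle with a given value on given frames. -/
def ofFrame {x : M} (a : Module.Basis (Fin r) ℝ (𝒢.algebroidFibre x))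
    (X : Module.Basis (Fin n) ℝ (TangentSpace (𝓡 n) x)) (c : ℝ) : 𝒢.transverseFibre χ x :=
  ⟨fun a' X' => χ (a'.det a) * χ (X.det X') * c, fun a₁ a₂ X₁ X₂ => by
    have h1 : a₂.det a = a₂.det a₁ * a₁.det a := (Module.Basis.det_mul_det _ _ _).symm
    have h2 : X.det X₂ = X.det X₁ * X₁.det X₂ := (Module.Basis.det_mul_det _ _ _).symm
    beta_reduce
    rw [h1, h2, map_mul, map_mul]
    ring⟩

theorem ofFrame_apply {x : M} (a a' : Module.Basis (Fin r) ℝ (𝒢.algebroidFibre x))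
    (X X' : Module.Basis (Fin n) ℝ (TangentSpace (𝓡 n) x)) (c : ℝ) :
    (𝒢.ofFrame χ a X c).1 a' X' = χ (a'.det a) * χ (X.det X') * c := rfl

theorem ofFrame_apply_self {x : M} (a : Module.Basis (Fin r) ℝ (𝒢.algebroidFibre x))
    (X : Module.Basis (Fin n) ℝ (TangentSpace (𝓡 n) x)) (c : ℝ) :
    (𝒢.ofFrame χ a X c).1 a X = c := by
  simp [ofFrame_apply, Module.Basis.det_self]

theorem basis_det_mul_det_symm {V ι : Type*} [AddCommGroup V] [Module ℝ V] [Fintype ι]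
    [DecidableEq ι] (a b : Module.Basis ι ℝ V) : a.det b * b.det a = 1 := by
  rw [Module.Basis.det_mul_det, Module.Basis.det_self]

/-- Changing the source frames multiplies the frame ratio and `ξ` by mutually inverse factors.
Smooth frames may therefore replace the ones in the definition. -/
theorem transverseAction_apply (g : G) (ξ : 𝒢.transverseFibre χ (𝒢.src g))
    (b : Module.Basis (Fin r) ℝ (𝒢.algebroidFibre (𝒢.src g)))
    (X : Module.Basis (Fin n) ℝ (TangentSpace (𝓡 n) (𝒢.src g)))
    (a : Module.Basis (Fin r) ℝ (𝒢.algebroidFibre (𝒢.tgt g)))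
    (Y : Module.Basis (Fin n) ℝ (TangentSpace (𝓡 n) (𝒢.tgt g))) :
    (𝒢.transverseAction χ g ξ).1 a Y = χ (𝒢.frameRatio g b X a Y) * ξ.1 b X := by
  change χ (𝒢.frameRatio g (𝒢.someFrame (𝒢.src g)) (someTangentFrame (𝒢.src g)) a Y) *
        ξ.1 (𝒢.someFrame (𝒢.src g)) (someTangentFrame (𝒢.src g)) = _
  rw [frameRatio_eq_of_src g _ b _ X, transverseFibre_apply ξ b _ X _, map_mul, map_mul]
  have h1 := congrArg χ (basis_det_mul_det_symm b (𝒢.someFrame (𝒢.src g)))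
  have h2 := congrArg χ (basis_det_mul_det_symm X (someTangentFrame (𝒢.src g)))
  rw [map_mul, map_one] at h1 h2
  linear_combination (χ (𝒢.frameRatio g b X a Y) * ξ.1 b X) * χ (X.det (someTangentFrame (𝒢.src g))) *
    χ ((someTangentFrame (𝒢.src g)).det X) * h1 + (χ (𝒢.frameRatio g b X a Y) * ξ.1 b X) * h2

theorem transverseAction_ne_zero {g : G} {ξ : 𝒢.transverseFibre χ (𝒢.src g)} (hξ : ξ ≠ 0) :
    𝒢.transverseAction χ g ξ ≠ 0 :=
  ne_zero_of_apply_ne_zero (a := 𝒢.someFrame _) (X := someTangentFrame _) (by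
    rw [transverseAction_apply g ξ (𝒢.someFrame _) (someTangentFrame _)]
    exact mul_ne_zero (character_ne_zero χ (frameRatio_ne_zero _ _ _ _ _))
      (transverseFibre_apply_ne_zero hξ _ _))

variable (𝒢) in
/-- The frame ratio for a choice of frames at all points. -/
def ratio (g : G) : ℝ :=
  𝒢.frameRatio g (𝒢.someFrame _) (someTangentFrame _) (𝒢.someFrame _) (someTangentFrame _)

theorem ratio_ne_zero (g : G) : 𝒢.ratio g ≠ 0 := frameRatio_ne_zero _ _ _ _ _

/-- Functoriality of `g_*` in the chosen frames. `ratio` itself need not be continuous, since the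
frames are chosen point by point. -/
theorem ratio_mul {g h : G} (hgh : 𝒢.src g = 𝒢.tgt h) :
    𝒢.ratio (𝒢.mul g h) = 𝒢.ratio g * 𝒢.ratio h :=
  frameRatio_mul hgh 𝒢.someFrame someTangentFrame

theorem ratio_unit (x : M) : 𝒢.ratio (𝒢.unit x) = 1 := by
  have h1 := 𝒢.mul_unit (𝒢.unit x)
  rw [𝒢.src_unit] at h1
  have h2 := ratio_mul (𝒢 := 𝒢) (g := 𝒢.unit x) (h := 𝒢.unit x)
    (by rw [𝒢.src_unit, 𝒢.tgt_unit])
  rw [h1] at h2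
  exact (mul_eq_left₀ (ratio_ne_zero _)).1 h2.symm

variable (𝒢 χ) in
/-- The value of an element of the transverse bundle on the chosen frames. -/
def value {x : M} (ξ : 𝒢.transverseFibre χ x) : ℝ := ξ.1 (𝒢.someFrame x) (someTangentFrame x)

theorem value_injective {x : M} : Function.Injective (𝒢.value χ (x := x)) :=
  fun _ _ h => transverseFibre_ext _ _ h

theorem value_ne_zero {x : M} {ξ : 𝒢.transverseFibre χ x} : 𝒢.value χ ξ ≠ 0 ↔ ξ ≠ 0 :=
  ⟨ne_zero_of_apply_ne_zero, fun h => transverseFibre_apply_ne_zero h _ _⟩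

theorem value_smul {x : M} (c : ℝ) (ξ : 𝒢.transverseFibre χ x) :
    𝒢.value χ (c • ξ) = c * 𝒢.value χ ξ := rfl

theorem value_transverseAction (g : G) (ξ : 𝒢.transverseFibre χ (𝒢.src g)) :
    𝒢.value χ (𝒢.transverseAction χ g ξ) = χ (𝒢.ratio g) * 𝒢.value χ ξ := rfl

/-- The factor is the same for all `ξ` in a fibre. Quotients of values of two sections are thus the
same in every frame, and inherit smoothness from smooth frames. -/
theorem apply_eq_mul_value {x : M} (a : Module.Basis (Fin r) ℝ (𝒢.algebroidFibre x))
    (X : Module.Basis (Fin n) ℝ (TangentSpace (𝓡 n) x)) :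
    ∃ k : ℝ, k ≠ 0 ∧ ∀ ξ : 𝒢.transverseFibre χ x, ξ.1 a X = k * 𝒢.value χ ξ :=
  ⟨_, mul_ne_zero (character_ne_zero χ (a.isUnit_det _).ne_zero)
    (character_ne_zero χ ((someTangentFrame x).isUnit_det _).ne_zero),
    fun ξ => transverseFibre_apply ξ _ a _ X⟩

end LieGroupoid

/-! ### Smooth families of tangent vectors -/

section SmoothFamily

variable {E : Type*} [NormedAddCommGroup E] [NormedSpace ℝ E] {H : Type*} [TopologicalSpace H]
  {I : ModelWithCorners ℝ E H} {P : Type*} [TopologicalSpace P] [ChartedSpace H P]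
  {F : Type*} [NormedAddCommGroup F] [NormedSpace ℝ F] {K : Type*} [TopologicalSpace K]
  {J : ModelWithCorners ℝ F K} {N : Type*} [TopologicalSpace N] [ChartedSpace K N]
  [IsManifold I ∞ P]

variable (I) in
/-- The vector field near `p₀` which is constant in the chart at `p₀`. -/
def chartVector (p₀ : P) (e : E) (p : P) : TangentSpace I p :=
  (trivializationAt E (TangentSpace I) p₀).symm p e

theorem trivializationAt_chartVector {p₀ p : P} (hp : p ∈ (chartAt H p₀).source) (e : E) :
    (trivializationAt E (TangentSpace I) p₀ ⟨p, chartVector I p₀ e p⟩).2 = e :=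
  congrArg Prod.snd ((trivializationAt E (TangentSpace I) p₀).apply_mk_symm hp e)

theorem chartVector_trivializationAt {p₀ p : P} (hp : p ∈ (chartAt H p₀).source)
    (v : TangentSpace I p) :
    chartVector I p₀ (trivializationAt E (TangentSpace I) p₀ ⟨p, v⟩).2 p = v :=
  (trivializationAt E (TangentSpace I) p₀).symm_apply_apply_mk hp v

theorem contMDiffAt_chartVector {p₀ : P} {φ : N → P} {x₀ : N} (hφ : ContMDiffAt J I ∞ φ x₀)
    (hp : φ x₀ ∈ (chartAt H p₀).source) (e : E) :
    ContMDiffAt J I.tangent ∞ (fun x => (⟨φ x, chartVector I p₀ e (φ x)⟩ : TangentBundle I P))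
      x₀ := by
  refine ((trivializationAt E (TangentSpace I) p₀).contMDiffAt_iff hp).2 ⟨hφ, ?_⟩
  refine (contMDiffAt_const (c := e)).congr_of_eventuallyEq ?_
  filter_upwards [hφ.continuousAt ((chartAt H p₀).open_source.mem_nhds hp)] with x hx
  exact trivializationAt_chartVector hx e

theorem contMDiffAt_tangent_sub {φ : N → P} {x₀ : N} {v w : ∀ x, TangentSpace I (φ x)}
    (hv : ContMDiffAt J I.tangent ∞ (fun x => (⟨φ x, v x⟩ : TangentBundle I P)) x₀)
    (hw : ContMDiffAt J I.tangent ∞ (fun x => (⟨φ x, w x⟩ : TangentBundle I P)) x₀) :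
    ContMDiffAt J I.tangent ∞ (fun x => (⟨φ x, v x - w x⟩ : TangentBundle I P)) x₀ := by
  obtain ⟨hφ, hv2⟩ := Bundle.contMDiffAt_totalSpace.1 hv
  obtain ⟨-, hw2⟩ := Bundle.contMDiffAt_totalSpace.1 hw
  refine Bundle.contMDiffAt_totalSpace.2 ⟨hφ, (hv2.sub hw2).congr_of_eventuallyEq ?_⟩
  filter_upwards [hφ.continuousAt ((chartAt H (φ x₀)).open_source.mem_nhds
    (mem_chart_source H (φ x₀)))] with x hx
  exact ((trivializationAt E (TangentSpace I) (φ x₀)).linear ℝ hx).map_sub (v x) (w x)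

theorem contMDiffAt_tangent_neg {φ : N → P} {x₀ : N} {v : ∀ x, TangentSpace I (φ x)}
    (hv : ContMDiffAt J I.tangent ∞ (fun x => (⟨φ x, v x⟩ : TangentBundle I P)) x₀) :
    ContMDiffAt J I.tangent ∞ (fun x => (⟨φ x, -v x⟩ : TangentBundle I P)) x₀ := by
  have h := contMDiffAt_tangent_sub (contMDiffAt_tangent_sub hv hv) hv
  simpa using h

variable {ι : Type*}

open Classical in
variable (I) in
/-- The frame of the tangent bundle near `p₀` which is constant in the chart at `p₀`. -/
def chartBasis (B : Module.Basis ι ℝ E) (p₀ p : P) : Module.Basis ι ℝ (TangentSpace I p) :=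
  if hp : p ∈ (trivializationAt E (TangentSpace I) p₀).baseSet then
    B.map ((trivializationAt E (TangentSpace I) p₀).linearEquivAt ℝ p hp).symm
  else
    -- Outside the chart domain of `p₀` it only matters that this is some basis.
    B.map ((trivializationAt E (TangentSpace I) p).linearEquivAt ℝ p (mem_chart_source H p)).symm

theorem chartBasis_apply (B : Module.Basis ι ℝ E) {p₀ p : P} (hp : p ∈ (chartAt H p₀).source)
    (i : ι) : chartBasis I B p₀ p i = chartVector I p₀ (B i) p := by
  have hp' : p ∈ (trivializationAt E (TangentSpace I) p₀).baseSet := hp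
  rw [chartBasis, dif_pos hp']
  rfl

variable [Fintype ι] [DecidableEq ι]

theorem chartBasis_det (B : Module.Basis ι ℝ E) {p₀ p : P} (hp : p ∈ (chartAt H p₀).source)
    (v : ι → TangentSpace I p) :
    (chartBasis I B p₀ p).det v =
      B.det (fun i => (trivializationAt E (TangentSpace I) p₀ ⟨p, v i⟩).2) := by
  have hp' : p ∈ (trivializationAt E (TangentSpace I) p₀).baseSet := hp
  rw [chartBasis, dif_pos hp', Module.Basis.det_map]
  rfl

/-- By the Leibniz formula it is a polynomial in the coordinates. -/
theorem contDiff_basis_det [FiniteDimensional ℝ E] (B : Module.Basis ι ℝ E) :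
    ContDiff ℝ ∞ (fun v : ι → E => B.det v) := by
  have h : (fun v : ι → E => B.det v) = fun v =>
      ∑ σ : Equiv.Perm ι, ((Equiv.Perm.sign σ : ℤ) : ℝ) * ∏ i, B.repr (v i) (σ i) := by
    funext v
    rw [Module.Basis.det_apply, Matrix.det_apply']
    simp [Module.Basis.toMatrix_apply]
  rw [h]
  have hc : ∀ i j, ContDiff ℝ ∞ (fun v : ι → E => B.repr (v i) j) := fun i j =>
    (LinearMap.toContinuousLinearMap (B.coord j)).contDiff.comp (contDiff_apply ℝ E i)
  exact ContDiff.sum fun σ _ => contDiff_const.mul (contDiff_prod fun i _ => hc i (σ i))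

theorem contMDiffAt_chartBasis_det [FiniteDimensional ℝ E] (B : Module.Basis ι ℝ E) {φ : N → P}
    {x₀ : N} {p₀ : P} (hp : φ x₀ = p₀) (hφ : ContMDiffAt J I ∞ φ x₀)
    {v : ∀ x, ι → TangentSpace I (φ x)}
    (hv : ∀ i, ContMDiffAt J I.tangent ∞ (fun x => (⟨φ x, v x i⟩ : TangentBundle I P)) x₀) :
    ContMDiffAt J 𝓘(ℝ, ℝ) ∞ (fun x => (chartBasis I B p₀ (φ x)).det (v x)) x₀ := by
  subst hp
  have h1 : ContMDiffAt J 𝓘(ℝ, ι → E) ∞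
      (fun x i => (trivializationAt E (TangentSpace I) (φ x₀) ⟨φ x, v x i⟩).2) x₀ :=
    contMDiffAt_pi_space.2 fun i => (Bundle.contMDiffAt_totalSpace.1 (hv i)).2
  refine ((contDiff_basis_det B).contMDiff.contMDiffAt.comp x₀ h1).congr_of_eventuallyEq ?_
  filter_upwards [hφ.continuousAt ((chartAt H (φ x₀)).open_source.mem_nhds
    (mem_chart_source H (φ x₀)))] with x hx
  exact chartBasis_det B hx _

end SmoothFamily

/-! ### The splitting of the tangent space at a unit, and smooth frames -/

namespace LieGroupoid

variable {n r : ℕ} {M G : Type*}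
  [TopologicalSpace M] [ChartedSpace (EuclideanSpace ℝ (Fin n)) M]
  [TopologicalSpace G] [ChartedSpace (EuclideanSpace ℝ (Fin (r + n))) G]
  {𝒢 : LieGroupoid n r M G}

theorem mfderiv_src_mfderiv_unit (x : M) (v : TangentSpace (𝓡 n) x) :
    (mfderiv (𝓡 (r + n)) (𝓡 n) 𝒢.src (𝒢.unit x) (mfderiv (𝓡 n) (𝓡 (r + n)) 𝒢.unit x v) :
      EuclideanSpace ℝ (Fin n)) = v := by
  have h1 := mfderiv_comp (I := 𝓡 n) (I' := 𝓡 (r + n)) (I'' := 𝓡 n) x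
    (𝒢.contMDiff_src.mdifferentiableAt (x := 𝒢.unit x) (by simp))
    (𝒢.contMDiff_unit.mdifferentiableAt (x := x) (by simp))
  have h2 : 𝒢.src ∘ 𝒢.unit = id := funext 𝒢.src_unit
  have h3 : (mfderiv (𝓡 n) (𝓡 n) (𝒢.src ∘ 𝒢.unit) x v : EuclideanSpace ℝ (Fin n)) = v := by
    rw [h2, mfderiv_id]
    rfl
  rw [h1] at h3
  exact h3

theorem tangentBundle_mk_eq {F K N : Type*}
    [NormedAddCommGroup F] [NormedSpace ℝ F] [TopologicalSpace K] {I : ModelWithCorners ℝ F K}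
    [TopologicalSpace N] [ChartedSpace K N] {p q : N} (h : p = q) (v : F) :
    (⟨p, v⟩ : TangentBundle I N) = ⟨q, v⟩ := by
  subst h
  rfl

theorem mem_algebroidFibre_sub (x : M) (v : TangentSpace (𝓡 (r + n)) (𝒢.unit x)) :
    v - (mfderiv (𝓡 n) (𝓡 (r + n)) 𝒢.unit x
      (mfderiv (𝓡 (r + n)) (𝓡 n) 𝒢.src (𝒢.unit x) v : EuclideanSpace ℝ (Fin n)) :
        EuclideanSpace ℝ (Fin (r + n))) ∈ 𝒢.algebroidFibre x := by
  rw [LinearMap.mem_ker]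
  change mfderiv (𝓡 (r + n)) (𝓡 n) 𝒢.src (𝒢.unit x) _ = 0
  rw [map_sub, sub_eq_zero]
  exact (mfderiv_src_mfderiv_unit x _).symm

variable (𝒢) in
/-- The projection to the Lie algebroid along the tangent space of the units. -/
def algebroidProj (x : M) (v : TangentSpace (𝓡 (r + n)) (𝒢.unit x)) : 𝒢.algebroidFibre x :=
  ⟨_, mem_algebroidFibre_sub x v⟩

theorem algebroidProj_apply (x : M) (a : 𝒢.algebroidFibre x) : 𝒢.algebroidProj x a.1 = a := by
  apply Subtype.ext
  change a.1 - _ = a.1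
  have h : mfderiv (𝓡 (r + n)) (𝓡 n) 𝒢.src (𝒢.unit x) a.1 = 0 := a.2
  rw [h]
  exact (congrArg (fun w => a.1 - w) (map_zero (mfderiv (𝓡 n) (𝓡 (r + n)) 𝒢.unit x))).trans
    (sub_zero _)

/-- At a unit, `T G` is the sum of `A_x` and the image of `d unit`. Completing frames of `A` this
way reduces their smoothness to determinants in `T G`. -/
theorem det_frame_unit_ne_zero {x : M}
    (B : Module.Basis (Fin r ⊕ Fin n) ℝ (TangentSpace (𝓡 (r + n)) (𝒢.unit x)))
    (a : Module.Basis (Fin r) ℝ (𝒢.algebroidFibre x))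
    (X : ∀ x : M, Module.Basis (Fin n) ℝ (TangentSpace (𝓡 n) x)) :
    B.det (Sum.elim (fun i => (a i).1)
      (fun j => mfderiv (𝓡 n) (𝓡 (r + n)) 𝒢.unit x (X x j))) ≠ 0 := by
  obtain ⟨c, hc, h⟩ := exists_det_sumElim_eq_mul_det B (X (𝒢.src (𝒢.unit x)))
    (mfderiv (𝓡 (r + n)) (𝓡 n) 𝒢.src (𝒢.unit x)).toLinearMap
    (𝒢.surjective_mfderiv_src (𝒢.unit x)) (k := fun i => (a i).1)
    (a.linearIndependent.map' (𝒢.algebroidFibre x).subtype (Submodule.ker_subtype _))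
    (fun i => (a i).2)
  rw [h]
  have h1 : (mfderiv (𝓡 (r + n)) (𝓡 n) 𝒢.src (𝒢.unit x)).toLinearMap ∘
      (fun j => mfderiv (𝓡 n) (𝓡 (r + n)) 𝒢.unit x (X x j)) = X (𝒢.src (𝒢.unit x)) := by
    funext j
    exact (mfderiv_src_mfderiv_unit x _).trans (apply_eq_of_eq X (𝒢.src_unit x).symm j)
  rw [h1, Module.Basis.det_self, mul_one]
  exact hc

variable [IsManifold (𝓡 n) ∞ M] [IsManifold (𝓡 (r + n)) ∞ G]

/-! ### Smooth frames -/

variable (𝒢) in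
/-- Smoothness at a point of a frame of the Lie algebroid. -/
def IsSmoothFrameAt (a : ∀ x : M, Module.Basis (Fin r) ℝ (𝒢.algebroidFibre x)) (x₀ : M) : Prop :=
  ∀ i, ContMDiffAt (𝓡 n) (𝓡 (r + n)).tangent ∞
    (fun x => (⟨𝒢.unit x, (a x i).1⟩ : TangentBundle (𝓡 (r + n)) G)) x₀

/-- Smoothness at a point of a frame of the tangent bundle. -/
def IsSmoothTangentFrameAt (X : ∀ x : M, Module.Basis (Fin n) ℝ (TangentSpace (𝓡 n) x))
    (x₀ : M) : Prop :=
  ∀ j, ContMDiffAt (𝓡 n) (𝓡 n).tangent ∞ (fun x => (⟨x, X x j⟩ : TangentBundle (𝓡 n) M)) x₀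

variable (n) in
/-- The standard basis of the model space of `M`. -/
def modelBasis : Module.Basis (Fin n) ℝ (EuclideanSpace ℝ (Fin n)) :=
  (EuclideanSpace.basisFun (Fin n) ℝ).toBasis

variable (n r) in
/-- The standard basis of the model space of `G`. -/
def modelSumBasis : Module.Basis (Fin r ⊕ Fin n) ℝ (EuclideanSpace ℝ (Fin (r + n))) :=
  (modelBasis (r + n)).reindex finSumFinEquiv.symm

theorem exists_isSmoothTangentFrameAt (x₀ : M) :
    ∃ X : ∀ x : M, Module.Basis (Fin n) ℝ (TangentSpace (𝓡 n) x), ∃ W : Opens M, x₀ ∈ W ∧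
      ∀ x ∈ W, IsSmoothTangentFrameAt X x := by
  refine ⟨chartBasis (𝓡 n) (modelBasis n) x₀, ⟨(chartAt (EuclideanSpace ℝ (Fin n)) x₀).source,
    (chartAt _ x₀).open_source⟩, mem_chart_source _ x₀, fun x hx j => ?_⟩
  refine (contMDiffAt_chartVector (φ := id) contMDiffAt_id hx
    (modelBasis n j)).congr_of_eventuallyEq ?_
  filter_upwards [(chartAt (EuclideanSpace ℝ (Fin n)) x₀).open_source.mem_nhds hx] with y hy
  rw [chartBasis_apply _ hy]
  rfl

theorem contMDiffAt_mfderiv {N N' K K' F F' Z Z' L : Type*}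
    [NormedAddCommGroup F] [NormedSpace ℝ F] [TopologicalSpace K] {I : ModelWithCorners ℝ F K}
    [TopologicalSpace N] [ChartedSpace K N] [IsManifold I ∞ N]
    [NormedAddCommGroup F'] [NormedSpace ℝ F'] [TopologicalSpace K'] {I' : ModelWithCorners ℝ F' K'}
    [TopologicalSpace N'] [ChartedSpace K' N'] [IsManifold I' ∞ N']
    [NormedAddCommGroup Z] [NormedSpace ℝ Z] [TopologicalSpace L] {J : ModelWithCorners ℝ Z L}
    [TopologicalSpace Z'] [ChartedSpace L Z'] {f : N → N'} (hf : ContMDiff I I' ∞ f) {φ : Z' → N}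
    {z₀ : Z'} {v : ∀ z, TangentSpace I (φ z)}
    (hv : ContMDiffAt J I.tangent ∞ (fun z => (⟨φ z, v z⟩ : TangentBundle I N)) z₀) :
    ContMDiffAt J I'.tangent ∞
      (fun z => (⟨f (φ z), mfderiv I I' f (φ z) (v z)⟩ : TangentBundle I' N')) z₀ :=
  ((hf.contMDiff_tangentMap (m := ∞) (by simp)).contMDiffAt
    (x := (⟨φ z₀, v z₀⟩ : TangentBundle I N))).comp z₀ hv

theorem contMDiffAt_algebroidProj {x₀ : M} {v : ∀ x, TangentSpace (𝓡 (r + n)) (𝒢.unit x)}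
    (hv : ContMDiffAt (𝓡 n) (𝓡 (r + n)).tangent ∞
      (fun x => (⟨𝒢.unit x, v x⟩ : TangentBundle (𝓡 (r + n)) G)) x₀) :
    ContMDiffAt (𝓡 n) (𝓡 (r + n)).tangent ∞
      (fun x => (⟨𝒢.unit x, (𝒢.algebroidProj x (v x)).1⟩ : TangentBundle (𝓡 (r + n)) G)) x₀ := by
  have h1 := contMDiffAt_mfderiv 𝒢.contMDiff_src hv
  have h2 : ContMDiffAt (𝓡 n) (𝓡 n).tangent ∞ (fun x => (⟨x,
      (mfderiv (𝓡 (r + n)) (𝓡 n) 𝒢.src (𝒢.unit x) (v x) : EuclideanSpace ℝ (Fin n))⟩ :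
        TangentBundle (𝓡 n) M)) x₀ := by
    refine h1.congr_of_eventuallyEq (Filter.Eventually.of_forall fun x => ?_)
    exact (tangentBundle_mk_eq (𝒢.src_unit x) _).symm
  exact contMDiffAt_tangent_sub hv (contMDiffAt_mfderiv 𝒢.contMDiff_unit h2)

theorem IsSmoothTangentFrameAt.contMDiffAt_unit
    {X : ∀ x : M, Module.Basis (Fin n) ℝ (TangentSpace (𝓡 n) x)} {x₀ : M}
    (hX : IsSmoothTangentFrameAt X x₀) (j : Fin n) :
    ContMDiffAt (𝓡 n) (𝓡 (r + n)).tangent ∞ (fun x => (⟨𝒢.unit x,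
      mfderiv (𝓡 n) (𝓡 (r + n)) 𝒢.unit x (X x j)⟩ : TangentBundle (𝓡 (r + n)) G)) x₀ :=
  contMDiffAt_mfderiv 𝒢.contMDiff_unit (hX j)

/-- Extend a frame of `A` at `x₀` by vector fields constant in a chart and project them onto `A`
along the units. The result stays a frame near `x₀`, where its determinant, completed by a frame
tangent to the units, does not vanish. -/
theorem exists_isSmoothFrameAt (x₀ : M) :
    ∃ a : ∀ x : M, Module.Basis (Fin r) ℝ (𝒢.algebroidFibre x), ∃ W : Opens M, x₀ ∈ W ∧
      ∀ x ∈ W, 𝒢.IsSmoothFrameAt a x := by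
  classical
  obtain ⟨X, W₁, hx₁, hX⟩ := exists_isSmoothTangentFrameAt (n := n) x₀
  let p₀ := 𝒢.unit x₀
  let v : Fin r → ∀ x, TangentSpace (𝓡 (r + n)) (𝒢.unit x) := fun i x => chartVector (𝓡 (r + n)) p₀
    (trivializationAt _ (TangentSpace (𝓡 (r + n))) p₀ ⟨p₀, (𝒢.someFrame x₀ i).1⟩).2 (𝒢.unit x)
  let α : ∀ x, Fin r → 𝒢.algebroidFibre x := fun x i => 𝒢.algebroidProj x (v i x)
  have hα₀ : α x₀ = 𝒢.someFrame x₀ := by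
    funext i
    have h1 : v i x₀ = (𝒢.someFrame x₀ i).1 := chartVector_trivializationAt (mem_chart_source _ _) _
    exact (congrArg (𝒢.algebroidProj x₀) h1).trans (algebroidProj_apply x₀ _)
  let W₂ : Opens M := ⟨𝒢.unit ⁻¹' (chartAt (EuclideanSpace ℝ (Fin (r + n))) p₀).source,
    (chartAt _ p₀).open_source.preimage 𝒢.contMDiff_unit.continuous⟩
  have hα : ∀ x ∈ W₂, ∀ i, ContMDiffAt (𝓡 n) (𝓡 (r + n)).tangent ∞
      (fun x => (⟨𝒢.unit x, (α x i).1⟩ : TangentBundle (𝓡 (r + n)) G)) x := fun x hx i =>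
    contMDiffAt_algebroidProj (contMDiffAt_chartVector 𝒢.contMDiff_unit.contMDiffAt hx _)
  have hx₂ : x₀ ∈ W₂ := mem_chart_source _ p₀
  have hdet : ContMDiffAt (𝓡 n) 𝓘(ℝ, ℝ) ∞ (fun x => (chartBasis (𝓡 (r + n)) (modelSumBasis n r) p₀
      (𝒢.unit x)).det (Sum.elim (fun i => (α x i).1)
        (fun j => mfderiv (𝓡 n) (𝓡 (r + n)) 𝒢.unit x (X x j)))) x₀ := by
    refine contMDiffAt_chartBasis_det _ rfl 𝒢.contMDiff_unit.contMDiffAt ?_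
    rintro (i | j)
    · exact hα x₀ hx₂ i
    · exact (hX x₀ hx₁).contMDiffAt_unit j
  have hne : ∀ᶠ x in 𝓝 x₀, (chartBasis (𝓡 (r + n)) (modelSumBasis n r) p₀
      (𝒢.unit x)).det (Sum.elim (fun i => (α x i).1)
        (fun j => mfderiv (𝓡 n) (𝓡 (r + n)) 𝒢.unit x (X x j))) ≠ 0 := by
    refine hdet.continuousAt.eventually_ne ?_
    rw [hα₀]
    exact det_frame_unit_ne_zero _ _ X
  obtain ⟨O, hO, hOo, hxO⟩ := eventually_nhds_iff.1 hne
  have hli : ∀ x ∈ O, LinearIndependent ℝ (α x) := fun x hx => by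
    have h1 := (Module.Basis.is_basis_iff_det _).2 (isUnit_iff_ne_zero.2 (hO x hx))
    have h2 := h1.1.comp Sum.inl Sum.inl_injective
    exact LinearIndependent.of_comp (𝒢.algebroidFibre x).subtype h2
  have hfd : ∀ x, FiniteDimensional ℝ (TangentSpace (𝓡 (r + n)) (𝒢.unit x)) := fun _ =>
    inferInstanceAs (FiniteDimensional ℝ (EuclideanSpace ℝ (Fin (r + n))))
  have hex : ∀ x ∈ O, ∃ b : Module.Basis (Fin r) ℝ (𝒢.algebroidFibre x), ⇑b = α x := fun x hx => by
    refine ⟨Module.Basis.mk (hli x hx) (ge_of_eq ?_), Module.Basis.coe_mk _ _⟩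
    refine Submodule.eq_top_of_finrank_eq ?_
    rw [finrank_span_eq_card (hli x hx), Fintype.card_fin, 𝒢.finrank_algebroidFibre]
  let a : ∀ x : M, Module.Basis (Fin r) ℝ (𝒢.algebroidFibre x) := fun x =>
    if h : x ∈ O then (hex x h).choose else 𝒢.someFrame x
  have ha : ∀ x ∈ O, ⇑(a x) = α x := fun x hx => by
    simp only [a, dif_pos hx]
    exact (hex x hx).choose_spec
  refine ⟨a, ⟨O, hOo⟩ ⊓ W₂, ⟨hxO, hx₂⟩, fun x hx i => ?_⟩
  refine (hα x hx.2 i).congr_of_eventuallyEq ?_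
  filter_upwards [hOo.mem_nhds hx.1] with y hy
  rw [ha y hy]

theorem IsSmoothTangentFrameAt.contMDiffAt_det
    {X X' : ∀ x : M, Module.Basis (Fin n) ℝ (TangentSpace (𝓡 n) x)} {x₀ : M}
    (hX : IsSmoothTangentFrameAt X x₀) (hX' : IsSmoothTangentFrameAt X' x₀) :
    ContMDiffAt (𝓡 n) 𝓘(ℝ, ℝ) ∞ (fun x => (X x).det (X' x)) x₀ := by
  have h1 := contMDiffAt_chartBasis_det (I := 𝓡 n) (modelBasis n) (p₀ := x₀) (φ := id) rfl
    contMDiffAt_id (v := fun x => X' x) hX'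
  have h2 := contMDiffAt_chartBasis_det (I := 𝓡 n) (modelBasis n) (p₀ := x₀) (φ := id) rfl
    contMDiffAt_id (v := fun x => X x) hX
  refine (h1.div₀ h2 (Module.Basis.isUnit_det _ _).ne_zero).congr_of_eventuallyEq
    (Filter.Eventually.of_forall fun x => ?_)
  have h3 := Module.Basis.det_div_det_eq (X x) (chartBasis (𝓡 n) (modelBasis n) x₀ x) (X' x) (X x)
  rw [Module.Basis.det_self, div_one] at h3
  exact h3

/-- Completed by the same frame tangent to the units, both frames have smooth determinants in `T G`;
the quotient of these is the determinant sought. -/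
theorem IsSmoothFrameAt.contMDiffAt_det
    {a a' : ∀ x : M, Module.Basis (Fin r) ℝ (𝒢.algebroidFibre x)} {x₀ : M}
    (ha : 𝒢.IsSmoothFrameAt a x₀) (ha' : 𝒢.IsSmoothFrameAt a' x₀) :
    ContMDiffAt (𝓡 n) 𝓘(ℝ, ℝ) ∞ (fun x => (a x).det (a' x)) x₀ := by
  obtain ⟨X, W, hxW, hX⟩ := exists_isSmoothTangentFrameAt (n := n) x₀
  have key : ∀ b : ∀ x : M, Module.Basis (Fin r) ℝ (𝒢.algebroidFibre x), 𝒢.IsSmoothFrameAt b x₀ →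
      ContMDiffAt (𝓡 n) 𝓘(ℝ, ℝ) ∞ (fun x => (chartBasis (𝓡 (r + n)) (modelSumBasis n r) (𝒢.unit x₀)
      (𝒢.unit x)).det (Sum.elim (fun i => (b x i).1)
        (fun j => mfderiv (𝓡 n) (𝓡 (r + n)) 𝒢.unit x (X x j)))) x₀ := fun b hb => by
    refine contMDiffAt_chartBasis_det _ rfl 𝒢.contMDiff_unit.contMDiffAt ?_
    rintro (i | j)
    · exact hb i
    · exact (hX x₀ hxW).contMDiffAt_unit j
  refine ((key a' ha').div₀ (key a ha) (det_frame_unit_ne_zero _ _ X)).congr_of_eventuallyEq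
    (Filter.Eventually.of_forall fun x => ?_)
  have h := det_sumElim_left (chartBasis (𝓡 (r + n)) (modelSumBasis n r) (𝒢.unit x₀) (𝒢.unit x))
    (𝒢.algebroidFibre x).subtype (fun j => mfderiv (𝓡 n) (𝓡 (r + n)) 𝒢.unit x (X x j)) (a x) (a' x)
  exact eq_div_of_mul_eq (det_frame_unit_ne_zero _ _ X) h.symm

/-! ### Smooth sections of the transverse bundle -/

/-- A section is smooth if its values on some smooth local frames are. -/
theorem isSmoothOn_of_exists {χ : ℝ →*₀ ℝ} (hχ : ∀ t : ℝ, t ≠ 0 → ContDiffAt ℝ ∞ χ t)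
    {σ : ∀ x : M, 𝒢.transverseFibre χ x} {U : Opens M}
    (h : ∀ x₀ ∈ U, ∃ a X, 𝒢.IsSmoothFrameAt a x₀ ∧ IsSmoothTangentFrameAt X x₀ ∧
      ContMDiffAt (𝓡 n) 𝓘(ℝ, ℝ) ∞ (fun x => (σ x).1 (a x) (X x)) x₀) :
    𝒢.IsSmoothOn χ σ U := by
  intro W hW a' X' ha' hX' x₀ hx₀
  obtain ⟨a, X, ha, hX, hσ⟩ := h x₀ (hW hx₀)
  have hWn : (W : Set M) ∈ 𝓝 x₀ := W.isOpen.mem_nhds hx₀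
  have ha'' : 𝒢.IsSmoothFrameAt a' x₀ := fun i => (ha' i).contMDiffAt hWn
  have hX'' : IsSmoothTangentFrameAt X' x₀ := fun j => (hX' j).contMDiffAt hWn
  have h1 := (hχ _ ((a' x₀).isUnit_det (a x₀)).ne_zero).contMDiffAt.comp x₀
    (ha''.contMDiffAt_det ha)
  have h2 := (hχ _ ((X x₀).isUnit_det (X' x₀)).ne_zero).contMDiffAt.comp x₀
    (hX.contMDiffAt_det hX'')
  refine (((h1.mul h2).mul hσ).congr_of_eventuallyEq
    (Filter.Eventually.of_forall fun x => ?_)).contMDiffWithinAt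
  exact transverseFibre_apply (σ x) (a x) (a' x) (X x) (X' x)

/-- Near every point there are smooth frames, on which the values of smooth sections are smooth. -/
theorem exists_smoothFrames (𝒢 : LieGroupoid n r M G) (x₀ : M) :
    ∃ (a : ∀ x : M, Module.Basis (Fin r) ℝ (𝒢.algebroidFibre x))
      (X : ∀ x : M, Module.Basis (Fin n) ℝ (TangentSpace (𝓡 n) x)) (W : Opens M), x₀ ∈ W ∧
      (∀ x ∈ W, 𝒢.IsSmoothFrameAt a x ∧ IsSmoothTangentFrameAt X x) ∧
      ∀ (χ : ℝ →*₀ ℝ) (σ : ∀ x : M, 𝒢.transverseFibre χ x) (U : Opens M), 𝒢.IsSmoothOn χ σ U →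
        ∀ x ∈ W, x ∈ U → ContMDiffAt (𝓡 n) 𝓘(ℝ, ℝ) ∞ (fun x => (σ x).1 (a x) (X x)) x := by
  obtain ⟨a, W₁, h₁, ha⟩ := exists_isSmoothFrameAt (𝒢 := 𝒢) x₀
  obtain ⟨X, W₂, h₂, hX⟩ := exists_isSmoothTangentFrameAt (n := n) x₀
  refine ⟨a, X, W₁ ⊓ W₂, ⟨h₁, h₂⟩, fun x hx => ⟨ha x hx.1, hX x hx.2⟩, fun χ σ U hσ x hx hxU => ?_⟩
  exact (hσ (U ⊓ (W₁ ⊓ W₂)) inf_le_left a X (fun i y hy => (ha y hy.2.1 i).contMDiffWithinAt)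
    (fun j y hy => (hX y hy.2.2 j).contMDiffWithinAt)).contMDiffAt
      ((U ⊓ (W₁ ⊓ W₂)).isOpen.mem_nhds ⟨hxU, hx⟩)

end LieGroupoid

namespace LieGroupoid

variable {n r : ℕ} {M G : Type*}
  [TopologicalSpace M] [ChartedSpace (EuclideanSpace ℝ (Fin n)) M]
  [TopologicalSpace G] [ChartedSpace (EuclideanSpace ℝ (Fin (r + n))) G]
  [IsManifold (𝓡 (r + n)) ∞ G]
  {𝒢 : LieGroupoid n r M G}

/-! ### Smoothness of the frame ratio -/

/-- This is the derivative of the multiplication at `(1_y, g)` in the direction `(a, 0)`, tangent to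
the composable pairs, so `contMDiffAt_of_hasVelocity` applies. -/
theorem contMDiffAt_rightTranslation
    {a : ∀ x : M, Module.Basis (Fin r) ℝ (𝒢.algebroidFibre x)} {g₀ : G}
    (ha : 𝒢.IsSmoothFrameAt a (𝒢.tgt g₀)) (i : Fin r) :
    ContMDiffAt (𝓡 (r + n)) (𝓡 (r + n)).tangent ∞ (fun g =>
      (⟨g, 𝒢.rightTranslation g (a (𝒢.tgt g) i)⟩ : TangentBundle (𝓡 (r + n)) G)) g₀ := by
  have h1 : ContMDiffAt (𝓡 (r + n)) (𝓡 (r + n)).tangent ∞ (fun g =>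
      (⟨𝒢.unit (𝒢.tgt g), (a (𝒢.tgt g) i).1⟩ : TangentBundle (𝓡 (r + n)) G)) g₀ :=
    (ha i).comp g₀ 𝒢.contMDiff_tgt.contMDiffAt
  have h2 : ContMDiffAt (𝓡 (r + n)) (𝓡 (r + n)).tangent ∞ (fun g =>
      (⟨g, 0⟩ : TangentBundle (𝓡 (r + n)) G)) g₀ :=
    (Bundle.contMDiff_zeroSection (IB := 𝓡 (r + n)) (F := EuclideanSpace ℝ (Fin (r + n)))
      ℝ (TangentSpace (𝓡 (r + n)) : G → Type _)).contMDiffAt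
  have h3 := (contMDiff_equivTangentBundleProd_symm (n := ∞) (I := 𝓡 (r + n)) (M := G)
    (I' := 𝓡 (r + n)) (M' := G)).contMDiffAt.comp g₀ (h1.prodMk h2)
  refine contMDiffAt_of_hasVelocity 𝒢.contMDiffOn_mul (φ := fun g => (𝒢.unit (𝒢.tgt g), g))
    (fun g => 𝒢.src_unit _) (v := fun g => ((a (𝒢.tgt g) i).1, 0)) h3 (ψ := fun g => g)
    (fun g => 𝒢.unit_mul g) (Filter.Eventually.of_forall fun g => ?_)
  obtain ⟨c, hc, hcs⟩ := exists_hasVelocity_algebroidFibre _ (a (𝒢.tgt g) i)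
  exact ⟨fun t => (c t, g), hc.prodMk (HasVelocity.const g), hcs,
    hasVelocity_rightTranslation rfl (fun x => a x i) hc hcs⟩

theorem contMDiffAt_leftTranslation
    {b : ∀ x : M, Module.Basis (Fin r) ℝ (𝒢.algebroidFibre x)} {g₀ : G}
    (hb : 𝒢.IsSmoothFrameAt b (𝒢.src g₀)) (i : Fin r) :
    ContMDiffAt (𝓡 (r + n)) (𝓡 (r + n)).tangent ∞ (fun g =>
      (⟨g, 𝒢.leftTranslation g (b (𝒢.src g) i)⟩ : TangentBundle (𝓡 (r + n)) G)) g₀ := by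
  have h1 : ContMDiffAt (𝓡 (r + n)) (𝓡 (r + n)).tangent ∞ (fun g =>
      (⟨𝒢.unit (𝒢.src g), (b (𝒢.src g) i).1⟩ : TangentBundle (𝓡 (r + n)) G)) g₀ :=
    (hb i).comp g₀ 𝒢.contMDiff_src.contMDiffAt
  have h1' := contMDiffAt_mfderiv 𝒢.contMDiff_inv h1
  have h2 : ContMDiffAt (𝓡 (r + n)) (𝓡 (r + n)).tangent ∞ (fun g =>
      (⟨g, 0⟩ : TangentBundle (𝓡 (r + n)) G)) g₀ :=
    (Bundle.contMDiff_zeroSection (IB := 𝓡 (r + n)) (F := EuclideanSpace ℝ (Fin (r + n)))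
      ℝ (TangentSpace (𝓡 (r + n)) : G → Type _)).contMDiffAt
  have h3 := (contMDiff_equivTangentBundleProd_symm (n := ∞) (I := 𝓡 (r + n)) (M := G)
    (I' := 𝓡 (r + n)) (M' := G)).contMDiffAt.comp g₀ (h2.prodMk h1')
  have h4 : ContMDiffAt (𝓡 (r + n)) (𝓡 (r + n)).tangent ∞ (fun g =>
      (⟨g, -𝒢.leftTranslation g (b (𝒢.src g) i)⟩ : TangentBundle (𝓡 (r + n)) G)) g₀ := by
    refine contMDiffAt_of_hasVelocity 𝒢.contMDiffOn_mul
      (φ := fun g => (g, 𝒢.inv (𝒢.unit (𝒢.src g))))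
      (fun g => by simp [𝒢.tgt_inv, 𝒢.src_unit])
      (v := fun g => (0, mfderiv (𝓡 (r + n)) (𝓡 (r + n)) 𝒢.inv _ (b (𝒢.src g) i).1)) h3
      (ψ := fun g => g) (fun g => by simp only [inv_unit, 𝒢.mul_unit])
      (Filter.Eventually.of_forall fun g => ?_)
    obtain ⟨c, hc, hcs⟩ := exists_hasVelocity_algebroidFibre _ (b (𝒢.src g) i)
    exact ⟨fun t => (g, 𝒢.inv (c t)), (HasVelocity.const g).prodMk
        (hc.mfderiv (𝒢.contMDiff_inv.mdifferentiableAt (by simp))),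
      hcs.mono fun t ht => by simp [𝒢.tgt_inv, ht],
      hasVelocity_leftTranslation rfl (fun x => b x i) hc hcs⟩
  have h5 := contMDiffAt_tangent_neg h4
  simpa using h5

variable [IsManifold (𝓡 n) ∞ M]

/-- `srcLift` is chosen arrow by arrow and need not be smooth. Since the determinant depends on the
lift only through `d src`, a smooth family `w` serves instead, corrected by the quotient of the
determinants of `X` and `d src w`. -/
theorem contMDiffAt_det_rightTranslation
    {a : ∀ x : M, Module.Basis (Fin r) ℝ (𝒢.algebroidFibre x)}
    {X : ∀ x : M, Module.Basis (Fin n) ℝ (TangentSpace (𝓡 n) x)} {g₀ : G}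
    (ha : 𝒢.IsSmoothFrameAt a (𝒢.tgt g₀)) (hX : IsSmoothTangentFrameAt X (𝒢.src g₀)) :
    ContMDiffAt (𝓡 (r + n)) 𝓘(ℝ, ℝ) ∞ (fun g =>
      (chartBasis (𝓡 (r + n)) (modelSumBasis n r) g₀ g).det
        (Sum.elim (𝒢.rightTranslation g ∘ a (𝒢.tgt g)) (𝒢.srcLift g ∘ X (𝒢.src g)))) g₀ := by
  let w : Fin n → ∀ g, TangentSpace (𝓡 (r + n)) g := fun j => chartVector (𝓡 (r + n)) g₀
    (trivializationAt _ (TangentSpace (𝓡 (r + n))) g₀ ⟨g₀, 𝒢.srcLift g₀ (X (𝒢.src g₀) j)⟩).2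
  have hw : ∀ j, ContMDiffAt (𝓡 (r + n)) (𝓡 (r + n)).tangent ∞ (fun g =>
      (⟨g, w j g⟩ : TangentBundle (𝓡 (r + n)) G)) g₀ := fun j =>
    contMDiffAt_chartVector (φ := fun g => g) contMDiffAt_id (mem_chart_source _ g₀) _
  have hw₀ : ∀ j, w j g₀ = 𝒢.srcLift g₀ (X (𝒢.src g₀) j) := fun j =>
    chartVector_trivializationAt (mem_chart_source _ _) _
  have h1 : ContMDiffAt (𝓡 (r + n)) 𝓘(ℝ, ℝ) ∞ (fun g =>
      (chartBasis (𝓡 (r + n)) (modelSumBasis n r) g₀ g).det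
        (Sum.elim (𝒢.rightTranslation g ∘ a (𝒢.tgt g)) (fun j => w j g))) g₀ := by
    refine contMDiffAt_chartBasis_det (φ := fun g => g) _ rfl contMDiffAt_id ?_
    rintro (i | j)
    · exact contMDiffAt_rightTranslation ha i
    · exact hw j
  have h2 := contMDiffAt_chartBasis_det (J := 𝓡 (r + n)) (I := 𝓡 n) (modelBasis n) (φ := 𝒢.src)
    (x₀ := g₀) rfl 𝒢.contMDiff_src.contMDiffAt (v := fun g => X (𝒢.src g))
    (fun j => (hX j).comp g₀ 𝒢.contMDiff_src.contMDiffAt)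
  have h3 := contMDiffAt_chartBasis_det (J := 𝓡 (r + n)) (I := 𝓡 n) (modelBasis n) (φ := 𝒢.src)
    (x₀ := g₀) rfl 𝒢.contMDiff_src.contMDiffAt
    (v := fun g j => mfderiv (𝓡 (r + n)) (𝓡 n) 𝒢.src g (w j g))
    (fun j => contMDiffAt_mfderiv 𝒢.contMDiff_src (hw j))
  -- At `g₀` the family `w` is the chosen lift, so its image by `d src` is a frame there and, by
  -- continuity, nearby.
  have hne : (chartBasis (𝓡 n) (modelBasis n) (𝒢.src g₀) (𝒢.src g₀)).det
      (fun j => mfderiv (𝓡 (r + n)) (𝓡 n) 𝒢.src g₀ (w j g₀)) ≠ 0 := by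
    simp only [hw₀, mfderiv_src_srcLift]
    exact (Module.Basis.isUnit_det _ _).ne_zero
  refine ((h1.mul h2).div₀ h3 hne).congr_of_eventuallyEq ?_
  filter_upwards [h3.continuousAt.eventually_ne hne] with g hg
  obtain ⟨c, -, hc⟩ := exists_det_rightTranslation_eq g
    (chartBasis (𝓡 (r + n)) (modelSumBasis n r) g₀ g) (a (𝒢.tgt g))
    (chartBasis (𝓡 n) (modelBasis n) (𝒢.src g₀) (𝒢.src g))
  simp only [Pi.mul_apply, Pi.div_apply]
  rw [hc, hc]
  simp only [Function.comp_apply, mfderiv_src_srcLift]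
  exact eq_div_of_mul_eq hg (by ring)

theorem contMDiffAt_det_leftTranslation
    {b : ∀ x : M, Module.Basis (Fin r) ℝ (𝒢.algebroidFibre x)}
    {Y : ∀ x : M, Module.Basis (Fin n) ℝ (TangentSpace (𝓡 n) x)} {g₀ : G}
    (hb : 𝒢.IsSmoothFrameAt b (𝒢.src g₀)) (hY : IsSmoothTangentFrameAt Y (𝒢.tgt g₀)) :
    ContMDiffAt (𝓡 (r + n)) 𝓘(ℝ, ℝ) ∞ (fun g =>
      (chartBasis (𝓡 (r + n)) (modelSumBasis n r) g₀ g).det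
        (Sum.elim (𝒢.leftTranslation g ∘ b (𝒢.src g)) (𝒢.tgtLift g ∘ Y (𝒢.tgt g)))) g₀ := by
  let w : Fin n → ∀ g, TangentSpace (𝓡 (r + n)) g := fun j => chartVector (𝓡 (r + n)) g₀
    (trivializationAt _ (TangentSpace (𝓡 (r + n))) g₀ ⟨g₀, 𝒢.tgtLift g₀ (Y (𝒢.tgt g₀) j)⟩).2
  have hw : ∀ j, ContMDiffAt (𝓡 (r + n)) (𝓡 (r + n)).tangent ∞ (fun g =>
      (⟨g, w j g⟩ : TangentBundle (𝓡 (r + n)) G)) g₀ := fun j =>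
    contMDiffAt_chartVector (φ := fun g => g) contMDiffAt_id (mem_chart_source _ g₀) _
  have hw₀ : ∀ j, w j g₀ = 𝒢.tgtLift g₀ (Y (𝒢.tgt g₀) j) := fun j =>
    chartVector_trivializationAt (mem_chart_source _ _) _
  have h1 : ContMDiffAt (𝓡 (r + n)) 𝓘(ℝ, ℝ) ∞ (fun g =>
      (chartBasis (𝓡 (r + n)) (modelSumBasis n r) g₀ g).det
        (Sum.elim (𝒢.leftTranslation g ∘ b (𝒢.src g)) (fun j => w j g))) g₀ := by
    refine contMDiffAt_chartBasis_det (φ := fun g => g) _ rfl contMDiffAt_id ?_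
    rintro (i | j)
    · exact contMDiffAt_leftTranslation hb i
    · exact hw j
  have h2 := contMDiffAt_chartBasis_det (J := 𝓡 (r + n)) (I := 𝓡 n) (modelBasis n) (φ := 𝒢.tgt)
    (x₀ := g₀) rfl 𝒢.contMDiff_tgt.contMDiffAt (v := fun g => Y (𝒢.tgt g))
    (fun j => (hY j).comp g₀ 𝒢.contMDiff_tgt.contMDiffAt)
  have h3 := contMDiffAt_chartBasis_det (J := 𝓡 (r + n)) (I := 𝓡 n) (modelBasis n) (φ := 𝒢.tgt)
    (x₀ := g₀) rfl 𝒢.contMDiff_tgt.contMDiffAt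
    (v := fun g j => mfderiv (𝓡 (r + n)) (𝓡 n) 𝒢.tgt g (w j g))
    (fun j => contMDiffAt_mfderiv 𝒢.contMDiff_tgt (hw j))
  have hne : (chartBasis (𝓡 n) (modelBasis n) (𝒢.tgt g₀) (𝒢.tgt g₀)).det
      (fun j => mfderiv (𝓡 (r + n)) (𝓡 n) 𝒢.tgt g₀ (w j g₀)) ≠ 0 := by
    simp only [hw₀, mfderiv_tgt_tgtLift]
    exact (Module.Basis.isUnit_det _ _).ne_zero
  refine ((h1.mul h2).div₀ h3 hne).congr_of_eventuallyEq ?_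
  filter_upwards [h3.continuousAt.eventually_ne hne] with g hg
  obtain ⟨c, -, hc⟩ := exists_det_leftTranslation_eq g
    (chartBasis (𝓡 (r + n)) (modelSumBasis n r) g₀ g) (b (𝒢.src g))
    (chartBasis (𝓡 n) (modelBasis n) (𝒢.tgt g₀) (𝒢.tgt g))
  simp only [Pi.mul_apply, Pi.div_apply]
  rw [hc, hc]
  simp only [Function.comp_apply, mfderiv_tgt_tgtLift]
  exact eq_div_of_mul_eq hg (by ring)

/-- The frame ratio of smooth frames is smooth. -/
theorem contMDiffAt_frameRatio
    {a b : ∀ x : M, Module.Basis (Fin r) ℝ (𝒢.algebroidFibre x)}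
    {X Y : ∀ x : M, Module.Basis (Fin n) ℝ (TangentSpace (𝓡 n) x)} {g₀ : G}
    (hb : 𝒢.IsSmoothFrameAt b (𝒢.src g₀)) (hX : IsSmoothTangentFrameAt X (𝒢.src g₀))
    (ha : 𝒢.IsSmoothFrameAt a (𝒢.tgt g₀)) (hY : IsSmoothTangentFrameAt Y (𝒢.tgt g₀)) :
    ContMDiffAt (𝓡 (r + n)) 𝓘(ℝ, ℝ) ∞ (fun g =>
      𝒢.frameRatio g (b (𝒢.src g)) (X (𝒢.src g)) (a (𝒢.tgt g)) (Y (𝒢.tgt g))) g₀ := by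
  refine ((contMDiffAt_det_leftTranslation hb hY).div₀ (contMDiffAt_det_rightTranslation ha hX)
    (det_rightTranslation_srcLift_ne_zero _ _ _ _)).congr_of_eventuallyEq
    (Filter.Eventually.of_forall fun g => ?_)
  exact Module.Basis.det_div_det_eq _ _ _ _

end LieGroupoid

theorem ContMDiffAt.log {E H N : Type*} [NormedAddCommGroup E] [NormedSpace ℝ E]
    [TopologicalSpace H] {I : ModelWithCorners ℝ E H} [TopologicalSpace N] [ChartedSpace H N]
    {f : N → ℝ} {x : N} (hf : ContMDiffAt I 𝓘(ℝ, ℝ) ∞ f x) (h : f x ≠ 0) :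
    ContMDiffAt I 𝓘(ℝ, ℝ) ∞ (fun y => Real.log (f y)) x :=
  (Real.contDiffAt_log.2 h).contMDiffAt.comp x hf

namespace LieGroupoid

variable {n r : ℕ} {M G : Type*}
  [TopologicalSpace M] [ChartedSpace (EuclideanSpace ℝ (Fin n)) M]
  [TopologicalSpace G] [ChartedSpace (EuclideanSpace ℝ (Fin (r + n))) G]
  {𝒢 : LieGroupoid n r M G} {χ : ℝ →*₀ ℝ}

theorem density_pos_of_apply_pos {x : M} {ξ : 𝒢.transverseFibre densityCharacter x}
    {a : Module.Basis (Fin r) ℝ (𝒢.algebroidFibre x)}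
    {X : Module.Basis (Fin n) ℝ (TangentSpace (𝓡 n) x)} (h : 0 < ξ.1 a X)
    (a' : Module.Basis (Fin r) ℝ (𝒢.algebroidFibre x))
    (X' : Module.Basis (Fin n) ℝ (TangentSpace (𝓡 n) x)) : 0 < ξ.1 a' X' := by
  rw [transverseFibre_apply ξ a a' X X']
  exact mul_pos (mul_pos (abs_pos.2 (a'.isUnit_det _).ne_zero)
    (abs_pos.2 (X.isUnit_det _).ne_zero)) h

variable [IsManifold (𝓡 n) ∞ M] [IsManifold (𝓡 (r + n)) ∞ G]

/-! ### Smoothness of the coefficients of the action -/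

theorem contDiffAt_volumeCharacter (t : ℝ) (_ : t ≠ 0) : ContDiffAt ℝ ∞ volumeCharacter t :=
  contDiffAt_id

theorem contDiffAt_densityCharacter (t : ℝ) (ht : t ≠ 0) :
    ContDiffAt ℝ ∞ densityCharacter t :=
  contDiffAt_abs ht

/-- The passage from smooth frames to the chosen ones cancels in the quotient. -/
theorem contMDiffAt_value_div {σ τ : ∀ x : M, 𝒢.transverseFibre χ x} {U V : Opens M}
    (hσ : 𝒢.IsSmoothOn χ σ U) (hτ : 𝒢.IsSmoothOn χ τ V) {x₀ : M} (hU : x₀ ∈ U) (hV : x₀ ∈ V)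
    (h0 : τ x₀ ≠ 0) :
    ContMDiffAt (𝓡 n) 𝓘(ℝ, ℝ) ∞ (fun x => 𝒢.value χ (σ x) / 𝒢.value χ (τ x)) x₀ := by
  obtain ⟨a, X, W, hW, -, h⟩ := exists_smoothFrames 𝒢 x₀
  refine ((h χ σ U hσ x₀ hW hU).div₀ (h χ τ V hτ x₀ hW hV)
    (transverseFibre_apply_ne_zero h0 _ _)).congr_of_eventuallyEq
    (Filter.Eventually.of_forall fun x => ?_)
  obtain ⟨k, hk, hk'⟩ := apply_eq_mul_value (𝒢 := 𝒢) (χ := χ) (a x) (X x)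
  simp only [Pi.div_apply]
  rw [hk', hk', mul_div_mul_left _ _ hk]

/-- The function `c` with `g_* σ(x) = c(g) τ(y)`, `g : x → y`, is smooth. -/
theorem contMDiffAt_coefficient (hχ : ∀ t : ℝ, t ≠ 0 → ContDiffAt ℝ ∞ χ t)
    {σ τ : ∀ x : M, 𝒢.transverseFibre χ x} {U V : Opens M}
    (hσ : 𝒢.IsSmoothOn χ σ U) (hτ : 𝒢.IsSmoothOn χ τ V) {g₀ : G} (hU : 𝒢.src g₀ ∈ U)
    (hV : 𝒢.tgt g₀ ∈ V) (h0 : τ (𝒢.tgt g₀) ≠ 0) :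
    ContMDiffAt (𝓡 (r + n)) 𝓘(ℝ, ℝ) ∞ (fun g =>
      χ (𝒢.ratio g) * 𝒢.value χ (σ (𝒢.src g)) / 𝒢.value χ (τ (𝒢.tgt g))) g₀ := by
  obtain ⟨b, X, W, hW, hbX, h⟩ := exists_smoothFrames 𝒢 (𝒢.src g₀)
  obtain ⟨a, Y, W', hW', haY, h'⟩ := exists_smoothFrames 𝒢 (𝒢.tgt g₀)
  have h1 := (hχ _ (frameRatio_ne_zero (𝒢 := 𝒢) g₀ _ _ _ _)).contMDiffAt.comp g₀
    (contMDiffAt_frameRatio (hbX _ hW).1 (hbX _ hW).2 (haY _ hW').1 (haY _ hW').2)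
  have h2 := (h χ σ U hσ _ hW hU).comp g₀ 𝒢.contMDiff_src.contMDiffAt
  have h3 := (h' χ τ V hτ _ hW' hV).comp g₀ 𝒢.contMDiff_tgt.contMDiffAt
  refine ((h1.mul h2).div₀ h3
    (transverseFibre_apply_ne_zero h0 _ _)).congr_of_eventuallyEq
    (Filter.Eventually.of_forall fun g => ?_)
  obtain ⟨k, hk, hk'⟩ := apply_eq_mul_value (𝒢 := 𝒢) (χ := χ) (a (𝒢.tgt g)) (Y (𝒢.tgt g))
  simp only [Pi.div_apply, Pi.mul_apply, Function.comp_apply]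
  rw [← transverseAction_apply, hk', hk', mul_div_mul_left _ _ hk, value_transverseAction]

/-! ### The modular class -/

/-- The section equal to `1` on smooth frames. It is given at all points, so its density version is
positive everywhere, though smooth only on `U`. -/
theorem exists_smooth_local_section (hχ : ∀ t : ℝ, t ≠ 0 → ContDiffAt ℝ ∞ χ t) (x₀ : M) :
    ∃ (U : Opens M) (σ : ∀ x : M, 𝒢.transverseFibre χ x), x₀ ∈ U ∧ 𝒢.IsSmoothOn χ σ U ∧
      ∃ (a : ∀ x : M, Module.Basis (Fin r) ℝ (𝒢.algebroidFibre x))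
        (X : ∀ x : M, Module.Basis (Fin n) ℝ (TangentSpace (𝓡 n) x)), ∀ x, σ x = 𝒢.ofFrame χ (a x) (X x) 1 := by
  obtain ⟨a, X, W, hW, haX, -⟩ := exists_smoothFrames 𝒢 x₀
  refine ⟨W, fun x => 𝒢.ofFrame χ (a x) (X x) 1, hW, isSmoothOn_of_exists hχ fun x hx =>
    ⟨a, X, (haX x hx).1, (haX x hx).2, ?_⟩, a, X, fun _ => rfl⟩
  simp only [ofFrame_apply_self]
  exact contMDiffAt_const

/-- Positive densities form a convex set in each fibre, so local ones are glued by a partition of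
unity. -/
theorem exists_smooth_positive_density [T2Space M] [SecondCountableTopology M]
    (𝒢 : LieGroupoid n r M G) :
    ∃ σ : ∀ x : M, 𝒢.transverseFibre densityCharacter x,
      𝒢.IsSmoothOn densityCharacter σ ⊤ ∧ ∀ x a X, 0 < (σ x).1 a X := by
  have : LocallyCompactSpace M := ChartedSpace.locallyCompactSpace (EuclideanSpace ℝ (Fin n)) M
  choose U δ hU hδ a X hδa using
    exists_smooth_local_section (𝒢 := 𝒢) (n := n) contDiffAt_densityCharacter
  obtain ⟨ρ, hρ⟩ := SmoothPartitionOfUnity.exists_isSubordinate (𝓡 n)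
    (isClosed_univ (X := M)) (fun x => (U x : Set M)) (fun x => (U x).isOpen)
    (fun x _ => Set.mem_iUnion.2 ⟨x, hU x⟩)
  have hδpos : ∀ z x, 0 < 𝒢.value densityCharacter (δ z x) := fun z x => by
    rw [hδa]
    exact density_pos_of_apply_pos (a := a z x) (X := X z x)
      (by rw [ofFrame_apply_self]; exact one_pos) _ _
  -- The sum is formed in the chosen frames. In smooth frames every term acquires the same factor,
  -- so smoothness may be tested there.
  let s : M → ℝ := fun x => ∑ᶠ z, ρ z x • 𝒢.value densityCharacter (δ z x)
  have hs : ∀ x, 0 < s x := fun x =>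
    ρ.finsum_smul_mem_convex (t := Set.Ioi (0 : ℝ))
      (g := fun z x => 𝒢.value densityCharacter (δ z x)) (Set.mem_univ x) (fun z _ => hδpos z x)
      (convex_Ioi 0)
  refine ⟨fun x => 𝒢.ofFrame densityCharacter (𝒢.someFrame x) (someTangentFrame x) (s x),
    isSmoothOn_of_exists contDiffAt_densityCharacter fun x₀ _ => ?_, fun x b Y =>
    density_pos_of_apply_pos (by rw [ofFrame_apply_self]; exact hs x) b Y⟩
  obtain ⟨b, Y, W, hW, hbY, h⟩ := exists_smoothFrames 𝒢 x₀
  refine ⟨b, Y, (hbY _ hW).1, (hbY _ hW).2, ?_⟩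
  have key := ρ.contMDiffAt_finsum (n := ⊤) (x₀ := x₀) (g := fun z x => (δ z x).1 (b x) (Y x))
    fun z hz => h densityCharacter (δ z) (U z) (hδ z) x₀ hW (hρ z hz)
  refine key.congr_of_eventuallyEq (Filter.Eventually.of_forall fun x => ?_)
  obtain ⟨k, hk, hk'⟩ := apply_eq_mul_value (𝒢 := 𝒢) (χ := densityCharacter) (b x) (Y x)
  simp only [hk']
  rw [show 𝒢.value densityCharacter (𝒢.ofFrame densityCharacter (𝒢.someFrame x)
    (someTangentFrame x) (s x)) = s x from ofFrame_apply_self _ _ _]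
  simp only [s, smul_eq_mul, ← mul_left_comm k]
  exact (smul_finsum k _)

theorem existsUnique_isModularClass [T2Space M] [SecondCountableTopology M]
    (𝒢 : LieGroupoid n r M G) : ∃! κ, 𝒢.IsModularClass κ := by
  obtain ⟨σ, hσ, hpos⟩ := exists_smooth_positive_density 𝒢
  have hv : ∀ x, 0 < 𝒢.value densityCharacter (σ x) := fun x => hpos x _ _
  have hr : ∀ g, 0 < |𝒢.ratio g| := fun g => abs_pos.2 (ratio_ne_zero g)
  have hq : ∀ g, 0 < |𝒢.ratio g| * 𝒢.value densityCharacter (σ (𝒢.src g)) /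
      𝒢.value densityCharacter (σ (𝒢.tgt g)) :=
    fun g => div_pos (mul_pos (hr g) (hv _)) (hv _)
  let c : 𝒢.realCocycles := ⟨fun g => -Real.log (|𝒢.ratio g| *
    𝒢.value densityCharacter (σ (𝒢.src g)) / 𝒢.value densityCharacter (σ (𝒢.tgt g))), by
      constructor
      · intro g
        exact ((contMDiffAt_coefficient contDiffAt_densityCharacter hσ hσ (g₀ := g) trivial trivial
          (value_ne_zero.1 (hv _).ne')).log (hq g).ne').neg
      · intro g h e
        dsimp only
        rw [ratio_mul e, 𝒢.src_mul g h e, 𝒢.tgt_mul g h e, ← neg_add,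
          ← Real.log_mul (hq g).ne' (hq h).ne', abs_mul, e]
        congr 2
        have := (hv (𝒢.tgt h)).ne'
        field_simp⟩
  have hc : ∀ g, σ (𝒢.tgt g) =
      Real.exp (c.1 g) • 𝒢.transverseAction densityCharacter g (σ (𝒢.src g)) := fun g => by
    apply value_injective
    rw [value_smul, value_transverseAction]
    simp only [c]
    rw [Real.exp_neg, Real.exp_log (hq g)]
    have h1 := (hr g).ne'
    have h2 := (hv (𝒢.src g)).ne'
    change _ = _ * (|𝒢.ratio g| * _)
    field_simp
  refine ⟨Submodule.Quotient.mk c, ⟨σ, hσ, hpos, c, hc, rfl⟩, ?_⟩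
  rintro _ ⟨σ', hσ', hpos', c', hc', rfl⟩
  have hv' : ∀ x, 0 < 𝒢.value densityCharacter (σ' x) := fun x => hpos' x _ _
  -- The cocycles differ by the coboundary of `-log (σ' / σ)`.
  refine (Submodule.Quotient.eq _).2 ⟨fun x => -Real.log (𝒢.value densityCharacter (σ' x) /
    𝒢.value densityCharacter (σ x)), fun x => ?_, fun g => ?_⟩
  · exact ((contMDiffAt_value_div hσ' hσ trivial trivial (value_ne_zero.1 (hv x).ne')).log
      (div_pos (hv' x) (hv x)).ne').neg
  · have e := congrArg (fun ξ => Real.log (𝒢.value densityCharacter ξ)) (hc g)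
    have e' := congrArg (fun ξ => Real.log (𝒢.value densityCharacter ξ)) (hc' g)
    simp only [value_smul, value_transverseAction] at e e'
    have hχ := character_ne_zero densityCharacter (ratio_ne_zero (𝒢 := 𝒢) g)
    rw [Real.log_mul (Real.exp_ne_zero _) (mul_ne_zero hχ (hv _).ne'), Real.log_exp,
      Real.log_mul hχ (hv _).ne'] at e
    rw [Real.log_mul (Real.exp_ne_zero _) (mul_ne_zero hχ (hv' _).ne'), Real.log_exp,
      Real.log_mul hχ (hv' _).ne'] at e'
    change c'.1 g - c.1 g = -Real.log (_ / _) - -Real.log (_ / _)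
    rw [Real.log_div (hv' _).ne' (hv _).ne', Real.log_div (hv' _).ne' (hv _).ne']
    linarith

end LieGroupoid

/-! ### Signs -/

/-- The sign of a nonzero real number. -/
def signUnit (t : ℝ) : ℤˣ := if 0 < t then 1 else -1

theorem signUnit_eq_one_iff {t : ℝ} : signUnit t = 1 ↔ 0 < t := by
  unfold signUnit
  split_ifs with h
  · simp [h]
  · simp only [h, iff_false]
    decide

theorem signUnit_mul {s t : ℝ} (hs : s ≠ 0) (ht : t ≠ 0) :
    signUnit (s * t) = signUnit s * signUnit t := by
  rcases hs.lt_or_gt with h | h <;> rcases ht.lt_or_gt with h' | h'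
  · simp [signUnit, mul_pos_of_neg_of_neg h h', h.not_gt, h'.not_gt]
  · simp [signUnit, (mul_neg_of_neg_of_pos h h').not_gt, h.not_gt, h']
  · simp [signUnit, (mul_neg_of_pos_of_neg h h').not_gt, h, h'.not_gt]
  · simp [signUnit, mul_pos h h', h, h']

theorem signUnit_div {s t : ℝ} (hs : s ≠ 0) (ht : t ≠ 0) :
    signUnit (s / t) = signUnit s / signUnit t := by
  rw [eq_div_iff_mul_eq', ← signUnit_mul (div_ne_zero hs ht) ht, div_mul_cancel₀ _ ht]

theorem signUnit_mul_abs (t : ℝ) : ((signUnit t : ℤ) : ℝ) * |t| = t := by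
  unfold signUnit
  split_ifs with h
  · simp [abs_of_pos h]
  · simp [abs_of_nonpos (not_lt.1 h)]

theorem signUnit_intCast (u : ℤˣ) : signUnit ((u : ℤ) : ℝ) = u := by
  rcases Int.units_eq_one_or u with rfl | rfl <;> simp [signUnit]

theorem units_intCast_ne_zero (u : ℤˣ) : ((u : ℤ) : ℝ) ≠ 0 :=
  Int.cast_ne_zero.2 u.ne_zero

/-- The sign is forced to be that of `s / t`, and then `l = |s / t|`. -/
theorem exists_pos_eq_iff {s t : ℝ} (hs : s ≠ 0) (ht : t ≠ 0) (u : ℤˣ) :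
    (∃ l : ℝ, 0 < l ∧ s = l * ((u : ℤ) : ℝ) * t) ↔ u = signUnit s / signUnit t := by
  rw [← signUnit_div hs ht]
  constructor
  · rintro ⟨l, hl, h⟩
    rw [h, mul_div_cancel_right₀ _ ht, signUnit_mul hl.ne' (units_intCast_ne_zero u),
      signUnit_eq_one_iff.2 hl, one_mul, signUnit_intCast]
  · rintro rfl
    refine ⟨|s / t|, abs_pos.2 (div_ne_zero hs ht), ?_⟩
    rw [mul_comm |s / t|, signUnit_mul_abs, div_mul_cancel₀ _ ht]

theorem eventually_signUnit_eq {X : Type*} [TopologicalSpace X] {f : X → ℝ} {x : X}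
    (hf : ContinuousAt f x) (h : f x ≠ 0) : ∀ᶠ y in 𝓝 x, signUnit (f y) = signUnit (f x) := by
  rcases h.lt_or_gt with h | h
  · filter_upwards [hf.eventually_lt_const h] with y hy
    simp [signUnit, h.not_gt, hy.not_gt]
  · filter_upwards [hf.eventually_const_lt h] with y hy
    simp [signUnit, h, hy]

theorem OpenCover.eventually_fst_eq {M : Type*} [TopologicalSpace M] {𝒰 : OpenCover M}
    (q : 𝒰.Total) : ∀ᶠ p in 𝓝 q, p.1 = q.1 := by
  filter_upwards [(isOpen_range_sigmaMk (i := q.1)).mem_nhds ⟨q.2, rfl⟩]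
    with p hp
  obtain ⟨y, rfl⟩ := hp
  rfl

namespace LieGroupoid

variable {n r : ℕ} {M G : Type*}
  [TopologicalSpace M] [ChartedSpace (EuclideanSpace ℝ (Fin n)) M]
  [TopologicalSpace G] [ChartedSpace (EuclideanSpace ℝ (Fin (r + n))) G]
  {𝒢 : LieGroupoid n r M G}

/-! ### The transverse first Stiefel–Whitney class -/

/-- The sign, on the chosen frames, of a family of local sections of the transverse volume bundle. -/
def sectionSign {𝒰 : OpenCover M} (σ : 𝒰.sets → ∀ x : M, 𝒢.transverseFibre volumeCharacter x)
    (q : 𝒰.Total) : ℤˣ := signUnit (𝒢.value _ (σ q.1 (𝒰.proj q)))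

theorem transverseAction_eq_smul_iff {𝒰 : OpenCover M}
    {σ : 𝒰.sets → ∀ x : M, 𝒢.transverseFibre volumeCharacter x}
    (h0 : ∀ U : 𝒰.sets, ∀ x ∈ U.1, σ U x ≠ 0) (p : 𝒢.PullbackArrow 𝒰.proj) (u : ℤˣ) :
    (∃ l : ℝ, 0 < l ∧ 𝒢.transverseAction volumeCharacter p.1.2.1
      (σ p.1.2.2.1 (𝒢.src p.1.2.1)) = (l * ((u : ℤ) : ℝ)) • σ p.1.1.1 (𝒢.tgt p.1.2.1)) ↔
    u = signUnit (𝒢.ratio p.1.2.1) * sectionSign σ p.1.2.2 / sectionSign σ p.1.1 := by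
  have hs := value_ne_zero.2 (h0 p.1.2.2.1 (𝒢.src p.1.2.1) (p.2.2 ▸ p.1.2.2.2.2))
  have ht := value_ne_zero.2 (h0 p.1.1.1 (𝒢.tgt p.1.2.1) (p.2.1 ▸ p.1.1.2.2))
  have e1 : sectionSign σ p.1.2.2 = signUnit (𝒢.value _ (σ p.1.2.2.1 (𝒢.src p.1.2.1))) :=
    congrArg (fun x => signUnit (𝒢.value _ (σ p.1.2.2.1 x))) p.2.2.symm
  have e2 : sectionSign σ p.1.1 = signUnit (𝒢.value _ (σ p.1.1.1 (𝒢.tgt p.1.2.1))) :=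
    congrArg (fun x => signUnit (𝒢.value _ (σ p.1.1.1 x))) p.2.1.symm
  rw [e1, e2, ← signUnit_mul (ratio_ne_zero _) hs,
    ← exists_pos_eq_iff (mul_ne_zero (ratio_ne_zero _) hs) ht]
  refine exists_congr fun l => and_congr_right fun _ => ?_
  rw [← value_injective.eq_iff, value_smul, value_transverseAction]
  rfl

variable [IsManifold (𝓡 n) ∞ M] [IsManifold (𝓡 (r + n)) ∞ G]

/-- The three signs need not be locally constant separately. With the two members of the cover
fixed, as they are near `p₀`, their combination is the sign of the smooth nowhere zero coefficient
of the action. -/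
theorem isLocallyConstant_sign_cocycle {𝒰 : OpenCover M}
    {σ : 𝒰.sets → ∀ x : M, 𝒢.transverseFibre volumeCharacter x}
    (hσ : ∀ U : 𝒰.sets, 𝒢.IsSmoothOn volumeCharacter (σ U) U.1 ∧ ∀ x ∈ U.1, σ U x ≠ 0) :
    IsLocallyConstant fun p : 𝒢.PullbackArrow 𝒰.proj =>
      signUnit (𝒢.ratio p.1.2.1) * sectionSign σ p.1.2.2 / sectionSign σ p.1.1 := by
  have hne : ∀ q : 𝒰.Total, 𝒢.value volumeCharacter (σ q.1 (𝒰.proj q)) ≠ 0 :=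
    fun q => value_ne_zero.2 ((hσ q.1).2 _ q.2.2)
  refine (IsLocallyConstant.iff_eventually_eq _).2 fun p₀ => ?_
  have hs : 𝒢.src p₀.1.2.1 ∈ p₀.1.2.2.1.1 := p₀.2.2 ▸ p₀.1.2.2.2.2
  have ht : 𝒢.tgt p₀.1.2.1 ∈ p₀.1.1.1.1 := p₀.2.1 ▸ p₀.1.1.2.2
  have hs' := value_ne_zero.2 ((hσ _).2 _ hs)
  have ht' := value_ne_zero.2 ((hσ _).2 _ ht)
  have hg : Continuous fun p : 𝒢.PullbackArrow 𝒰.proj => p.1.2.1 := by fun_prop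
  have h1 := hg.continuousAt.eventually (eventually_signUnit_eq
    (contMDiffAt_coefficient contDiffAt_volumeCharacter (hσ p₀.1.2.2.1).1 (hσ p₀.1.1.1).1
      hs ht ((hσ _).2 _ ht)).continuousAt
    (div_ne_zero (mul_ne_zero (ratio_ne_zero _) hs') ht'))
  have hs1 : Continuous fun p : 𝒢.PullbackArrow 𝒰.proj => p.1.2.2 := by fun_prop
  have ht1 : Continuous fun p : 𝒢.PullbackArrow 𝒰.proj => p.1.1 := by fun_prop
  have key : ∀ p : 𝒢.PullbackArrow 𝒰.proj, p.1.2.2.1 = p₀.1.2.2.1 → p.1.1.1 = p₀.1.1.1 →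
      signUnit (𝒢.ratio p.1.2.1) * sectionSign σ p.1.2.2 / sectionSign σ p.1.1 =
      signUnit (𝒢.ratio p.1.2.1 * 𝒢.value volumeCharacter (σ p₀.1.2.2.1 (𝒢.src p.1.2.1)) /
        𝒢.value volumeCharacter (σ p₀.1.1.1 (𝒢.tgt p.1.2.1))) := by
    intro p e e'
    rw [← e, ← e', p.2.1, p.2.2, signUnit_div (mul_ne_zero (ratio_ne_zero _) (hne _)) (hne _),
      signUnit_mul (ratio_ne_zero _) (hne _)]
    rfl
  filter_upwards [h1, hs1.continuousAt.eventually (OpenCover.eventually_fst_eq p₀.1.2.2),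
    ht1.continuousAt.eventually (OpenCover.eventually_fst_eq p₀.1.1)] with p h1 h2 h3
  rw [key p h2 h3, key p₀ rfl rfl]
  exact h1

theorem isLocallyConstant_sectionSign_div {𝒰 𝒰' 𝒱 : OpenCover M} (h : 𝒰 ≤ 𝒱) (h' : 𝒰' ≤ 𝒱)
    {σ : 𝒰.sets → ∀ x : M, 𝒢.transverseFibre volumeCharacter x}
    (hσ : ∀ U : 𝒰.sets, 𝒢.IsSmoothOn volumeCharacter (σ U) U.1 ∧ ∀ x ∈ U.1, σ U x ≠ 0)
    {σ' : 𝒰'.sets → ∀ x : M, 𝒢.transverseFibre volumeCharacter x}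
    (hσ' : ∀ U : 𝒰'.sets, 𝒢.IsSmoothOn volumeCharacter (σ' U) U.1 ∧ ∀ x ∈ U.1, σ' U x ≠ 0) :
    IsLocallyConstant fun q : 𝒱.Total =>
      sectionSign σ' (OpenCover.refineMap h' q) / sectionSign σ (OpenCover.refineMap h q) := by
  refine (IsLocallyConstant.iff_eventually_eq _).2 fun q₀ => ?_
  have hq : ∀ q : 𝒱.Total, 𝒱.proj q ∈ (OpenCover.refineMap h q).1.1 :=
    fun q => (OpenCover.refineMap h q).2.2
  have hq' : ∀ q : 𝒱.Total, 𝒱.proj q ∈ (OpenCover.refineMap h' q).1.1 :=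
    fun q => (OpenCover.refineMap h' q).2.2
  have hne := fun q => value_ne_zero.2 ((hσ _).2 _ (hq q))
  have hne' := fun q => value_ne_zero.2 ((hσ' _).2 _ (hq' q))
  have h1 := 𝒱.continuous_proj.continuousAt.eventually (eventually_signUnit_eq
    (contMDiffAt_value_div (hσ' _).1 (hσ _).1 (hq' q₀) (hq q₀) ((hσ _).2 _ (hq q₀))).continuousAt
    (div_ne_zero (hne' q₀) (hne q₀)))
  have key : ∀ q : 𝒱.Total, (OpenCover.refineMap h q).1 = (OpenCover.refineMap h q₀).1 →
      (OpenCover.refineMap h' q).1 = (OpenCover.refineMap h' q₀).1 →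
      sectionSign σ' (OpenCover.refineMap h' q) / sectionSign σ (OpenCover.refineMap h q) =
      signUnit (𝒢.value volumeCharacter (σ' (OpenCover.refineMap h' q₀).1 (𝒱.proj q)) /
        𝒢.value volumeCharacter (σ (OpenCover.refineMap h q₀).1 (𝒱.proj q))) := by
    intro q e e'
    rw [← e, ← e', signUnit_div (hne' q) (hne q)]
    rfl
  filter_upwards [h1,
    (OpenCover.continuous_refineMap h).continuousAt.eventually (OpenCover.eventually_fst_eq _),
    (OpenCover.continuous_refineMap h').continuousAt.eventually (OpenCover.eventually_fst_eq _)]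
    with q h1 h2 h3
  rw [key q h2 h3, key q₀ rfl rfl]
  exact h1

/-- The cocycle of the signs of the coefficients of the action in a family of local sections. -/
def signCocycle {𝒰 : OpenCover M} {σ : 𝒰.sets → ∀ x : M, 𝒢.transverseFibre volumeCharacter x}
    (hσ : ∀ U : 𝒰.sets, 𝒢.IsSmoothOn volumeCharacter (σ U) U.1 ∧ ∀ x ∈ U.1, σ U x ≠ 0) :
    (𝒢.pullback 𝒰.proj).discreteCocycles ℤˣ :=
  ⟨fun p => signUnit (𝒢.ratio p.1.2.1) * sectionSign σ p.1.2.2 / sectionSign σ p.1.1,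
    isLocallyConstant_sign_cocycle hσ, fun p q e => by
      have e' : p.1.2.2 = q.1.1 := e
      have hc : 𝒢.src p.1.2.1 = 𝒢.tgt q.1.2.1 := by rw [p.2.2, q.2.1, e']
      simp only [𝒢.pullback_mul_val 𝒰.proj p q e', ratio_mul hc, e',
        signUnit_mul (ratio_ne_zero p.1.2.1) (ratio_ne_zero q.1.2.1)]
      have key : ∀ a b c d e : ℤˣ, a * b * c / d = a * e / d * (b * c / e) := by decide
      exact key _ _ _ _ _⟩

/-- The sign at each arrow is determined by the sections, so the cocycle in the definition of the
class is unique. -/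
theorem eq_signCocycle {𝒰 : OpenCover M}
    {σ : 𝒰.sets → ∀ x : M, 𝒢.transverseFibre volumeCharacter x}
    (hσ : ∀ U : 𝒰.sets, 𝒢.IsSmoothOn volumeCharacter (σ U) U.1 ∧ ∀ x ∈ U.1, σ U x ≠ 0)
    {c : (𝒢.pullback 𝒰.proj).discreteCocycles ℤˣ} :
    (∀ p : 𝒢.PullbackArrow 𝒰.proj, ∃ l : ℝ, 0 < l ∧
      𝒢.transverseAction volumeCharacter p.1.2.1 (σ p.1.2.2.1 (𝒢.src p.1.2.1)) =
        (l * ((c.1 p : ℤ) : ℝ)) • σ p.1.1.1 (𝒢.tgt p.1.2.1)) ↔ c = signCocycle hσ := by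
  rw [Subtype.ext_iff, funext_iff]
  exact forall_congr' fun p => transverseAction_eq_smul_iff (fun U => (hσ U).2) p _

/-- The open sets carrying a smooth nowhere zero section form a cover. Over a common refinement, the
cocycles of two families differ by the coboundary of the sign of the quotient of the sections. -/
theorem existsUnique_isTransverseStiefelWhitneyClass (𝒢 : LieGroupoid n r M G) :
    ∃! w, 𝒢.IsTransverseStiefelWhitneyClass w := by
  let 𝒰 : OpenCover M := ⟨{U | ∃ σ : ∀ x : M, 𝒢.transverseFibre volumeCharacter x,
    𝒢.IsSmoothOn volumeCharacter σ U ∧ ∀ x ∈ U, σ x ≠ 0}, fun x => by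
      obtain ⟨U, σ, hx, hσ, a, X, h⟩ :=
        exists_smooth_local_section (𝒢 := 𝒢) contDiffAt_volumeCharacter x
      exact ⟨U, ⟨σ, hσ, fun y _ => ne_zero_of_apply_ne_zero (a := a y) (X := X y)
        (by rw [h, ofFrame_apply_self]; exact one_ne_zero)⟩, hx⟩⟩
  choose σ hσ using fun U : 𝒰.sets => U.2
  refine ⟨_, ⟨𝒰, σ, hσ, signCocycle hσ, (eq_signCocycle hσ).2 rfl, rfl⟩, ?_⟩
  rintro _ ⟨𝒰', σ', hσ', c', hc', rfl⟩
  obtain rfl := (eq_signCocycle hσ').1 hc'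
  obtain ⟨𝒱, h, h'⟩ := exists_ge_ge 𝒰 𝒰'
  refine (DirectLimit.eq_of_le _ 𝒱 h').trans (Eq.trans ?_ (DirectLimit.eq_of_le _ 𝒱 h).symm)
  refine congrArg (fun z => Quotient.mk _ (⟨𝒱, z⟩ : Σ 𝒱 : OpenCover M, _)) ?_
  refine QuotientGroup.eq.2 ⟨_, isLocallyConstant_sectionSign_div h' h hσ' hσ, fun p => ?_⟩
  have key : ∀ a b c d e : ℤˣ, (a * b / c)⁻¹ * (a * d / e) = d / b / (e / c) := by decide
  exact key _ _ _ _ _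

end LieGroupoid

namespace LieGroupoid

variable {n r : ℕ} {M G : Type*}
  [TopologicalSpace M] [ChartedSpace (EuclideanSpace ℝ (Fin n)) M]
  [TopologicalSpace G] [ChartedSpace (EuclideanSpace ℝ (Fin (r + n))) G]
  {𝒢 : LieGroupoid n r M G}

/-! ### Transverse orientations -/

/-- In a line, being a positive multiple means that the quotient of the values is positive. -/
theorem rayOfNeZero_eq_iff {x : M} {ξ η : 𝒢.transverseFibre volumeCharacter x} (hξ : ξ ≠ 0)
    (hη : η ≠ 0) : rayOfNeZero ℝ ξ hξ = rayOfNeZero ℝ η hη ↔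
      signUnit (𝒢.value volumeCharacter ξ) = signUnit (𝒢.value volumeCharacter η) := by
  have h1 := value_ne_zero.2 hξ
  have h2 := value_ne_zero.2 hη
  rw [ray_eq_iff, ← div_eq_one, ← signUnit_div h1 h2, signUnit_eq_one_iff]
  constructor
  · intro h
    obtain ⟨s, t, hs, ht, h⟩ := h.exists_pos hξ hη
    have h := congrArg (𝒢.value volumeCharacter) h
    rw [value_smul, value_smul] at h
    rw [show 𝒢.value volumeCharacter ξ / 𝒢.value volumeCharacter η = t / s by
      rw [div_eq_div_iff h2 hs.ne']; linarith]
    exact div_pos ht hs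
  · intro h
    have : ξ = (𝒢.value volumeCharacter ξ / 𝒢.value volumeCharacter η) • η := by
      apply value_injective
      rw [value_smul, div_mul_cancel₀ _ h2]
    rw [this]
    exact SameRay.sameRay_pos_smul_left η h

variable (𝒢) in
/-- The element of the transverse volume bundle whose value on the chosen frames is a sign. -/
def ofSign (x : M) (u : ℤˣ) : 𝒢.transverseFibre volumeCharacter x :=
  𝒢.ofFrame volumeCharacter (𝒢.someFrame x) (someTangentFrame x) ((u : ℤ) : ℝ)

theorem value_ofSign (x : M) (u : ℤˣ) :
    𝒢.value volumeCharacter (𝒢.ofSign x u) = ((u : ℤ) : ℝ) := ofFrame_apply_self _ _ _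

theorem ofSign_ne_zero (x : M) (u : ℤˣ) : 𝒢.ofSign x u ≠ 0 :=
  value_ne_zero.1 (by rw [value_ofSign]; exact units_intCast_ne_zero u)

theorem signUnit_value_transverseAction {g : G}
    {ξ : 𝒢.transverseFibre volumeCharacter (𝒢.src g)} (hξ : ξ ≠ 0) :
    signUnit (𝒢.value volumeCharacter (𝒢.transverseAction volumeCharacter g ξ)) =
      signUnit (𝒢.ratio g) * signUnit (𝒢.value volumeCharacter ξ) :=
  signUnit_mul (ratio_ne_zero g) (value_ne_zero.2 hξ)

variable (𝒢) in
/-- The density given by the absolute value of a volume form. -/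
def absDensity {x : M} (ξ : 𝒢.transverseFibre volumeCharacter x) :
    𝒢.transverseFibre densityCharacter x :=
  ⟨fun a X => |ξ.1 a X|, fun a a' X X' => by
    beta_reduce
    rw [transverseFibre_apply ξ a a' X X', abs_mul, abs_mul]
    rfl⟩

theorem value_absDensity {x : M} (ξ : 𝒢.transverseFibre volumeCharacter x) :
    𝒢.value densityCharacter (𝒢.absDensity ξ) = |𝒢.value volumeCharacter ξ| := rfl

theorem absDensity_ne_zero {x : M} {ξ : 𝒢.transverseFibre volumeCharacter x} (hξ : ξ ≠ 0) :
    𝒢.absDensity ξ ≠ 0 :=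
  value_ne_zero.1 (by rw [value_absDensity]; exact abs_ne_zero.2 (value_ne_zero.2 hξ))

variable [IsManifold (𝓡 n) ∞ M] [IsManifold (𝓡 (r + n)) ∞ G]

variable (𝒢) in
/-- The signs, on the chosen frames, of an invariant orientation of the transverse volume bundle. -/
structure IsOrientationSign (ε : M → ℤˣ) : Prop where
  exists_section : ∀ x : M, ∃ U : Opens M, x ∈ U ∧
    ∃ σ : ∀ y : M, 𝒢.transverseFibre volumeCharacter y, 𝒢.IsSmoothOn volumeCharacter σ U ∧
      ∀ y ∈ U, σ y ≠ 0 ∧ signUnit (𝒢.value volumeCharacter (σ y)) = ε y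
  apply_tgt : ∀ g, ε (𝒢.tgt g) = signUnit (𝒢.ratio g) * ε (𝒢.src g)

theorem transverselyOrientable_iff : 𝒢.TransverselyOrientable ↔ ∃ ε, 𝒢.IsOrientationSign ε := by
  constructor
  · rintro ⟨o, ho, hg⟩
    have key : ∀ x (ξ : 𝒢.transverseFibre volumeCharacter x) (hξ : ξ ≠ 0),
        rayOfNeZero ℝ ξ hξ = o x ↔ signUnit (𝒢.value volumeCharacter ξ) =
          signUnit (𝒢.value volumeCharacter (o x).someVector) := fun x ξ hξ => by
      rw [← rayOfNeZero_eq_iff hξ (o x).someVector_ne_zero, Module.Ray.someVector_ray]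
    refine ⟨fun x => signUnit (𝒢.value volumeCharacter (o x).someVector), fun x => ?_, fun g => ?_⟩
    · obtain ⟨U, hx, σ, hσ, h⟩ := ho x
      refine ⟨U, hx, σ, hσ, fun y hy => ?_⟩
      obtain ⟨h0, h1⟩ := h y hy
      exact ⟨h0, (key y _ h0).1 h1⟩
    · obtain ⟨h0, h1⟩ := hg g _ (o (𝒢.src g)).someVector_ne_zero (Module.Ray.someVector_ray _)
      rw [← (key _ _ h0).1 h1, signUnit_value_transverseAction (Module.Ray.someVector_ne_zero _)]
  · rintro ⟨ε, hε, hg⟩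
    have key : ∀ x (ξ : 𝒢.transverseFibre volumeCharacter x) (hξ : ξ ≠ 0),
        rayOfNeZero ℝ ξ hξ = rayOfNeZero ℝ (𝒢.ofSign x (ε x)) (ofSign_ne_zero _ _) ↔
          signUnit (𝒢.value volumeCharacter ξ) = ε x := fun x ξ hξ => by
      rw [rayOfNeZero_eq_iff, value_ofSign, signUnit_intCast]
    refine ⟨fun x => rayOfNeZero ℝ (𝒢.ofSign x (ε x)) (ofSign_ne_zero _ _), fun x => ?_,
      fun g ξ hξ h => ?_⟩
    · obtain ⟨U, hx, σ, hσ, h⟩ := hε x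
      exact ⟨U, hx, σ, hσ, fun y hy => ⟨(h y hy).1, (key y _ _).2 (h y hy).2⟩⟩
    · refine ⟨transverseAction_ne_zero hξ, (key _ _ _).2 ?_⟩
      rw [signUnit_value_transverseAction hξ, (key _ _ _).1 h, hg]

/-- Over the cover by open sets with a section of sign `ε`, the cocycle itself is `1`, by the
invariance of `ε`. -/
theorem IsOrientationSign.isTransverseStiefelWhitneyClass_one {ε : M → ℤˣ}
    (hε : 𝒢.IsOrientationSign ε) : 𝒢.IsTransverseStiefelWhitneyClass 1 := by
  let 𝒰 : OpenCover M := ⟨{U | ∃ σ : ∀ x : M, 𝒢.transverseFibre volumeCharacter x,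
    𝒢.IsSmoothOn volumeCharacter σ U ∧
      ∀ y ∈ U, σ y ≠ 0 ∧ signUnit (𝒢.value volumeCharacter (σ y)) = ε y}, fun x => by
      obtain ⟨U, hx, h⟩ := hε.exists_section x
      exact ⟨U, h, hx⟩⟩
  choose σ hσ using fun U : 𝒰.sets => U.2
  have hσ' : ∀ U : 𝒰.sets, 𝒢.IsSmoothOn volumeCharacter (σ U) U.1 ∧ ∀ x ∈ U.1, σ U x ≠ 0 :=
    fun U => ⟨(hσ U).1, fun x hx => ((hσ U).2 x hx).1⟩
  refine ⟨𝒰, σ, hσ', 1, (eq_signCocycle hσ').2 (Subtype.ext (funext fun p => ?_)),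
    DirectLimit.one_def 𝒰⟩
  have h : ∀ q : 𝒰.Total, sectionSign σ q = ε (𝒰.proj q) := fun q => ((hσ q.1).2 _ q.2.2).2
  change 1 = signUnit (𝒢.ratio p.1.2.1) * sectionSign σ p.1.2.2 / sectionSign σ p.1.1
  rw [h, h, ← p.2.1, ← p.2.2, ← hε.apply_tgt, div_self']

theorem IsSmoothOn.mono {χ : ℝ →*₀ ℝ} {σ : ∀ x : M, 𝒢.transverseFibre χ x} {U V : Opens M}
    (hσ : 𝒢.IsSmoothOn χ σ U) (h : V ≤ U) : 𝒢.IsSmoothOn χ σ V :=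
  fun W hW => hσ W (hW.trans h)

theorem IsSmoothOn.const_smul {χ : ℝ →*₀ ℝ} {σ : ∀ x : M, 𝒢.transverseFibre χ x} {U : Opens M}
    (hσ : 𝒢.IsSmoothOn χ σ U) (k : ℝ) : 𝒢.IsSmoothOn χ (fun x => k • σ x) U :=
  fun W hW a X ha hX => contMDiffOn_const.mul (hσ W hW a X ha hX)

/-- Triviality in the colimit means being the coboundary of some `f` over a finer cover. Correcting
the signs of the sections by `f` makes them invariant under all arrows of the pull-back groupoid. -/
theorem exists_isOrientationSign (h : 𝒢.IsTransverseStiefelWhitneyClass 1) :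
    ∃ ε, 𝒢.IsOrientationSign ε := by
  obtain ⟨𝒰, σ, hσ, c, hc, h⟩ := h
  obtain rfl := (eq_signCocycle hσ).1 hc
  obtain ⟨𝒱, h1, h2, h⟩ := Quotient.exact ((DirectLimit.one_def 𝒰).symm.trans h)
  have h' : 𝒢.cechMap ℤˣ 𝒰 𝒱 h2 (QuotientGroup.mk (signCocycle hσ)) = 1 :=
    h.symm.trans (map_one _)
  obtain ⟨f, hf, hcf⟩ := (QuotientGroup.eq_one_iff _).1 h'
  let e : 𝒱.Total → ℤˣ := fun q => f q * sectionSign σ (OpenCover.refineMap h2 q)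
  have he : ∀ p : 𝒢.PullbackArrow 𝒱.proj, e p.1.1 = signUnit (𝒢.ratio p.1.2.1) * e p.1.2.2 := by
    intro p
    have hp : signUnit (𝒢.ratio p.1.2.1) * sectionSign σ (OpenCover.refineMap h2 p.1.2.2) /
      sectionSign σ (OpenCover.refineMap h2 p.1.1) = f p.1.2.2 / f p.1.1 := hcf p
    have key : ∀ a b c d e : ℤˣ, a * b / c = d / e → e * c = a * (d * b) := by decide
    exact key _ _ _ _ _ hp
  -- A unit, seen as an arrow between two members of the cover, has ratio `1`; hence `e` descends to
  -- `M`.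
  have he' : ∀ q q' : 𝒱.Total, 𝒱.proj q = 𝒱.proj q' → e q = e q' := by
    intro q q' hq
    have := he ⟨(q, 𝒢.unit (𝒱.proj q), q'), 𝒢.tgt_unit _, (𝒢.src_unit _).trans hq⟩
    rwa [ratio_unit, signUnit_eq_one_iff.2 one_pos, one_mul] at this
  have hex : ∀ x, ∃ q : 𝒱.Total, 𝒱.proj q = x := fun x => by
    obtain ⟨V, hV, hx⟩ := 𝒱.covers x
    exact ⟨⟨⟨V, hV⟩, x, hx⟩, rfl⟩
  choose q hq using hex
  refine ⟨fun x => e (q x), fun x => ?_, fun g => he ⟨(q _, g, q _), (hq _).symm, (hq _).symm⟩⟩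
  let V := (q x).1
  -- On the part of `V` where `f` keeps its value at the lift of `x`, the section `f σ` is smooth
  -- and has the sign `e`.
  let U : Opens M := ⟨Subtype.val '' {y : V.1 | f ⟨V, y⟩ = f (q x)},
    V.1.isOpen.isOpenEmbedding_subtypeVal.isOpenMap _
      ((hf.isOpen_fiber (f (q x))).preimage continuous_sigmaMk)⟩
  let U' := (OpenCover.refineMap h2 (q x)).1
  have hUU' : U ≤ U'.1 := by
    rintro _ ⟨y, -, rfl⟩
    exact (OpenCover.refineMap h2 ⟨V, y⟩).2.2
  refine ⟨U, ⟨(q x).2, rfl, hq x⟩, fun y => ((f (q x) : ℤ) : ℝ) • σ U' y,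
    ((hσ U').1.mono hUU').const_smul _, ?_⟩
  intro y hy
  have h0 := (hσ U').2 y (hUU' hy)
  refine ⟨smul_ne_zero (units_intCast_ne_zero _) h0, ?_⟩
  rw [value_smul, signUnit_mul (units_intCast_ne_zero _) (value_ne_zero.2 h0), signUnit_intCast]
  obtain ⟨y, hfy, rfl⟩ := hy
  rw [← he' ⟨V, y⟩ (q y.1) (hq y.1).symm, ← hfy]
  rfl

/-! ### Transverse volume forms -/

theorem IsSmoothOn.absDensity {σ : ∀ x : M, 𝒢.transverseFibre volumeCharacter x} {U : Opens M}
    (hσ : 𝒢.IsSmoothOn volumeCharacter σ U) (h0 : ∀ x ∈ U, σ x ≠ 0) :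
    𝒢.IsSmoothOn densityCharacter (fun x => 𝒢.absDensity (σ x)) U := by
  intro W hW a X ha hX x hx
  exact (contDiffAt_abs (transverseFibre_apply_ne_zero (h0 x (hW hx))
    (a x) (X x))).contMDiffAt.comp_contMDiffWithinAt x (hσ W hW a X ha hX x hx)

theorem AdmitsTransverseVolumeForm.exists_isOrientationSign
    (h : 𝒢.AdmitsTransverseVolumeForm) : ∃ ε, 𝒢.IsOrientationSign ε := by
  obtain ⟨σ, hσ, h0, hinv⟩ := h
  refine ⟨fun x => signUnit (𝒢.value volumeCharacter (σ x)),
    fun x => ⟨⊤, trivial, σ, hσ, fun y _ => ⟨h0 y, rfl⟩⟩, fun g => ?_⟩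
  rw [← hinv g, signUnit_value_transverseAction (h0 _)]

/-- The density `|σ|` is positive and invariant, so its cocycle is zero. -/
theorem AdmitsTransverseVolumeForm.isModularClass_zero (h : 𝒢.AdmitsTransverseVolumeForm) :
    𝒢.IsModularClass 0 := by
  obtain ⟨σ, hσ, h0, hinv⟩ := h
  refine ⟨fun x => 𝒢.absDensity (σ x), hσ.absDensity fun x _ => h0 x, fun x a X =>
    abs_pos.2 (transverseFibre_apply_ne_zero (h0 x) a X), 0, fun g => ?_, rfl⟩
  apply value_injective
  rw [value_absDensity, ← hinv g, value_smul, value_transverseAction, value_transverseAction,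
    value_absDensity, abs_mul]
  change _ = Real.exp 0 * _
  rw [Real.exp_zero, one_mul]
  rfl

theorem admitsTransverseVolumeForm_of_isOrientationSign {ε : M → ℤˣ}
    (hε : 𝒢.IsOrientationSign ε) (h : 𝒢.IsModularClass 0) : 𝒢.AdmitsTransverseVolumeForm := by
  obtain ⟨δ, hδ, hpos, c, hc, h⟩ := h
  obtain ⟨f, hf, hcf⟩ := (Submodule.Quotient.mk_eq_zero _).1 h.symm
  have hv : ∀ x, 0 < 𝒢.value densityCharacter (δ x) := fun x => hpos x _ _
  -- From `δ(y) = e^(f(x) - f(y)) g_* δ(x)` it follows that `e^f δ` is invariant; `t` is its value,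
  -- to which `ε` adds the sign.
  let t : M → ℝ := fun x => Real.exp (f x) * 𝒢.value densityCharacter (δ x)
  have ht : ∀ x, 0 < t x := fun x => mul_pos (Real.exp_pos _) (hv x)
  let τ : ∀ x, 𝒢.transverseFibre volumeCharacter x := fun x => t x • 𝒢.ofSign x (ε x)
  refine ⟨τ, isSmoothOn_of_exists contDiffAt_volumeCharacter fun x₀ _ => ?_,
    fun x => smul_ne_zero (ht x).ne' (ofSign_ne_zero _ _), fun g => ?_⟩
  · obtain ⟨U, hx, σ, hσ, hU⟩ := hε.exists_section x₀
    obtain ⟨a, X, W, hW, haX, hs⟩ := exists_smoothFrames 𝒢 x₀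
    refine ⟨a, X, (haX _ hW).1, (haX _ hW).2, ?_⟩
    have hexp : ContMDiffAt (𝓡 n) 𝓘(ℝ, ℝ) ∞ (fun x => Real.exp (f x)) x₀ :=
      Real.contDiff_exp.contDiffAt.contMDiffAt.comp x₀ hf.contMDiffAt
    have hq := contMDiffAt_value_div hδ (hσ.absDensity fun x hx => (hU x hx).1) (x₀ := x₀)
      trivial hx (absDensity_ne_zero (hU _ hx).1)
    refine ((hexp.mul hq).mul (hs _ σ U hσ x₀ hW hx)).congr_of_eventuallyEq ?_
    filter_upwards [U.isOpen.mem_nhds hx] with y hy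
    have hy0 := value_ne_zero.2 (hU y hy).1
    -- Near `x₀`, `τ` is a smooth multiple of a local section `σ` of the same sign; its smoothness
    -- is not visible in the chosen frames.
    have hτ : τ y = (Real.exp (f y) * (𝒢.value densityCharacter (δ y) /
        𝒢.value densityCharacter (𝒢.absDensity (σ y)))) • σ y := by
      apply value_injective
      rw [value_smul, value_smul, value_ofSign, value_absDensity, ← (hU y hy).2]
      have h1 := signUnit_mul_abs (𝒢.value volumeCharacter (σ y))
      have h2 := abs_ne_zero.2 hy0
      rw [eq_div_of_mul_eq h2 h1]
      ring
    rw [hτ]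
    rfl
  · apply value_injective
    rw [value_transverseAction, value_smul, value_smul, value_ofSign, value_ofSign,
      hε.apply_tgt]
    have h1 := congrArg (𝒢.value densityCharacter) (hc g)
    rw [value_smul, value_transverseAction, hcf, Real.exp_sub] at h1
    have h2 := signUnit_mul_abs (𝒢.ratio g)
    have h3 : t (𝒢.tgt g) = |𝒢.ratio g| * t (𝒢.src g) := by
      change _ = |𝒢.ratio g| * (_ * _)
      simp only [t]
      rw [h1, div_mul_eq_mul_div, mul_div_cancel₀ _ (Real.exp_ne_zero _)]
      exact mul_left_comm _ _ _
    change 𝒢.ratio g * _ = _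
    rw [h3]
    push_cast
    -- The density contributes `|ratio g|` and the orientation `sign (ratio g)`, whose product is
    -- the factor `ratio g` of the volume bundle.
    linear_combination -(t (𝒢.src g) * ((ε (𝒢.src g) : ℤ) : ℝ)) * h2

end LieGroupoid

theorem mainTheorem6 (n r : ℕ) (M G : Type*)
    [TopologicalSpace M] [ChartedSpace (EuclideanSpace ℝ (Fin n)) M]
    [IsManifold (𝓡 n) ∞ M] [T2Space M] [SecondCountableTopology M]
    [TopologicalSpace G] [ChartedSpace (EuclideanSpace ℝ (Fin (r + n))) G]
    [IsManifold (𝓡 (r + n)) ∞ G]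
    (𝒢 : LieGroupoid n r M G) :
    (∃! κ, 𝒢.IsModularClass κ) ∧ (∃! w, 𝒢.IsTransverseStiefelWhitneyClass w) ∧
    (𝒢.TransverselyOrientable ↔ 𝒢.transverseStiefelWhitneyClass = 1) ∧
    (𝒢.AdmitsTransverseVolumeForm ↔
      𝒢.modularClass = 0 ∧ 𝒢.transverseStiefelWhitneyClass = 1) := by
  have hκ := 𝒢.existsUnique_isModularClass
  have hw := 𝒢.existsUnique_isTransverseStiefelWhitneyClass
  -- The class is picked by `epsilon`; existence gives its defining property, and uniqueness
  -- identifies it with any class having that property.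
  have hκ₀ : 𝒢.modularClass = 0 ↔ 𝒢.IsModularClass 0 :=
    ⟨fun h => h ▸ Classical.epsilon_spec hκ.exists,
      fun h => hκ.unique (Classical.epsilon_spec hκ.exists) h⟩
  have hw₁ : 𝒢.transverseStiefelWhitneyClass = 1 ↔ ∃ ε, 𝒢.IsOrientationSign ε :=
    ⟨fun h => LieGroupoid.exists_isOrientationSign (h ▸ Classical.epsilon_spec hw.exists),
      fun ⟨_, h⟩ => hw.unique (Classical.epsilon_spec hw.exists)
        h.isTransverseStiefelWhitneyClass_one⟩
  refine ⟨hκ, hw, LieGroupoid.transverselyOrientable_iff.trans hw₁.symm, ?_⟩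
  rw [hκ₀, hw₁]
  exact ⟨fun h => ⟨h.isModularClass_zero, h.exists_isOrientationSign⟩,
    fun ⟨h, _, hε⟩ => LieGroupoid.admitsTransverseVolumeForm_of_isOrientationSign hε h⟩
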